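/- Let $M$ be a compact smooth $n$-dimensional manifold, possibly with boundary, and let $G=\mathrm{Diff}_0(M)$ be the group of smooth diffeomorphisms of $M$ that are smoothly isotopic to $\mathrm{Id}_M$, with the $C^\infty$ topology. Submanifolds of $M$ lie in the interior of $M$ and are without boundary. A finite family of smooth maps $f_j:N_j\to M$, $j\in J$, is called transverse if for every subset $K\subset J$ the product map $\prod_{j\in K}f_j:\prod_{j\in K}N_j\to M^{|K|}$ is transverse to the small diagonal $\{(y,\dots,y)\}$ of $M^{|K|}$. The family is called transverse to a submanifold $N'$ if the family obtained by adding the inclusion $N'\hookrightarrow M$ is transverse. **(a)** Let $N$ and $N'$ ($N'$ possibly empty) be two transverse compact submanifolds of $M$ of positive codimension, and let $G_{N'}=\{g\in G: g(N')=N'\}$, with the induced topology. Then for generic $g\in G_{N'}$ (that is, for all $g$ in a set containing a countable intersection of dense open subsets of $G_{N'}$) the following holds for every positive integer $d$: the family of embeddings $\{g^{\circ j}:N\to M\}_{j=0}^{d-1}$ is transverse, and this family is transverse to $N'$. Moreover, for each given $d$, the set of $g\in G_{N'}$ with this property is open and dense in $G_{N'}$. **(b)** The same holds if $N$ and $N'$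 are compact submanifolds of positive codimension with conical singularities. This means that $N$ is compact and is a disjoint union of strata such that, near each point $x$ of a stratum $\sigma$ of dimension $p$, there are smooth coordinates of $M$ in which $\sigma$ is $\mathbb R^p\times\{0\}$ and $N$ is $\mathbb R^p\times cL$, where $L$ is (recursively) a compact submanifold of positive codimension with conical singularities in the sphere $S^{n-p-1}$, $cL\subset\mathbb R^{n-p}$ is the cone on $L$ with vertex $0$ (with $cL=\{0\}$ if $L=\emptyset$), and the strata of $N$ of dimension $p+1+i$ are given by the products of $\mathbb R^p$ with the cones, without vertex, on the $i$-dimensional strata of $L$; similarly for $N'$. In this case $N$ and $N'$ are called transverse if every stratum of $N$ is transverse to every stratum of $N'$; $G_{N'}$ is the group of those $g\in G$ that map, for each $p$, the union of the $p$-dimensional strata of $N'$ onto itself; and the transversality properties of the iterates are required for every choice of one stratum in each of the $d$ copies of $N$, and of one stratum of $N'$. -/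

import Mathlib

open scoped Manifold ContDiff

noncomputable section

namespace IterateTransversality

/-- Euclidean space `ℝᵏ`. -/
abbrev Euc (k : ℕ) : Type := EuclideanSpace ℝ (Fin k)

/-- The unit sphere `Sʳ` in `ℝ^(r+1)`. -/
abbrev Sph (r : ℕ) : Type := Metric.sphere (0 : Euc (r + 1)) 1

/-- The cone on a subset `L` of the sphere, without its vertex: all `t • l` with `t > 0`, `l ∈ L`. -/
def puncturedCone {r : ℕ} (L : Set (Sph r)) : Set (Euc (r + 1)) :=
  {z | ∃ t : ℝ, 0 < t ∧ ∃ l ∈ L, z = t • (l : Euc (r + 1))}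

section Manifold

variable {E : Type*} [NormedAddCommGroup E] [NormedSpace ℝ E]
  {H : Type*} [TopologicalSpace H] (I : ModelWithCorners ℝ E H)
  {M : Type*} [TopologicalSpace M] [ChartedSpace H M]

/-! ### Submanifolds -/

/-- `Φ` is a system of smooth coordinates of `M` centred at `x`, with values in an open subset of
`ℝᵖ × ℝ^q`. (Such a system exists only around interior points of `M`, and only if
`p + q = dim M`.) -/
def IsCoordinateSystem {p q : ℕ} (Φ : OpenPartialHomeomorph M (Euc p × Euc q)) (x : M) : Prop :=
  x ∈ Φ.source ∧ Φ x = 0 ∧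
    ContMDiffOn I 𝓘(ℝ, Euc p × Euc q) ∞ Φ Φ.source ∧
    ContMDiffOn 𝓘(ℝ, Euc p × Euc q) I ∞ Φ.symm Φ.target

/-- `N` is a compact smooth submanifold (without boundary, in the interior of `M`) of positive
codimension. Its components may have different dimensions, and `N` may be empty. -/
def IsCompactSubmanifold (N : Set M) : Prop :=
  IsCompact N ∧ ∀ x ∈ N, ∃ p r : ℕ, p + (r + 1) = Module.finrank ℝ E ∧
    ∃ Φ : OpenPartialHomeomorph M (Euc p × Euc (r + 1)), IsCoordinateSystem I Φ x ∧
      ∀ y ∈ Φ.source, (y ∈ N ↔ (Φ y).2 = 0)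

/-- A stratified subset of the `n`-dimensional manifold `M` is given by `S : ℕ → Set M`, where `S p`
is the union of its `p`-dimensional strata. It is compact with conical singularities, relative to a
class `link` of stratified subsets of spheres of dimension `< n`, if its support is compact and if
around each point `x` of a `p`-dimensional stratum there are smooth coordinates in which the
stratum is `ℝᵖ × {0}` and the whole stratified set is `ℝᵖ × cL`, where `cL` is the cone on a
stratified subset `L` of the sphere `Sʳ`, `r = n - p - 1`, belonging to `link`. In these coordinates
the strata other than that of `x` are `ℝᵖ ×` the punctured cones on the strata of `L`. -/
def HasConicalSingularities (n : ℕ) (link : (r : ℕ) → r < n → (ℕ → Set (Sph r)) → Prop)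
    (S : ℕ → Set M) : Prop :=
  IsCompact (⋃ p, S p) ∧ ∀ p, ∀ x ∈ S p, ∃ (r : ℕ) (h : p + (r + 1) = n)
    (L : ℕ → Set (Sph r)) (Φ : OpenPartialHomeomorph M (Euc p × Euc (r + 1))),
      link r (by omega) L ∧ IsCoordinateSystem I Φ x ∧
      ∀ y ∈ Φ.source,
        (∀ j < p, y ∉ S j) ∧
        (y ∈ S p ↔ (Φ y).2 = 0) ∧
        (∀ i, y ∈ S (p + 1 + i) ↔ (Φ y).2 ∈ puncturedCone (L i))

end Manifold

/-- The links: compact submanifolds with conical singularities, of positive codimension, of the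
sphere `Sʳ`, the links of their own strata being of the same kind in lower-dimensional spheres. -/
def IsConicalInSphere (r : ℕ) (L : ℕ → Set (Sph r)) : Prop :=
  HasConicalSingularities (𝓡 r) r (fun r' (_ : r' < r) L' => IsConicalInSphere r' L') L
termination_by r

section Manifold

variable {E : Type*} [NormedAddCommGroup E] [NormedSpace ℝ E]
  {H : Type*} [TopologicalSpace H] (I : ModelWithCorners ℝ E H)
  {M : Type*} [TopologicalSpace M] [ChartedSpace H M]

/-- `S` (with `S p` the union of the `p`-dimensional strata) is a compact submanifold of `M` with
conical singularities and of positive codimension. -/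
def IsConicalSubmanifold (S : ℕ → Set M) : Prop :=
  HasConicalSingularities I (Module.finrank ℝ E) (fun r _ L => IsConicalInSphere r L) S

/-! ### Transversality -/

/-- The tangent space at `x` of a submanifold `S` of `M`: all velocities at `x` of curves in `S`. -/
def tangentVectors (S : Set M) (x : M) : Set (TangentSpace I x) :=
  {v | ∃ γ : ℝ → M, γ 0 = x ∧ (∀ᶠ t in nhds 0, γ t ∈ S) ∧ MDifferentiableAt 𝓘(ℝ, ℝ) I γ 0 ∧
    (mfderiv 𝓘(ℝ, ℝ) I γ 0 (1 : ℝ) : E) = v}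

/-- Two submanifolds are transverse: `T_x S + T_x S' = T_x M` at all common points `x`. -/
def TransverseSubmanifolds (S S' : Set M) : Prop :=
  ∀ x ∈ S ∩ S', ∀ w : TangentSpace I x,
    ∃ v ∈ tangentVectors I S x, ∃ v' ∈ tangentVectors I S' x, w = v + v'

/-- The family of maps `f j : S j → M`, `j ∈ J`, is transverse: for every finite `K ⊆ J` (hence every
`K ⊆ J` if `J` is finite) the product map `∏_{j ∈ K} S j → M^K` is transverse to the small diagonal,
that is, whenever it sends `(x_j)` to a point `(y, …, y)` of the diagonal, the image of its
differential and the diagonal of `(T_y M)^K` together span `(T_y M)^K`: every `w` is the sum of some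
`(df_j v_j)` and some `(u, …, u)`. -/
def TransverseFamily {J : Type*} (f : J → M → M) (S : J → Set M) : Prop :=
  ∀ (K : Finset J) (x : K → M) (y : M), (∀ j : K, x j ∈ S j ∧ f j (x j) = y) →
    ∀ w : K → TangentSpace I y,
      ∃ (v : ∀ j : K, TangentSpace I (x j)) (u : TangentSpace I y), ∀ j : K,
        v j ∈ tangentVectors I (S j) (x j) ∧
        mfderiv I I (f j) (x j) (v j) = w j - u

/-! ### Groups of diffeomorphisms -/

/-- `g` is smoothly isotopic to the identity of `M`. -/
def IsIsotopicToId (g : M ≃ₘ^∞⟮I, I⟯ M) : Prop :=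
  ∃ Φ : ℝ → (M ≃ₘ^∞⟮I, I⟯ M),
    ContMDiffOn (𝓘(ℝ, ℝ).prod I) I ∞ (fun z : ℝ × M => Φ z.1 z.2) (Set.Icc 0 1 ×ˢ Set.univ) ∧
    Φ 0 = Diffeomorph.refl I M ∞ ∧ Φ 1 = g

/-- The diffeomorphisms of `M` isotopic to the identity which leave each of the sets `S' i`
invariant. -/
def diffPreserving {ι : Type*} (S' : ι → Set M) : Set (M ≃ₘ^∞⟮I, I⟯ M) :=
  {g | IsIsotopicToId I g ∧ ∀ i, g '' S' i = S' i}

/-- The basic sets of the smooth topology: the diffeomorphisms `g` mapping `K` into the domain of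
the chart `ψ`, all of whose derivatives of order `≤ r`, read in the charts `φ` and `ψ`, are
`ε`-close to those of `f` on `K`. -/
def smoothBasicSet (f : M ≃ₘ^∞⟮I, I⟯ M) (φ ψ : OpenPartialHomeomorph M H) (K : Set M) (r : ℕ)
    (ε : ℝ) : Set (M ≃ₘ^∞⟮I, I⟯ M) :=
  {g | Set.MapsTo g K ψ.source ∧ ∀ x ∈ K, ∀ k ≤ r,
    ‖iteratedFDerivWithin ℝ k (ψ.extend I ∘ f ∘ (φ.extend I).symm) (φ.extend I).target
        (φ.extend I x) -
      iteratedFDerivWithin ℝ k (ψ.extend I ∘ g ∘ (φ.extend I).symm) (φ.extend I).target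
        (φ.extend I x)‖ < ε}

/-- The `C^∞` topology on the diffeomorphisms of `M` (uniform convergence of all derivatives on
compact sets, in charts). -/
instance smoothTopology : TopologicalSpace (M ≃ₘ^∞⟮I, I⟯ M) :=
  TopologicalSpace.generateFrom
    {U | ∃ (f : M ≃ₘ^∞⟮I, I⟯ M) (φ ψ : OpenPartialHomeomorph M H) (K : Set M) (r : ℕ) (ε : ℝ),
      φ ∈ IsManifold.maximalAtlas I ∞ M ∧ ψ ∈ IsManifold.maximalAtlas I ∞ M ∧
      IsCompact K ∧ K ⊆ φ.source ∧ Set.MapsTo f K ψ.source ∧ 0 < ε ∧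
      U = smoothBasicSet I f φ ψ K r ε}

/-- For a set `N` with strata `S a` and a set `N'` with strata `S' b`: the family of embeddings
`g^j : N → M`, `0 ≤ j < d`, is transverse, and this family is transverse to `N'` (that is, it remains
a transverse family when the inclusion of `N'` is added). For stratified sets this is required for
every choice of one stratum in each copy of `N`, and in `N'`. -/
def IteratesTransverse {ι ι' : Type*} (S : ι → Set M) (S' : ι' → Set M) (d : ℕ)
    (g : M ≃ₘ^∞⟮I, I⟯ M) : Prop :=
  ∀ a : Fin d → ι,
    TransverseFamily I (fun j : Fin d => (⇑g)^[(j : ℕ)]) (fun j => S (a j)) ∧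
    ∀ b : ι', TransverseFamily I
      (fun o : Option (Fin d) => o.elim id (fun j => (⇑g)^[(j : ℕ)]))
      (fun o => o.elim (S' b) (fun j => S (a j)))

end Manifold

end IterateTransversality

end

/-!
Both parts follow from one theorem about stratified sets `S`, `S'` which are locally trivial along
their strata (`IsStratification`); compact submanifolds and compact submanifolds with conical
singularities are of this type. For a diffeomorphism `g` preserving the strata of `S'`, the
transversality of the iterates `g^j : S → M`, `j < d`, and of `S'` means that at every point `x` the
preimages under `g^i`, `i < d`, of the tangent spaces to the strata of `S` at `g^i x`, and the
tangent space to the stratum of `S'` at `x`, are in general position (`OrbitTransverse`,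
`iteratesTransverse_iff`).

This condition is open, because near a point of a stratum the tangent spaces of the other strata
contain approximations of the tangent space of that stratum (Whitney's condition (a), a consequence
of local triviality), and because `g` and its derivative at a point depend continuously on `g` for
the smooth topology; as `M` is compact, it defines an open set of `g`. The residual set is the
intersection over `d` of these open sets, once they are known to be dense.

Density is proved by induction on `d`, and it is a local question (`mem_closure_of_local`). Near a
point of `S` there are coordinates in `P × Z` in which the strata of `S'` are products of `P` with
subsets of `Z`, and in which the translations in `P` are transverse to `S` (`IsPatch`); this uses
the transversality of `S` and `S'`. The maps `(y, z) ↦ (y + t + A (y, z), z)`, cut off outside a small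
neighbourhood, preserve the strata of `S'` and give the perturbations of `g`. If the
neighbourhood does not meet its images under `g, …, g^(m - 1)`, then such a perturbation changes the
iterates up to `g^m` only by composition with one shear. In this way transversality for `m` iterates
becomes transversality for `m + 1` iterates, for almost all `(t, A)`
(`IsPatch.exists_dense_orbitTransverse`). That the neighbourhood can be chosen like this requires
that the points of `S` do not return to themselves too early, which is first achieved by
perturbations of the same kind (`IsStratification.dense_noReturn`), with `A = 0`.

Sard's theorem is not needed here. As the linear part `A` is also a parameter, the bad parameters are
the image, under a smooth map, of a submanifold of smaller dimension (`dimH_badShears_le`), so that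
their Hausdorff dimension is too small for them to contain an open set, even in countable union. Nor
is Baire's theorem, since at each step finitely many open dense sets are intersected.
-/

noncomputable section

open scoped Topology
open Set Filter Module

namespace IterateTransversality

/-! ### Hausdorff dimension of zero sets and of their images -/

/-- A set which, around each of its points, is contained in a level set of a submersion onto `Y`
has Hausdorff dimension at most the dimension of the kernel: by strict differentiability the
linear projection to a complement of dimension `dim W - dim Y` is bi-Lipschitz on the set. -/
theorem dimH_le_of_submersion {W Y : Type*} [NormedAddCommGroup W] [NormedSpace ℝ W]
    [FiniteDimensional ℝ W] [NormedAddCommGroup Y] [NormedSpace ℝ Y] [FiniteDimensional ℝ Y]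
    {T : Set W}
    (h : ∀ w ∈ T, ∃ (ζ : W → Y) (ζ' : W →L[ℝ] Y), HasStrictFDerivAt ζ ζ' w ∧
      Function.Surjective ζ' ∧ ∀ᶠ w' in 𝓝[T] w, ζ w' = 0) :
    dimH T ≤ ((finrank ℝ W - finrank ℝ Y : ℕ) : ENNReal) := by
  by_contra hlt
  push Not at hlt
  obtain ⟨w, hw, H⟩ := exists_mem_nhdsWithin_lt_dimH_of_lt_dimH hlt
  obtain ⟨ζ, ζ', hζ, hsurj, hzero⟩ := h w hw
  -- a linear isomorphism `(ζ', π)`, with `π` a projection onto the kernel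
  obtain ⟨R, hR⟩ := ζ'.toLinearMap.exists_rightInverse_of_surjective
    (LinearMap.range_eq_top.2 hsurj)
  set K := LinearMap.ker ζ'.toLinearMap with hK
  have hfin : finrank ℝ K = finrank ℝ W - finrank ℝ Y := by
    have := LinearMap.finrank_range_add_finrank_ker ζ'.toLinearMap
    rw [LinearMap.range_eq_top.2 hsurj, finrank_top] at this
    exact Nat.eq_sub_of_add_eq' this
  have hRx : ∀ y, ζ' (R y) = y := fun y => by
    have := LinearMap.congr_fun hR y
    simpa using this
  let π : W →ₗ[ℝ] K := LinearMap.codRestrict K (LinearMap.id - R ∘ₗ ζ'.toLinearMap) (by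
    intro x
    simp [hK, LinearMap.mem_ker, hRx])
  have hπ : ∀ x, x = (π x : W) + R (ζ' x) := fun x => by simp [π]
  let R' : Y →L[ℝ] W := LinearMap.toContinuousLinearMap R
  let π' : W →L[ℝ] K := LinearMap.toContinuousLinearMap π
  have hπ' : ∀ x, ‖x‖ ≤ ‖π' x‖ + ‖R'‖ * ‖ζ' x‖ := fun x => by
    calc ‖x‖ = ‖(π x : W) + R (ζ' x)‖ := by rw [← hπ x]
      _ ≤ ‖(π x : W)‖ + ‖R (ζ' x)‖ := norm_add_le _ _
      _ ≤ _ := by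
        gcongr
        · exact le_rfl
        · exact R'.le_opNorm _
  obtain ⟨c, hc, hcR⟩ : ∃ c : ℝ, 0 < c ∧ ‖R'‖ * c ≤ 1 / 2 := by
    refine ⟨1 / (2 * (‖R'‖ + 1)), by positivity, ?_⟩
    rw [mul_one_div, div_le_div_iff₀ (by positivity) (by positivity)]
    nlinarith [norm_nonneg R']
  have hlo : ∀ᶠ p in 𝓝 ((w, w) : W × W), ‖ζ p.1 - ζ p.2 - ζ' (p.1 - p.2)‖ ≤ c * ‖p.1 - p.2‖ :=
    hζ.isLittleO.def hc
  rw [nhds_prod_eq] at hlo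
  obtain ⟨U, hU, hU2⟩ := Filter.eventually_prod_self_iff'.1 hlo
  set t := {w' | ζ w' = 0} ∩ U ∩ T with ht
  have htn : t ∈ 𝓝[T] w :=
    inter_mem (inter_mem hzero (mem_nhdsWithin_of_mem_nhds hU)) self_mem_nhdsWithin
  have hanti : ∀ x ∈ t, ∀ y ∈ t, ‖x - y‖ ≤ 2 * ‖π' x - π' y‖ := by
    intro x hx y hy
    have h1 := hU2 x hx.1.2 y hy.1.2
    have h2 : ‖ζ' (x - y)‖ ≤ c * ‖x - y‖ := by
      have e1 : ζ x = 0 := hx.1.1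
      have e2 : ζ y = 0 := hy.1.1
      simpa only [e1, e2, sub_zero, zero_sub, norm_neg] using h1
    have h3 := hπ' (x - y)
    rw [map_sub π'] at h3
    have h4 : ‖R'‖ * ‖ζ' (x - y)‖ ≤ 1 / 2 * ‖x - y‖ := by
      calc _ ≤ ‖R'‖ * (c * ‖x - y‖) := by gcongr
        _ = (‖R'‖ * c) * ‖x - y‖ := by ring
        _ ≤ _ := by gcongr
    linarith
  have hinj : InjOn π' t := fun x hx y hy hxy => by
    have := hanti x hx y hy
    rw [hxy, sub_self, norm_zero, mul_zero] at this
    exact sub_eq_zero.1 (norm_le_zero_iff.1 this)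
  have hlip : LipschitzOnWith 2 (Function.invFunOn π' t) (π' '' t) := by
    refine LipschitzOnWith.of_dist_le_mul ?_
    rintro _ ⟨x, hx, rfl⟩ _ ⟨y, hy, rfl⟩
    rw [hinj.leftInvOn_invFunOn hx, hinj.leftInvOn_invFunOn hy, dist_eq_norm, dist_eq_norm]
    exact hanti x hx y hy
  have h5 := hlip.dimH_image_le
  rw [hinj.leftInvOn_invFunOn.image_image] at h5
  have h6 : dimH (π' '' t) ≤ finrank ℝ K :=
    (dimH_mono (subset_univ _)).trans (Real.dimH_univ_eq_finrank K).le
  have h7 := H t htn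
  rw [← hfin] at h7
  exact absurd (h5.trans h6) (not_le.2 h7)

theorem dimH_image_le_of_submersion {W Y V : Type*} [NormedAddCommGroup W] [NormedSpace ℝ W]
    [FiniteDimensional ℝ W] [NormedAddCommGroup Y] [NormedSpace ℝ Y] [FiniteDimensional ℝ Y]
    [NormedAddCommGroup V] [NormedSpace ℝ V] {T : Set W} {G : W → V}
    (h : ∀ w ∈ T, ∃ (ζ : W → Y) (ζ' : W →L[ℝ] Y), HasStrictFDerivAt ζ ζ' w ∧
      Function.Surjective ζ' ∧ ∀ᶠ w' in 𝓝[T] w, ζ w' = 0)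
    (hG : ∀ w ∈ T, ∃ G' : W →L[ℝ] V, HasStrictFDerivAt G G' w) :
    dimH (G '' T) ≤ ((finrank ℝ W - finrank ℝ Y : ℕ) : ENNReal) := by
  refine (dimH_image_le_of_locally_lipschitzOn fun w hw => ?_).trans (dimH_le_of_submersion h)
  obtain ⟨G', hG'⟩ := hG w hw
  obtain ⟨C, s, hs, hC⟩ := hG'.exists_lipschitzOnWith
  exact ⟨C, s, mem_nhdsWithin_of_mem_nhds hs, hC⟩

/-! ### Almost every shear is transverse -/

/-- The parameters of the perturbations: a translation vector of `P` and a linear map into `P`. -/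
abbrev ShearParam (P Z : Type*) [NormedAddCommGroup P] [NormedSpace ℝ P] [NormedAddCommGroup Z]
    [NormedSpace ℝ Z] : Type _ := P × (P × Z →L[ℝ] P)

/-- The affine map `(y, z) ↦ (y + t + A (y, z), z)` of `P × Z` with parameter `θ = (t, A)`. It
does not change the coordinate `z`. -/
def shear {P Z : Type*} [NormedAddCommGroup P] [NormedSpace ℝ P] [NormedAddCommGroup Z]
    [NormedSpace ℝ Z] (θ : ShearParam P Z) (x : P × Z) : P × Z := x + (θ.1 + θ.2 x, 0)

section Jets

variable {P Z : Type*} [NormedAddCommGroup P] [NormedSpace ℝ P]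
  [NormedAddCommGroup Z] [NormedSpace ℝ Z]

/-- The linear part `v ↦ v + (A v, 0)` of a shear. -/
def shearLin (A : P × Z →L[ℝ] P) : P × Z →L[ℝ] P × Z :=
  ContinuousLinearMap.id ℝ (P × Z) + (ContinuousLinearMap.inl ℝ P Z).comp A

@[simp] theorem shearLin_apply (A : P × Z →L[ℝ] P) (v : P × Z) :
    shearLin A v = v + (A v, 0) := rfl

theorem shearLin_surjective [FiniteDimensional ℝ P] {A : P × Z →L[ℝ] P} (hA : ‖A‖ < 1) :
    Function.Surjective (shearLin A) := by
  intro w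
  -- on the fibre over `w.2` one has to invert the linear map `e ↦ e + A (e, 0)` of `P`
  have hinj : Function.Injective
      (LinearMap.id + A.toLinearMap ∘ₗ LinearMap.inl ℝ P Z : P →ₗ[ℝ] P) := by
    rw [← LinearMap.ker_eq_bot, LinearMap.ker_eq_bot']
    intro e he
    have h1 : e = - A (e, 0) := by
      have : e + A (e, 0) = 0 := he
      exact eq_neg_of_add_eq_zero_left this
    by_contra hne
    have h2 : ‖e‖ ≤ ‖A‖ * ‖e‖ := by
      calc ‖e‖ = ‖A (e, 0)‖ := by rw [← norm_neg (A (e, 0)), ← h1]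
        _ ≤ ‖A‖ * ‖((e, 0) : P × Z)‖ := A.le_opNorm _
        _ = _ := by simp [Prod.norm_def]
    nlinarith [norm_pos_iff.2 hne]
  obtain ⟨e, he⟩ := (LinearMap.injective_iff_surjective.1 hinj) (w.1 - A (0, w.2))
  have he' : e + A (e, 0) = w.1 - A (0, w.2) := he
  refine ⟨(e, w.2), ?_⟩
  have hA2 : A (e, w.2) = A (e, 0) + A (0, w.2) := by
    rw [← map_add]; simp
  ext1
  · simp only [shearLin_apply, Prod.fst_add, hA2, ← add_assoc, he', sub_add_cancel]
  · simp

variable {Va Vb : Type*} [NormedAddCommGroup Va] [NormedSpace ℝ Va] [NormedAddCommGroup Vb]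
  [NormedSpace ℝ Vb]

/-- The parameters `θ` of the shears which fail to make the zero set of `α` transverse to that of
`β`. -/
def badShears (α : P × Z → Va) (β : P × Z → Vb) (Oa Ob : Set (P × Z)) : Set (ShearParam P Z) :=
  {θ | ‖θ.2‖ < 1 ∧ ∃ x ∈ Oa, α x = 0 ∧ shear θ x ∈ Ob ∧ β (shear θ x) = 0 ∧
    ¬ ∀ a b, ∃ v, fderiv ℝ α x v = a ∧ fderiv ℝ β (shear θ x) (shearLin θ.2 v) = b}

/-- If `0` is a regular value of `β`, and of `α` even along `P × {0}`, then almost all shears make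
the zero sets of `α` and `β` transverse. As the shears have arbitrary `1`-jets in the direction of
`P`, Sard's theorem is not needed: at a bad `θ` there are `x`, the translation
`s = θ.1 + θ.2 x` and a covector `κ` with `κ ∘ (Dα, Dβ ∘ (1 + θ.2)) = 0`. The quadruples
`(x, s, κ, θ.2)` satisfying these equations and a normalization of `κ` form a submanifold of
dimension less than that of the space of parameters, and `θ` is a smooth function of the
quadruple. -/
theorem dimH_badShears_le [FiniteDimensional ℝ P] [FiniteDimensional ℝ Z]
    [FiniteDimensional ℝ Va] [FiniteDimensional ℝ Vb]
    {α : P × Z → Va} {β : P × Z → Vb} {Oa Ob : Set (P × Z)}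
    (hOa : IsOpen Oa) (hOb : IsOpen Ob) (hαs : ContDiffOn ℝ 2 α Oa) (hβs : ContDiffOn ℝ 2 β Ob)
    (hα : ∀ x ∈ Oa, α x = 0 → ∀ a, ∃ e : P, fderiv ℝ α x (e, 0) = a)
    (hβ : ∀ x ∈ Ob, β x = 0 → Function.Surjective (fderiv ℝ β x)) :
    dimH (badShears α β Oa Ob) ≤ ((finrank ℝ (ShearParam P Z) - 1 : ℕ) : ENNReal) := by
  let D := (Va × Vb) →L[ℝ] ℝ
  let W := (P × Z) × P × D × (P × Z →L[ℝ] P)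
  let Y := (Va × Vb) × ((P × Z) →L[ℝ] ℝ) × ℝ
  let bs := Module.finBasis ℝ (Va × Vb)
  let il : Va →L[ℝ] Va × Vb := ContinuousLinearMap.inl ℝ Va Vb
  let ir : Vb →L[ℝ] Va × Vb := ContinuousLinearMap.inr ℝ Va Vb
  let sh : W → P × Z := fun w => w.1 + (w.2.1, 0)
  let eqn : W → ((P × Z) →L[ℝ] ℝ) := fun w =>
    (w.2.2.1.comp il).comp (fderiv ℝ α w.1) +
      (w.2.2.1.comp ir).comp ((fderiv ℝ β (sh w)).comp (shearLin w.2.2.2))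
  let G : W → ShearParam P Z := fun w => (w.2.1 - w.2.2.2 w.1, w.2.2.2)
  let T : Fin (finrank ℝ (Va × Vb)) → Set W := fun i =>
    {w | w.1 ∈ Oa ∧ α w.1 = 0 ∧ sh w ∈ Ob ∧ β (sh w) = 0 ∧ ‖w.2.2.2‖ < 1 ∧ eqn w = 0 ∧
      w.2.2.1 (bs i) = 1}
  have hcover : badShears α β Oa Ob ⊆ ⋃ i, G '' T i := by
    rintro ⟨t, A⟩ ⟨hA, x, hxO, hx0, hxb, hxb0, hns⟩
    let ℓ : (P × Z) →L[ℝ] Va × Vb :=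
      (fderiv ℝ α x).prod ((fderiv ℝ β (shear (t, A) x)).comp (shearLin A))
    have hrange : LinearMap.range ℓ.toLinearMap < ⊤ := by
      rw [lt_top_iff_ne_top]
      intro htop
      apply hns
      intro a b
      obtain ⟨v, hv⟩ := LinearMap.range_eq_top.1 htop (a, b)
      exact ⟨v, congrArg Prod.fst hv, congrArg Prod.snd hv⟩
    obtain ⟨κ0, hκ0, hκ1⟩ := Submodule.exists_le_ker_of_lt_top _ hrange
    obtain ⟨i, hi⟩ : ∃ i, κ0 (bs i) ≠ 0 := by
      by_contra hcon
      push Not at hcon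
      exact hκ0 (bs.ext (by simpa using hcon))
    let κ : D := LinearMap.toContinuousLinearMap ((κ0 (bs i))⁻¹ • κ0)
    refine mem_iUnion.2 ⟨i, (x, t + A x, κ, A), ⟨hxO, hx0, hxb, hxb0, hA, ?_, ?_⟩, ?_⟩
    · refine ContinuousLinearMap.ext fun v => ?_
      have hv : κ0 (ℓ v) = 0 := hκ1 ⟨v, rfl⟩
      have hsum : κ (il (fderiv ℝ α x v)) +
          κ (ir (fderiv ℝ β (shear (t, A) x) (shearLin A v))) = κ (ℓ v) := by
        rw [← map_add]
        congr 1
        simp [il, ir, ℓ]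
      have : κ (ℓ v) = 0 := by
        change (κ0 (bs i))⁻¹ * κ0 (ℓ v) = 0
        rw [hv, mul_zero]
      exact hsum.trans this
    · exact inv_mul_cancel₀ hi
    · simp [G]
  refine (dimH_mono hcover).trans ?_
  rw [dimH_iUnion]
  refine iSup_le fun i => ?_
  have hdim : finrank ℝ W - finrank ℝ Y = finrank ℝ (ShearParam P Z) - 1 := by
    have e1 : finrank ℝ ((P × Z) →L[ℝ] ℝ) = finrank ℝ P + finrank ℝ Z := by
      rw [← (LinearMap.toContinuousLinearMap (𝕜 := ℝ) (E := P × Z) (F' := ℝ)).finrank_eq,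
        Module.finrank_linearMap]
      simp
    have e2 : finrank ℝ D = finrank ℝ Va + finrank ℝ Vb := by
      rw [← (LinearMap.toContinuousLinearMap (𝕜 := ℝ) (E := Va × Vb) (F' := ℝ)).finrank_eq,
        Module.finrank_linearMap]
      simp
    simp only [W, Y, ShearParam, Module.finrank_prod, e1, e2, Module.finrank_self]
    omega
  rw [← hdim]
  have hsmooth : ∀ w ∈ T i, ContDiffAt ℝ 1 eqn w := by
    rintro w ⟨hxO, hx0, hxb, hxb0, hA, heq, hi⟩
    have h1 : ContDiffAt ℝ 1 (fun w : W => fderiv ℝ α w.1) w := by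
      have : ContDiffAt ℝ 1 (fderiv ℝ α) w.1 :=
        ((hαs.contDiffAt (hOa.mem_nhds hxO))).fderiv_right (by norm_num)
      exact this.comp w contDiffAt_fst
    have hsh : ContDiffAt ℝ 1 sh w := by
      have : ContDiff ℝ 1 sh := by fun_prop
      exact this.contDiffAt
    have h2 : ContDiffAt ℝ 1 (fun w : W => fderiv ℝ β (sh w)) w := by
      have : ContDiffAt ℝ 1 (fderiv ℝ β) (sh w) :=
        ((hβs.contDiffAt (hOb.mem_nhds hxb))).fderiv_right (by norm_num)
      exact this.comp w hsh
    have h3 : ContDiff ℝ 1 (fun w : W => shearLin w.2.2.2) :=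
      contDiff_const.add (contDiff_const.clm_comp (by fun_prop))
    have h4 : ContDiff ℝ 1 (fun w : W => w.2.2.1) := by fun_prop
    exact ((h4.clm_comp contDiff_const).contDiffAt.clm_comp h1).add
      ((h4.clm_comp contDiff_const).contDiffAt.clm_comp (h2.clm_comp h3.contDiffAt))
  refine dimH_image_le_of_submersion (Y := Y) (fun w hw => ?_) (fun w hw => ?_)
  · have hsm := (hsmooth w hw).hasStrictFDerivAt one_ne_zero
    obtain ⟨hxO, hx0, hxb, hxb0, hA, heq, hi⟩ := id hw
    have hα' : HasStrictFDerivAt α (fderiv ℝ α w.1) w.1 :=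
      (hαs.contDiffAt (hOa.mem_nhds hxO)).hasStrictFDerivAt two_ne_zero
    have hβ' : HasStrictFDerivAt β (fderiv ℝ β (sh w)) (sh w) :=
      (hβs.contDiffAt (hOb.mem_nhds hxb)).hasStrictFDerivAt two_ne_zero
    let dsh : W →L[ℝ] P × Z := ContinuousLinearMap.fst ℝ _ _ +
      (ContinuousLinearMap.inl ℝ P Z).comp
        ((ContinuousLinearMap.fst ℝ _ _).comp (ContinuousLinearMap.snd ℝ _ _))
    have hdsh : HasStrictFDerivAt sh dsh w := dsh.hasStrictFDerivAt
    let dev : W →L[ℝ] ℝ := (ContinuousLinearMap.apply ℝ ℝ (bs i)).comp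
      ((ContinuousLinearMap.fst ℝ D (P × Z →L[ℝ] P)).comp
        ((ContinuousLinearMap.snd ℝ P (D × (P × Z →L[ℝ] P))).comp
          (ContinuousLinearMap.snd ℝ (P × Z) (P × D × (P × Z →L[ℝ] P)))))
    have hdev : HasStrictFDerivAt (fun w : W => w.2.2.1 (bs i) - 1) dev w :=
      dev.hasStrictFDerivAt.sub_const 1
    refine ⟨fun w => ((α w.1, β (sh w)), eqn w, w.2.2.1 (bs i) - 1), _,
      ((hα'.comp w hasStrictFDerivAt_fst).prodMk (hβ'.comp w hdsh)).prodMk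
        (hsm.prodMk hdev), ?_, ?_⟩
    · -- the derivative of `eqn` in the direction of the linear map
      set ν : P →L[ℝ] ℝ := (w.2.2.1.comp ir).comp
        ((fderiv ℝ β (sh w)).comp (ContinuousLinearMap.inl ℝ P Z)) with hν
      have hpart : ∀ δ : P × Z →L[ℝ] P, fderiv ℝ eqn w (0, 0, 0, δ) = ν.comp δ := by
        intro δ
        let j : ℝ → W := fun t => w + t • ((0, 0, 0, δ) : W)
        have hj0 : j 0 = w := by
          change w + (0 : ℝ) • ((0, 0, 0, δ) : W) = w
          rw [zero_smul, add_zero]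
        have hj : HasDerivAt j ((0, 0, 0, δ) : W) 0 := by
          have := ((hasDerivAt_id (0 : ℝ)).smul_const ((0, 0, 0, δ) : W)).const_add w
          rwa [one_smul] at this
        have h1 : HasDerivAt (eqn ∘ j) (fderiv ℝ eqn w (0, 0, 0, δ)) 0 := by
          have := hsm.hasFDerivAt
          rw [← hj0] at this
          have := this.comp_hasDerivAt (0 : ℝ) hj
          rwa [hj0] at this
        have h2 : eqn ∘ j = fun t => eqn w + t • ν.comp δ := by
          funext t
          have e1 : (j t).1 = w.1 := by
            change w.1 + t • (0 : P × Z) = w.1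
            simp
          have e2 : sh (j t) = sh w := by
            change (j t).1 + (w.2.1 + t • (0 : P), 0) = _
            rw [e1, smul_zero, add_zero]
          have e3 : (j t).2.2.1 = w.2.2.1 := by
            change w.2.2.1 + t • (0 : D) = w.2.2.1
            simp
          have e4 : (j t).2.2.2 = w.2.2.2 + t • δ := rfl
          refine ContinuousLinearMap.ext fun v => ?_
          simp only [Function.comp_apply, eqn, e1, e2, e3, e4, hν, shearLin,
            add_apply, ContinuousLinearMap.comp_apply,
            smul_apply, map_add, map_smul]
          ring
        rw [h2] at h1
        have h3 : HasDerivAt (fun t : ℝ => eqn w + t • ν.comp δ) (ν.comp δ) 0 := by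
          have := ((hasDerivAt_id (0 : ℝ)).smul_const (ν.comp δ)).const_add (eqn w)
          rwa [one_smul] at this
        exact h1.unique h3
      have heqv : ∀ v, w.2.2.1 (il (fderiv ℝ α w.1 v)) +
          w.2.2.1 (ir (fderiv ℝ β (sh w) (shearLin w.2.2.2 v))) = 0 := fun v =>
        congrArg (fun ℓ : (P × Z) →L[ℝ] ℝ => ℓ v) heq
      obtain ⟨e0, he0⟩ : ∃ e0, ν e0 = 1 := by
        suffices h : ∃ e, ν e ≠ 0 by
          obtain ⟨e, he⟩ := h
          exact ⟨(ν e)⁻¹ • e, by simp [he]⟩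
        by_contra hcon
        push Not at hcon
        -- `κ` vanishes on `Va`, by the regularity of `α` along `P`
        have hκa : ∀ a, w.2.2.1 (il a) = 0 := by
          intro a
          obtain ⟨e, he⟩ := hα _ hxO hx0 a
          have h1 := heqv (e, 0)
          have h2 : shearLin w.2.2.2 (e, 0) = (e + w.2.2.2 (e, 0), 0) := by
            ext <;> simp
          have h3 := hcon (e + w.2.2.2 (e, 0))
          rw [he, h2] at h1
          have h4 : w.2.2.1 (ir (fderiv ℝ β (sh w) (e + w.2.2.2 (e, 0), 0))) = 0 := h3
          linarith
        have hκb : ∀ b, w.2.2.1 (ir b) = 0 := by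
          intro b
          obtain ⟨u, hu⟩ := hβ _ hxb hxb0 b
          obtain ⟨v, hv⟩ := shearLin_surjective hA u
          have h1 := heqv v
          rw [hκa, hv, hu, zero_add] at h1
          exact h1
        have : w.2.2.1 (bs i) = 0 := by
          have : bs i = il (bs i).1 + ir (bs i).2 := by simp [il, ir]
          rw [this, map_add, hκa, hκb, add_zero]
        rw [this] at hi
        exact zero_ne_one hi
      rintro ⟨⟨a, b⟩, c, r⟩
      obtain ⟨u, hu⟩ := hβ _ hxb hxb0 b
      obtain ⟨e, he⟩ := hα _ hxO hx0 (a - fderiv ℝ α w.1 u)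
      let δ0 : W := (u + (e, 0), -e, r • w.2.2.1, 0)
      let δA : P × Z →L[ℝ] P := (c - fderiv ℝ eqn w δ0).smulRight e0
      have hνδ : ν.comp δA = c - fderiv ℝ eqn w δ0 := by
        ext v <;> simp [δA, he0]
      refine ⟨δ0 + (0, 0, 0, δA), ?_⟩
      refine Prod.ext (Prod.ext ?_ ?_) (Prod.ext ?_ ?_)
      · change fderiv ℝ α w.1 (u + (e, 0) + 0) = a
        rw [add_zero, map_add, he]
        abel
      · change fderiv ℝ β (sh w) ((u + (e, 0) + 0) + (-e + 0, 0)) = b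
        rw [← hu]
        congr 1
        ext <;> simp
      · change fderiv ℝ eqn w (δ0 + (0, 0, 0, δA)) = c
        rw [map_add, hpart, hνδ]
        abel
      · change (r • w.2.2.1 + 0 : D) (bs i) = r
        rw [add_zero, smul_apply, hi, smul_eq_mul, mul_one]
    · filter_upwards [self_mem_nhdsWithin] with w' hw'
      obtain ⟨_, hx0, _, hxb0, _, heq, hi⟩ := hw'
      simp only [hx0, hxb0, heq, hi, sub_self]
      rfl
  · have : ContDiff ℝ 1 G := by
      refine ContDiff.prodMk (ContDiff.sub (by fun_prop) ?_) (by fun_prop)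
      exact ContDiff.clm_apply (by fun_prop) (by fun_prop)
    exact ⟨_, this.contDiffAt.hasStrictFDerivAt one_ne_zero⟩

end Jets

/-- A countable union of sets of dimension less than that of the space has a dense complement. -/
theorem dense_compl_iUnion_of_dimH_le {V : Type*} [NormedAddCommGroup V] [NormedSpace ℝ V]
    [FiniteDimensional ℝ V] [Nontrivial V] {κ : Type*} [Countable κ] {s : κ → Set V}
    (h : ∀ k, dimH (s k) ≤ ((finrank ℝ V - 1 : ℕ) : ENNReal)) : Dense (⋃ k, s k)ᶜ := by
  apply dense_compl_of_dimH_lt_finrank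
  rw [dimH_iUnion]
  refine (iSup_le h).trans_lt ?_
  have : 0 < finrank ℝ V := finrank_pos
  exact_mod_cast Nat.sub_lt this one_pos

/-! ### Localization of density, and continuity for the smooth topology -/

/-- An open condition on pairs `(g, x)`, with `x` in a compact space, defines an open set of `g`. -/
theorem isOpen_forall_mem_of_isCompact {G X : Type*} [TopologicalSpace G] [TopologicalSpace X]
    {Good : G → X → Prop} (hGood : IsOpen {p : G × X | Good p.1 p.2}) {C : Set X}
    (hC : IsCompact C) : IsOpen {g | ∀ x ∈ C, Good g x} := by
  rw [isOpen_iff_mem_nhds]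
  intro g hg
  exact hC.eventually_forall_of_forall_eventually fun x hx => hGood.mem_nhds (hg x hx)

/-- Local density implies density: if for each `x` all the `g` close to `g0` can be approximated by
elements satisfying an open condition near `x`, then `g0` can be approximated by elements satisfying
the condition everywhere. -/
theorem mem_closure_of_local {G X : Type*} [TopologicalSpace G] [TopologicalSpace X]
    [CompactSpace X] [T2Space X] {Good : G → X → Prop}
    (hGood : IsOpen {p : G × X | Good p.1 p.2}) {g0 : G}
    (h : ∀ x, ∃ C ∈ 𝓝 x, ∀ᶠ g1 in 𝓝 g0, g1 ∈ closure {g | ∀ x ∈ C, Good g x}) :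
    g0 ∈ closure {g | ∀ x, Good g x} := by
  have key : ∃ C : Set X, IsCompact C ∧ univ ⊆ C ∧
      ∀ᶠ g1 in 𝓝 g0, g1 ∈ closure {g | ∀ x ∈ C, Good g x} := by
    refine isCompact_univ.induction_on (p := fun s => ∃ C : Set X, IsCompact C ∧ s ⊆ C ∧
      ∀ᶠ g1 in 𝓝 g0, g1 ∈ closure {g | ∀ x ∈ C, Good g x}) ?_ ?_ ?_ ?_
    · exact ⟨∅, isCompact_empty, subset_rfl, by simp⟩
    · rintro s t hst ⟨C, hC, htC, h⟩
      exact ⟨C, hC, hst.trans htC, h⟩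
    · rintro s t ⟨C, hC, hsC, h1⟩ ⟨C', hC', htC', h2⟩
      refine ⟨C ∪ C', hC.union hC', union_subset_union hsC htC', ?_⟩
      filter_upwards [h1, eventually_eventually_nhds.2 h2] with g1 hg1 hg2
      rw [mem_closure_iff_nhds] at hg1 ⊢
      intro V hV
      obtain ⟨U, hUV, hU, hgU⟩ := mem_nhds_iff.1 (inter_mem hV hg2)
      obtain ⟨g3, hg3U, hg3⟩ := hg1 U (hU.mem_nhds hgU)
      have hO := isOpen_forall_mem_of_isCompact hGood hC
      obtain ⟨g4, hg4, hg4'⟩ := mem_closure_iff.1 (hUV hg3U).2 (U ∩ {g | ∀ x ∈ C, Good g x})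
        (hU.inter hO) ⟨hg3U, hg3⟩
      exact ⟨g4, (hUV hg4.1).1, fun x hx => hx.elim (hg4.2 x) (hg4' x)⟩
    · intro x _
      obtain ⟨C, hC, h⟩ := h x
      obtain ⟨K, hK, hKC, hKc⟩ := local_compact_nhds hC
      refine ⟨K, mem_nhdsWithin_of_mem_nhds hK, K, hKc, subset_rfl, ?_⟩
      filter_upwards [h] with g hg
      exact closure_mono (show {g | ∀ x ∈ C, Good g x} ⊆ {g | ∀ x ∈ K, Good g x} from
        fun g' hg' x hx => hg' x (hKC hx)) hg
  obtain ⟨C, _, hC, h⟩ := key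
  simpa [univ_subset_iff.1 hC] using h.self_of_nhds

/-- The iterated derivatives in the second variable are smooth functions of both variables. -/
theorem contDiffWithinAt_iteratedFDerivWithin_param {V E' F : Type*} [NormedAddCommGroup V]
    [NormedSpace ℝ V] [NormedAddCommGroup E'] [NormedSpace ℝ E'] [NormedAddCommGroup F]
    [NormedSpace ℝ F] {f : V × E' → F} {T : Set E'} (hT : UniqueDiffOn ℝ T) {p : V × E'}
    (hp : p.2 ∈ T) (hf : ContDiffWithinAt ℝ ∞ f (univ ×ˢ T) p) (k : ℕ) :
    ContDiffWithinAt ℝ ∞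
      (fun q : V × E' => iteratedFDerivWithin ℝ k (fun u => f (q.1, u)) T q.2) (univ ×ˢ T) p := by
  induction k with
  | zero =>
    have : (fun q : V × E' => iteratedFDerivWithin ℝ 0 (fun u => f (q.1, u)) T q.2) =
        (continuousMultilinearCurryFin0 ℝ E' F).symm ∘ f := by
      funext q
      simp [iteratedFDerivWithin_zero_eq_comp]
    rw [this]
    exact (continuousMultilinearCurryFin0 ℝ E' F).symm.contDiff.contDiffAt.comp_contDiffWithinAt
      p hf
  | succ k ih =>
    have h1 : ContDiffWithinAt ℝ ∞ (fun q : V × E' =>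
        fderivWithin ℝ (fun u => iteratedFDerivWithin ℝ k (fun u => f (q.1, u)) T u) T q.2)
        (univ ×ˢ T) p := by
      have hps : p ∈ (univ : Set V) ×ˢ T := ⟨mem_univ _, hp⟩
      refine ContDiffWithinAt.fderivWithin (n := ∞) (t := T)
        (f := fun (q : V × E') u => iteratedFDerivWithin ℝ k (fun u => f (q.1, u)) T u)
        (g := fun q => q.2) ?_ contDiffWithinAt_snd hT le_rfl hps (fun q hq => hq.2)
      have h2 : ContDiffWithinAt ℝ ∞ (fun r : (V × E') × E' => (r.1.1, r.2))
          ((univ ×ˢ T) ×ˢ T) (p, p.2) := by fun_prop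
      exact ContDiffWithinAt.comp (p, p.2) (g := fun q : V × E' =>
        iteratedFDerivWithin ℝ k (fun u => f (q.1, u)) T q.2) ih h2
        (fun r (hr : r ∈ ((univ : Set V) ×ˢ T) ×ˢ T) =>
          (⟨mem_univ _, hr.2⟩ : (r.1.1, r.2) ∈ (univ : Set V) ×ˢ T))
    exact (continuousMultilinearCurryLeftEquiv ℝ (fun _ : Fin (k + 1) => E') F).symm.contDiff
      |>.contDiffAt.comp_contDiffWithinAt p h1

section Manifold

variable {E : Type*} [NormedAddCommGroup E] [NormedSpace ℝ E]
  {H : Type*} [TopologicalSpace H] {I : ModelWithCorners ℝ E H}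
  {M : Type*} [TopologicalSpace M] [ChartedSpace H M]

/-- A family of diffeomorphisms depending smoothly on a parameter `θ` is continuous in `θ`, for the
smooth topology. -/
theorem continuousAt_smoothTopology {V : Type*} [NormedAddCommGroup V] [NormedSpace ℝ V]
    {k : V → (M ≃ₘ^∞⟮I, I⟯ M)} {U : Set V} {θ0 : V} (hU : U ∈ 𝓝 θ0)
    (hk : ContMDiffOn (𝓘(ℝ, V).prod I) I ∞ (fun z : V × M => k z.1 z.2) (U ×ˢ univ)) :
    ContinuousAt k θ0 := by
  have hkat : ∀ x : M, ContMDiffAt (𝓘(ℝ, V).prod I) I ∞ (fun z : V × M => k z.1 z.2) (θ0, x) :=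
    fun x => hk.contMDiffAt (prod_mem_nhds hU univ_mem)
  refine TopologicalSpace.tendsto_nhds_generateFrom_iff.2 ?_
  rintro _ ⟨f, φ, ψ, K, r, ε, hφ, hψ, hK, hKφ, hfK, hε, rfl⟩ hk0
  obtain ⟨hk0m, hk0n⟩ := hk0
  -- the local expression of the family in the charts `φ` and `ψ`
  have hT : UniqueDiffOn ℝ (φ.extend I).target := by
    rw [φ.extend_target]
    exact I.uniqueDiffOn_preimage φ.open_target
  have hloc : ∀ (k : V → M → M) (x : M), x ∈ K → k θ0 x ∈ ψ.source →
      ContMDiffAt (𝓘(ℝ, V).prod I) I ∞ (fun z : V × M => k z.1 z.2) (θ0, x) →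
      ContDiffWithinAt ℝ ∞ (fun q : V × E => ψ.extend I (k q.1 ((φ.extend I).symm q.2)))
        (univ ×ˢ (φ.extend I).target) (θ0, φ.extend I x) := by
    intro k x hx hkx hs
    have hxφ : x ∈ (φ.extend I).source := by rw [φ.extend_source]; exact hKφ hx
    have hleft : (φ.extend I).symm (φ.extend I x) = x := (φ.extend I).left_inv hxφ
    have h1 : ContMDiffAt I 𝓘(ℝ, E) ∞ (ψ.extend I) (k θ0 x) :=
      ψ.contMDiffAt_extend hψ hkx
    have h2 : ContMDiffWithinAt 𝓘(ℝ, E) I ∞ (φ.extend I).symm (φ.extend I).target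
        (φ.extend I x) := by
      have := contMDiffOn_extend_symm hφ
      rw [φ.extend_target']
      exact this _ ⟨φ x, φ.map_source (hKφ hx), rfl⟩
    have h3 : ContMDiffWithinAt (𝓘(ℝ, V).prod 𝓘(ℝ, E)) (𝓘(ℝ, V).prod I) ∞
        (fun q : V × E => (q.1, (φ.extend I).symm q.2)) (univ ×ˢ (φ.extend I).target)
        (θ0, φ.extend I x) := by
      refine contMDiffWithinAt_fst.prodMk ?_
      exact h2.comp (θ0, φ.extend I x) (f := Prod.snd) contMDiffWithinAt_snd (fun q hq => hq.2)
    have h4 : ContMDiffWithinAt (𝓘(ℝ, V).prod 𝓘(ℝ, E)) 𝓘(ℝ, E) ∞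
        (fun q : V × E => ψ.extend I (k q.1 ((φ.extend I).symm q.2)))
        (univ ×ˢ (φ.extend I).target) (θ0, φ.extend I x) := by
      have hs' : ContMDiffAt (𝓘(ℝ, V).prod I) I ∞ (fun z : V × M => k z.1 z.2)
          (θ0, (φ.extend I).symm (φ.extend I x)) := by rw [hleft]; exact hs
      have h5 := hs'.comp_contMDiffWithinAt (θ0, φ.extend I x) h3
      refine ContMDiffAt.comp_contMDiffWithinAt (θ0, φ.extend I x) ?_ h5
      simp only [hleft]
      exact h1
    rw [← modelWithCornersSelf_prod] at h4
    exact (contMDiffWithinAt_iff_contDiffWithinAt (n := ∞)).1 (by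
      rwa [chartedSpaceSelf_prod] at h4)
  have hcont : ∀ (k : V → M → M) (x : M), x ∈ K → k θ0 x ∈ ψ.source →
      ContMDiffAt (𝓘(ℝ, V).prod I) I ∞ (fun z : V × M => k z.1 z.2) (θ0, x) → ∀ i : ℕ,
      ContinuousWithinAt (fun z : V × M => iteratedFDerivWithin ℝ i
        (ψ.extend I ∘ k z.1 ∘ (φ.extend I).symm) (φ.extend I).target (φ.extend I z.2))
        (univ ×ˢ φ.source) (θ0, x) := by
    intro k x hx hkx hs i
    have hxφ : x ∈ (φ.extend I).source := by rw [φ.extend_source]; exact hKφ hx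
    have h1 := (contDiffWithinAt_iteratedFDerivWithin_param hT
      (p := (θ0, φ.extend I x)) ((φ.extend I).map_source hxφ) (hloc k x hx hkx hs) i)
      |>.continuousWithinAt
    have h2 : ContinuousWithinAt (fun z : V × M => (z.1, φ.extend I z.2)) (univ ×ˢ φ.source)
        (θ0, x) := by
      refine continuousWithinAt_fst.prodMk ?_
      have h3 : ContinuousAt (φ.extend I) x := φ.continuousAt_extend (hKφ hx)
      exact h3.comp_continuousWithinAt (f := Prod.snd) (x := (θ0, x)) continuousWithinAt_snd
    exact ContinuousWithinAt.comp (g := fun q : V × E => iteratedFDerivWithin ℝ i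
      (fun u => ψ.extend I (k q.1 ((φ.extend I).symm u))) (φ.extend I).target q.2)
      (x := (θ0, x)) h1 h2 (fun z (hz : z ∈ (univ : Set V) ×ˢ φ.source) =>
        (⟨mem_univ _, (φ.extend I).map_source (by rw [φ.extend_source]; exact hz.2)⟩ :
          (z.1, φ.extend I z.2) ∈ (univ : Set V) ×ˢ (φ.extend I).target))
  have hall : ∀ x ∈ K, ∀ᶠ z : V × M in 𝓝 (θ0, x), z.2 ∈ K →
      k z.1 z.2 ∈ ψ.source ∧ ∀ i ≤ r,
        ‖iteratedFDerivWithin ℝ i (ψ.extend I ∘ f ∘ (φ.extend I).symm) (φ.extend I).target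
          (φ.extend I z.2) -
        iteratedFDerivWithin ℝ i (ψ.extend I ∘ k z.1 ∘ (φ.extend I).symm) (φ.extend I).target
          (φ.extend I z.2)‖ < ε := by
    intro x hx
    have hopen : (univ : Set V) ×ˢ φ.source ∈ 𝓝 (θ0, x) :=
      prod_mem_nhds univ_mem (φ.open_source.mem_nhds (hKφ hx))
    have h1 : ∀ᶠ z : V × M in 𝓝 (θ0, x), k z.1 z.2 ∈ ψ.source :=
      (hkat x).continuousAt.eventually_mem (ψ.open_source.mem_nhds (hk0m hx))
    have h2 : ∀ i ∈ Finset.range (r + 1), ∀ᶠ z : V × M in 𝓝 (θ0, x),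
        ‖iteratedFDerivWithin ℝ i (ψ.extend I ∘ f ∘ (φ.extend I).symm) (φ.extend I).target
          (φ.extend I z.2) -
        iteratedFDerivWithin ℝ i (ψ.extend I ∘ k z.1 ∘ (φ.extend I).symm) (φ.extend I).target
          (φ.extend I z.2)‖ < ε := by
      intro i hi
      have c1 := (hcont (fun _ => f) x hx (hfK hx)
        (f.contMDiff.contMDiffAt.comp (θ0, x) (f := Prod.snd) contMDiffAt_snd) i).continuousAt hopen
      have c2 := (hcont (fun θ => k θ) x hx (hk0m hx) (hkat x) i).continuousAt hopen
      exact (c1.sub c2).norm.eventually_lt_const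
        (hk0n x hx i (Nat.lt_succ_iff.1 (Finset.mem_range.1 hi)))
    filter_upwards [h1, (Finset.eventually_all _).2 h2] with z hz1 hz2 _
    exact ⟨hz1, fun i hi => hz2 i (Finset.mem_range.2 (Nat.lt_succ_of_le hi))⟩
  have := hK.eventually_forall_of_forall_eventually (P := fun θ x => x ∈ K → k θ x ∈ ψ.source ∧
    ∀ i ≤ r, ‖iteratedFDerivWithin ℝ i (ψ.extend I ∘ f ∘ (φ.extend I).symm) (φ.extend I).target
      (φ.extend I x) - iteratedFDerivWithin ℝ i (ψ.extend I ∘ k θ ∘ (φ.extend I).symm)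
      (φ.extend I).target (φ.extend I x)‖ < ε) hall
  filter_upwards [this] with θ hθ
  exact ⟨fun x hx => (hθ x hx hx).1, fun x hx => (hθ x hx hx).2⟩

end Manifold

/-! ### Joint continuity of the iterates and of their derivatives -/

section Manifold

variable {E : Type*} [NormedAddCommGroup E] [NormedSpace ℝ E]
  {H : Type*} [TopologicalSpace H] {I : ModelWithCorners ℝ E H}
  {M : Type*} [TopologicalSpace M] [ChartedSpace H M]

/-- The derivative of `g` at `x`, read in the preferred charts at `x0` and `y0`. -/
def chartDeriv (I : ModelWithCorners ℝ E H) (x0 y0 : M) (g : M → M) (x : M) : E →L[ℝ] E :=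
  fderivWithin ℝ (extChartAt I y0 ∘ g ∘ (extChartAt I x0).symm) (extChartAt I x0).target
    (extChartAt I x0 x)

/-- The derivative of `g : M → M` at `x`, as an endomorphism of the model space of the tangent
spaces. -/
def mapD (I : ModelWithCorners ℝ E H) (g : M → M) (x : M) : E →L[ℝ] E := mfderiv I I g x

/-- The coordinates of tangent vectors at `x` given by the preferred chart at `x0`. -/
def tangentCoord (I : ModelWithCorners ℝ E H) (x0 x : M) : E →L[ℝ] E :=
  (mfderiv I 𝓘(ℝ, E) (extChartAt I x0) x : E →L[ℝ] E)

theorem uniqueDiffOn_extChartAt_target (x : M) : UniqueDiffOn ℝ (extChartAt I x).target := by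
  rw [extChartAt, OpenPartialHomeomorph.extend_target]
  exact I.uniqueDiffOn_preimage (chartAt H x).open_target

theorem contMDiff_iterate (g : M ≃ₘ^∞⟮I, I⟯ M) (i : ℕ) : ContMDiff I I ∞ (⇑g)^[i] := by
  induction i with
  | zero => exact contMDiff_id
  | succ i ih =>
    rw [Function.iterate_succ']
    exact g.contMDiff.comp ih

theorem mapD_iterate_succ (g : M ≃ₘ^∞⟮I, I⟯ M) (i : ℕ) (x : M) (v : E) :
    mapD I (⇑g)^[i + 1] x v =
      (mapD I g ((⇑g)^[i] x)) (mapD I (⇑g)^[i] x v) := by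
  rw [Function.iterate_succ', mapD, mfderiv_comp x
    (g.contMDiff.contMDiffAt.mdifferentiableAt (by norm_cast))
    ((contMDiff_iterate g i).contMDiffAt.mdifferentiableAt (by norm_cast))]
  rfl

variable [IsManifold I ∞ M]

theorem tangentCoord_bijective {x0 x : M} (hx : x ∈ (chartAt H x0).source) :
    Function.Bijective (tangentCoord I x0 x) := by
  have : IsManifold I 1 M := IsManifold.of_le (n := ∞) (by norm_cast)
  have := isInvertible_mfderiv_extChartAt (I := I) (x := x0) (y := x) (by simpa using hx)
  exact this.bijective

theorem contDiffWithinAt_chartExpr {g : M → M} (hg : ContMDiff I I ∞ g) {x0 y0 x : M}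
    (hx : x ∈ (chartAt H x0).source) (hy : g x ∈ (chartAt H y0).source) :
    ContDiffWithinAt ℝ ∞ (extChartAt I y0 ∘ g ∘ (extChartAt I x0).symm) (extChartAt I x0).target
      (extChartAt I x0 x) := by
  have hx' : x ∈ (extChartAt I x0).source := by simpa using hx
  have hleft : (extChartAt I x0).symm (extChartAt I x0 x) = x := (extChartAt I x0).left_inv hx'
  have h2 : ContMDiffWithinAt 𝓘(ℝ, E) I ∞ (extChartAt I x0).symm (extChartAt I x0).target
      (extChartAt I x0 x) := contMDiffOn_extChartAt_symm x0 _ ((extChartAt I x0).map_source hx')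
  have h3 : ContMDiffAt I 𝓘(ℝ, E) ∞ (extChartAt I y0) (g x) := contMDiffAt_extChartAt' hy
  have h4 : ContMDiffAt I 𝓘(ℝ, E) ∞ (extChartAt I y0 ∘ g)
      ((extChartAt I x0).symm (extChartAt I x0 x)) := by
    rw [hleft]
    exact h3.comp x hg.contMDiffAt
  exact (h4.comp_contMDiffWithinAt _ h2).contDiffWithinAt

/-- The chain rule, in the preferred charts. -/
theorem tangentCoord_mfderiv {g : M → M} (hg : ContMDiff I I ∞ g) {x0 y0 x : M}
    (hx : x ∈ (chartAt H x0).source) (hy : g x ∈ (chartAt H y0).source) (v : E) :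
    tangentCoord I y0 (g x) (mapD I g x v) =
      chartDeriv I x0 y0 g x (tangentCoord I x0 x v) := by
  have hM : IsManifold I 1 M := IsManifold.of_le (n := ∞) (by norm_cast)
  set F := extChartAt I y0 ∘ g ∘ (extChartAt I x0).symm with hF
  have h1 : HasMFDerivWithinAt 𝓘(ℝ, E) 𝓘(ℝ, E) F (extChartAt I x0).target (extChartAt I x0 x)
      (fderivWithin ℝ F (extChartAt I x0).target (extChartAt I x0 x)) :=
    ((contDiffWithinAt_chartExpr hg hx hy).differentiableWithinAt
      (by norm_cast)).hasFDerivWithinAt.hasMFDerivWithinAt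
  have h2 : HasMFDerivWithinAt I 𝓘(ℝ, E) (extChartAt I x0) (chartAt H x0).source x
      (mfderiv I 𝓘(ℝ, E) (extChartAt I x0) x) :=
    (mdifferentiableAt_extChartAt hx).hasMFDerivAt.hasMFDerivWithinAt
  have hsrc : (chartAt H x0).source ∈ 𝓝 x := (chartAt H x0).open_source.mem_nhds hx
  have h3 := (h1.comp x h2 (fun z hz => (extChartAt I x0).map_source (by simpa using hz)))
    |>.hasMFDerivAt hsrc
  have h4 : HasMFDerivAt I 𝓘(ℝ, E) (extChartAt I y0 ∘ g) x
      ((mfderiv I 𝓘(ℝ, E) (extChartAt I y0) (g x)).comp (mfderiv I I g x)) :=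
    (mdifferentiableAt_extChartAt hy).hasMFDerivAt.comp x
      (hg.contMDiffAt.mdifferentiableAt (by norm_cast)).hasMFDerivAt
  have h5 : F ∘ extChartAt I x0 =ᶠ[𝓝 x] extChartAt I y0 ∘ g := by
    filter_upwards [hsrc] with z hz
    simp only [hF, Function.comp_apply]
    rw [(extChartAt I x0).left_inv (by simpa using hz)]
  have h6 := hasMFDerivAt_unique h4 (h3.congr_of_eventuallyEq h5.symm)
  exact congrArg (fun L : E →L[ℝ] E => L v) h6

variable [LocallyCompactSpace M]

/-- The basic open sets of order `1` control the values and the first derivatives, read in the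
preferred charts at `x0` and `g0 x0`. -/
theorem eventually_close (g0 : M ≃ₘ^∞⟮I, I⟯ M) (x0 : M) {ε : ℝ} (hε : 0 < ε) :
    ∀ᶠ p : (M ≃ₘ^∞⟮I, I⟯ M) × M in 𝓝 (g0, x0), p.2 ∈ (chartAt H x0).source ∧
      p.1 p.2 ∈ (chartAt H (g0 x0)).source ∧
      ‖extChartAt I (g0 x0) (p.1 p.2) - extChartAt I (g0 x0) (g0 p.2)‖ < ε ∧
      ‖chartDeriv I x0 (g0 x0) p.1 p.2 - chartDeriv I x0 (g0 x0) g0 p.2‖ ≤ ε := by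
  set φ := chartAt H x0
  set ψ := chartAt H (g0 x0)
  have hO : φ.source ∩ g0 ⁻¹' ψ.source ∈ 𝓝 x0 :=
    inter_mem (φ.open_source.mem_nhds (mem_chart_source H x0))
      (g0.continuous.continuousAt (ψ.open_source.mem_nhds (mem_chart_source H (g0 x0))))
  obtain ⟨K, hK, hKO, hKc⟩ := local_compact_nhds hO
  have hopen : IsOpen (smoothBasicSet I g0 φ ψ K 1 ε) :=
    TopologicalSpace.isOpen_generateFrom_of_mem ⟨g0, φ, ψ, K, 1, ε,
      IsManifold.chart_mem_maximalAtlas x0, IsManifold.chart_mem_maximalAtlas (g0 x0), hKc,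
      fun x hx => (hKO hx).1, fun x hx => (hKO hx).2, hε, rfl⟩
  have hg0 : g0 ∈ smoothBasicSet I g0 φ ψ K 1 ε :=
    ⟨fun x hx => (hKO hx).2, fun x _ k _ => by simpa using hε⟩
  filter_upwards [prod_mem_nhds (hopen.mem_nhds hg0) hK] with p hp
  obtain ⟨⟨hpm, hpn⟩, hpK⟩ := hp
  refine ⟨(hKO hpK).1, hpm hpK, ?_, ?_⟩
  · have h := hpn p.2 hpK 0 zero_le_one
    rw [iteratedFDerivWithin_zero_eq_comp, iteratedFDerivWithin_zero_eq_comp] at h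
    simp only [Function.comp_apply] at h
    rw [← map_sub, LinearIsometryEquiv.norm_map] at h
    have hleft : (φ.extend I).symm (φ.extend I p.2) = p.2 :=
      (φ.extend I).left_inv (by rw [φ.extend_source]; exact (hKO hpK).1)
    rw [hleft] at h
    rw [norm_sub_rev]
    exact h
  · have h := hpn p.2 hpK 1 le_rfl
    have hu : UniqueDiffWithinAt ℝ (φ.extend I).target (φ.extend I p.2) :=
      uniqueDiffOn_extChartAt_target x0 _
        ((φ.extend I).map_source (by rw [φ.extend_source]; exact (hKO hpK).1))
    refine ContinuousLinearMap.opNorm_le_bound _ hε.le fun v => ?_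
    have h1 := (ContinuousMultilinearMap.le_opNorm
      (iteratedFDerivWithin ℝ 1 (ψ.extend I ∘ g0 ∘ (φ.extend I).symm) (φ.extend I).target
        (φ.extend I p.2) - iteratedFDerivWithin ℝ 1 (ψ.extend I ∘ p.1 ∘ (φ.extend I).symm)
        (φ.extend I).target (φ.extend I p.2)) (fun _ => v))
    rw [sub_apply, iteratedFDerivWithin_one_apply hu,
      iteratedFDerivWithin_one_apply hu] at h1
    rw [norm_sub_rev] at h1
    refine (le_trans h1 ?_ : _)
    simp only [Finset.univ_unique, Finset.prod_singleton]
    gcongr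

/-- Evaluation of diffeomorphisms is jointly continuous for the smooth topology. -/
theorem continuous_eval : Continuous (fun p : (M ≃ₘ^∞⟮I, I⟯ M) × M => p.1 p.2) := by
  rw [continuous_iff_continuousAt]
  rintro ⟨g0, x0⟩
  have h1 : Tendsto (fun p : (M ≃ₘ^∞⟮I, I⟯ M) × M => extChartAt I (g0 x0) (p.1 p.2))
      (𝓝 (g0, x0)) (𝓝 (extChartAt I (g0 x0) (g0 x0))) := by
    have hc : Tendsto (fun p : (M ≃ₘ^∞⟮I, I⟯ M) × M => extChartAt I (g0 x0) (g0 p.2))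
        (𝓝 (g0, x0)) (𝓝 (extChartAt I (g0 x0) (g0 x0))) :=
      ContinuousAt.comp (x := (g0, x0)) (f := fun p : (M ≃ₘ^∞⟮I, I⟯ M) × M => g0 p.2)
        (continuousAt_extChartAt (g0 x0))
        (g0.continuous.comp continuous_snd).continuousAt
    have hd : Tendsto (fun p : (M ≃ₘ^∞⟮I, I⟯ M) × M =>
        extChartAt I (g0 x0) (p.1 p.2) - extChartAt I (g0 x0) (g0 p.2)) (𝓝 (g0, x0)) (𝓝 0) := by
      rw [Metric.tendsto_nhds]
      intro ε hε
      filter_upwards [eventually_close g0 x0 hε] with p hp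
      rw [dist_zero_right]
      exact hp.2.2.1
    simpa using hd.add hc
  have h2 := (continuousAt_extChartAt_symm (I := I) (g0 x0)).tendsto.comp h1
  rw [(extChartAt I (g0 x0)).left_inv (mem_extChartAt_source (g0 x0))] at h2
  refine h2.congr' ?_
  filter_upwards [eventually_close g0 x0 one_pos] with p hp
  exact (extChartAt I (g0 x0)).left_inv (by simpa using hp.2.1)

theorem continuous_eval_iterate (i : ℕ) :
    Continuous (fun p : (M ≃ₘ^∞⟮I, I⟯ M) × M => (⇑p.1)^[i] p.2) := by
  induction i with
  | zero => exact continuous_snd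
  | succ i ih =>
    simp only [Function.iterate_succ_apply']
    exact continuous_eval.comp (continuous_fst.prodMk ih)

theorem continuousAt_chartDeriv (g0 : M ≃ₘ^∞⟮I, I⟯ M) (x0 : M) :
    ContinuousAt (fun p : (M ≃ₘ^∞⟮I, I⟯ M) × M => chartDeriv I x0 (g0 x0) p.1 p.2) (g0, x0) := by
  have hc : Tendsto (fun p : (M ≃ₘ^∞⟮I, I⟯ M) × M => chartDeriv I x0 (g0 x0) g0 p.2)
      (𝓝 (g0, x0)) (𝓝 (chartDeriv I x0 (g0 x0) g0 x0)) := by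
    have h1 : ContDiffWithinAt ℝ 0 (fderivWithin ℝ
        (extChartAt I (g0 x0) ∘ g0 ∘ (extChartAt I x0).symm) (extChartAt I x0).target)
        (extChartAt I x0).target (extChartAt I x0 x0) :=
      (contDiffWithinAt_chartExpr g0.contMDiff (mem_chart_source H x0)
        (mem_chart_source H (g0 x0))).fderivWithin_right (uniqueDiffOn_extChartAt_target x0)
        (by norm_cast) (mem_extChartAt_target x0)
    have h2 : ContinuousAt (fun x => chartDeriv I x0 (g0 x0) g0 x) x0 := by
      have hs : (extChartAt I x0).source ∈ 𝓝 x0 := extChartAt_source_mem_nhds x0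
      refine ContinuousWithinAt.continuousAt ?_ hs
      exact h1.continuousWithinAt.comp (f := extChartAt I x0) (x := x0)
        (continuousAt_extChartAt x0).continuousWithinAt
        (fun z hz => (extChartAt I x0).map_source hz)
    exact h2.tendsto.comp (continuous_snd.tendsto' _ _ rfl)
  have hd : Tendsto (fun p : (M ≃ₘ^∞⟮I, I⟯ M) × M =>
      chartDeriv I x0 (g0 x0) p.1 p.2 - chartDeriv I x0 (g0 x0) g0 p.2) (𝓝 (g0, x0)) (𝓝 0) := by
    rw [Metric.tendsto_nhds]
    intro ε hε
    filter_upwards [eventually_close g0 x0 (half_pos hε)] with p hp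
    rw [dist_zero_right]
    exact hp.2.2.2.trans_lt (half_lt_self hε)
  have := hd.add hc
  simpa [ContinuousAt] using this

/-- The derivatives of the iterates of `g` depend continuously on `g` and on the point: read in
charts they are given by a continuous matrix. -/
theorem exists_continuousAt_deriv_iterate (g0 : M ≃ₘ^∞⟮I, I⟯ M) (x0 : M) (i : ℕ) :
    ∃ D : (M ≃ₘ^∞⟮I, I⟯ M) × M → (E →L[ℝ] E), ContinuousAt D (g0, x0) ∧
      ∀ᶠ p : (M ≃ₘ^∞⟮I, I⟯ M) × M in 𝓝 (g0, x0), ∀ v : E,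
        tangentCoord I ((⇑g0)^[i] x0) ((⇑p.1)^[i] p.2)
          (mapD I (⇑p.1)^[i] p.2 v) = D p (tangentCoord I x0 p.2 v) := by
  induction i with
  | zero =>
    refine ⟨fun _ => ContinuousLinearMap.id ℝ E, continuousAt_const, Eventually.of_forall ?_⟩
    intro p v
    simp only [Function.iterate_zero, id, ContinuousLinearMap.id_apply]
    have : mapD I (id : M → M) p.2 = ContinuousLinearMap.id ℝ E := mfderiv_id
    rw [this]
    rfl
  | succ i ih =>
    obtain ⟨D, hD, hDe⟩ := ih
    have hit : Tendsto (fun p : (M ≃ₘ^∞⟮I, I⟯ M) × M => (p.1, (⇑p.1)^[i] p.2)) (𝓝 (g0, x0))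
        (𝓝 (g0, (⇑g0)^[i] x0)) :=
      (continuous_fst.prodMk (continuous_eval_iterate i)).tendsto' _ _ rfl
    refine ⟨fun p => (chartDeriv I ((⇑g0)^[i] x0) (g0 ((⇑g0)^[i] x0)) p.1
      ((⇑p.1)^[i] p.2)).comp (D p), ?_, ?_⟩
    · exact ContinuousAt.clm_comp
        (Tendsto.comp (continuousAt_chartDeriv g0 ((⇑g0)^[i] x0)).tendsto hit) hD
    · filter_upwards [hDe, hit.eventually (eventually_close g0 ((⇑g0)^[i] x0) one_pos)]
        with p hp hp2 v
      rw [mapD_iterate_succ, ContinuousLinearMap.comp_apply, ← hp v,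
        Function.iterate_succ_apply', Function.iterate_succ_apply']
      exact tangentCoord_mfderiv p.1.contMDiff hp2.1 hp2.2.1 _

end Manifold

/-! ### Stratified sets and their defining functions -/

section Manifold

variable {E : Type*} [NormedAddCommGroup E] [NormedSpace ℝ E]
  {H : Type*} [TopologicalSpace H] (I : ModelWithCorners ℝ E H)
  {M : Type*} [TopologicalSpace M] [ChartedSpace H M]

section Charts

variable {F : Type*} [NormedAddCommGroup F] [NormedSpace ℝ F]

/-- `Φ` is a diffeomorphism of open subsets of `M` and of a normed space. -/
structure IsSmoothChart (Φ : OpenPartialHomeomorph M F) : Prop where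
  contMDiffOn : ContMDiffOn I 𝓘(ℝ, F) ∞ Φ Φ.source
  contMDiffOn_symm : ContMDiffOn 𝓘(ℝ, F) I ∞ Φ.symm Φ.target

/-- The derivative of a chart. -/
def chartD (Φ : OpenPartialHomeomorph M F) (x : M) : E →L[ℝ] F := mfderiv I 𝓘(ℝ, F) Φ x

/-- The derivative of the inverse of a chart. -/
def chartDSymm (Φ : OpenPartialHomeomorph M F) (u : F) : F →L[ℝ] E := mfderiv 𝓘(ℝ, F) I Φ.symm u

variable {I}

namespace IsSmoothChart

variable {Φ : OpenPartialHomeomorph M F} (h : IsSmoothChart I Φ)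

include h

theorem mdifferentiable : Φ.MDifferentiable I 𝓘(ℝ, F) :=
  ⟨h.contMDiffOn.mdifferentiableOn (by norm_cast),
    h.contMDiffOn_symm.mdifferentiableOn (by norm_cast)⟩

theorem hasMFDerivAt {x : M} (hx : x ∈ Φ.source) :
    HasMFDerivAt I 𝓘(ℝ, F) Φ x (chartD I Φ x : E →L[ℝ] F) :=
  (h.mdifferentiable.mdifferentiableAt hx).hasMFDerivAt

theorem hasMFDerivAt_symm {u : F} (hu : u ∈ Φ.target) :
    HasMFDerivAt 𝓘(ℝ, F) I Φ.symm u (chartDSymm I Φ u : F →L[ℝ] E) :=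
  (h.mdifferentiable.mdifferentiableAt_symm hu).hasMFDerivAt

theorem chartDSymm_chartD {x : M} (hx : x ∈ Φ.source) (v : E) :
    chartDSymm I Φ (Φ x) (chartD I Φ x v) = v :=
  congrArg (fun L : E →L[ℝ] E => L v) (h.mdifferentiable.symm_comp_deriv hx)

theorem chartD_chartDSymm {x : M} (hx : x ∈ Φ.source) (v : F) :
    chartD I Φ x (chartDSymm I Φ (Φ x) v) = v := by
  have := congrArg (fun L : F →L[ℝ] F => L v)
    (h.mdifferentiable.comp_symm_deriv (Φ.map_source hx))
  rw [Φ.left_inv hx] at this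
  exact this

theorem restr {s : Set M} (hs : IsOpen s) : IsSmoothChart I (Φ.restrOpen s hs) where
  contMDiffOn := h.contMDiffOn.mono (by simp)
  contMDiffOn_symm := by
    refine h.contMDiffOn_symm.mono ?_
    intro u hu
    have : u ∈ Φ.target ∩ Φ.symm ⁻¹' s := hu
    exact this.1

end IsSmoothChart

end Charts

variable {ι : Type*}

/-- `Φ` is a system of coordinates around a point of the stratum `S a`, in which that stratum is
`ℝᵖ × {0}` and all strata are products of `ℝᵖ` with subsets of `ℝ^q`. -/
structure IsStratumChart (S : ι → Set M) (a : ι) {p q : ℕ}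
    (Φ : OpenPartialHomeomorph M (Euc p × Euc q)) : Prop extends IsSmoothChart I Φ where
  mem_iff : ∀ y ∈ Φ.source, (y ∈ S a ↔ (Φ y).2 = 0)
  mem_congr : ∀ y ∈ Φ.source, ∀ y' ∈ Φ.source, (Φ y).2 = (Φ y').2 → ∀ b, y ∈ S b ↔ y' ∈ S b

/-- A compact subset of `M` of positive codimension, with strata `S a`, which is locally trivial
along each stratum. The strata are ordered by `ρ` (for instance by their dimensions), so that
around a point of `S a` there are only `S a` and strata `S b` with `ρ b > ρ a`. Both compact
submanifolds and compact submanifolds with conical singularities are of this type. -/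
structure IsStratification (S : ι → Set M) (ρ : ι → ℕ) : Prop where
  isCompact : IsCompact (⋃ a, S a)
  bounded : ∃ B, ∀ a, (S a).Nonempty → ρ a < B
  exists_chart : ∀ a, ∀ x ∈ S a, ∃ (p r : ℕ) (Φ : OpenPartialHomeomorph M (Euc p × Euc (r + 1))),
    x ∈ Φ.source ∧ IsStratumChart I S a Φ ∧ ∀ y ∈ Φ.source, ∀ b, y ∈ S b → b = a ∨ ρ a < ρ b

/-- The vectors at `x` tangent to the stratum through `x`; all vectors if there is none. With this
convention subfamilies need not be considered in the definition of transversality. -/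
def stratTangent (S : ι → Set M) (x : M) : Set E :=
  {v | ∀ a, x ∈ S a → v ∈ tangentVectors I (S a) x}

variable {I} {S : ι → Set M} {ρ : ι → ℕ}

theorem IsStratification.eq_of_mem (hS : IsStratification I S ρ) {a b : ι} {x : M} (ha : x ∈ S a)
    (hb : x ∈ S b) : a = b := by
  obtain ⟨_, _, Φ, hx, _, h1⟩ := hS.exists_chart a x ha
  obtain ⟨_, _, Φ', hx', _, h2⟩ := hS.exists_chart b x hb
  rcases h1 x hx b hb with h | h
  · exact h.symm
  rcases h2 x hx' a ha with h' | h'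
  · exact h'
  · omega

theorem IsStratification.stratTangent_eq (hS : IsStratification I S ρ) {a : ι} {x : M}
    (ha : x ∈ S a) : stratTangent I S x = tangentVectors I (S a) x := by
  ext v
  refine ⟨fun h => h a ha, fun h b hb => ?_⟩
  rw [← hS.eq_of_mem ha hb]
  exact h

theorem stratTangent_eq_univ {x : M} (hx : x ∉ ⋃ a, S a) : stratTangent I S x = univ := by
  ext v
  simp only [mem_iUnion, not_exists] at hx
  simp only [mem_univ, iff_true]
  exact fun a ha => absurd ha (hx a)

/-- The strata are locally unions of translates of `ℝᵖ × {0}`, hence the constant fields of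
`ℝᵖ × {0}` are tangent to all of them (Whitney's condition (a)). -/
theorem mem_tangentVectors_of_forall {p q : ℕ} {Φ : OpenPartialHomeomorph M (Euc p × Euc q)}
    (hΦ : IsSmoothChart I Φ) {T : Set M}
    (hT : ∀ y ∈ Φ.source, ∀ y' ∈ Φ.source, (Φ y).2 = (Φ y').2 → (y ∈ T ↔ y' ∈ T))
    {x : M} (hx : x ∈ Φ.source) (hxT : x ∈ T) (e : Euc p) :
    chartDSymm I Φ (Φ x) (e, 0) ∈ tangentVectors I T x := by
  let ℓ : ℝ → Euc p × Euc q := fun t => Φ x + t • ((e, 0) : Euc p × Euc q)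
  have hℓ0 : ℓ 0 = Φ x := by simp [ℓ]
  have hℓ : HasMFDerivAt 𝓘(ℝ, ℝ) 𝓘(ℝ, Euc p × Euc q) ℓ 0
      (ContinuousLinearMap.toSpanSingleton ℝ ((e, 0) : Euc p × Euc q)) := by
    have h1 : HasDerivAt ℓ ((e, 0) : Euc p × Euc q) 0 := by
      have := ((hasDerivAt_id (0 : ℝ)).smul_const ((e, 0) : Euc p × Euc q)).const_add (Φ x)
      rwa [one_smul] at this
    exact h1.hasFDerivAt.hasMFDerivAt
  have htgt : ∀ᶠ t in 𝓝 (0 : ℝ), ℓ t ∈ Φ.target := by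
    have hc : ContinuousAt ℓ 0 := hℓ.continuousAt
    have ht : Φ.target ∈ 𝓝 (ℓ 0) := by
      rw [hℓ0]
      exact Φ.open_target.mem_nhds (Φ.map_source hx)
    exact hc.eventually_mem ht
  have hsy : HasMFDerivAt 𝓘(ℝ, Euc p × Euc q) I Φ.symm (ℓ 0)
      (chartDSymm I Φ (ℓ 0) : Euc p × Euc q →L[ℝ] E) :=
    hΦ.hasMFDerivAt_symm (by rw [hℓ0]; exact Φ.map_source hx)
  have hγ := hsy.comp (0 : ℝ) hℓ
  refine ⟨Φ.symm ∘ ℓ, ?_, ?_, hγ.mdifferentiableAt, ?_⟩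
  · simp only [Function.comp_apply, hℓ0, Φ.left_inv hx]
  · filter_upwards [htgt] with t ht
    have h2 : (Φ (Φ.symm (ℓ t))).2 = (Φ x).2 := by
      rw [Φ.right_inv ht]
      simp [ℓ]
    exact (hT _ (Φ.map_target ht) x hx h2).2 hxT
  · rw [hγ.mfderiv]
    change chartDSymm I Φ (ℓ 0) ((1 : ℝ) • ((e, 0) : Euc p × Euc q)) = _
    rw [hℓ0, one_smul]

theorem chartD_snd_eq_zero_of_mem_tangentVectors {p q : ℕ}
    {Φ : OpenPartialHomeomorph M (Euc p × Euc q)} (hΦ : IsSmoothChart I Φ) {T : Set M}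
    (hT : ∀ y ∈ Φ.source, y ∈ T → (Φ y).2 = 0) {x : M} (hx : x ∈ Φ.source) {v : E}
    (hv : v ∈ tangentVectors I T x) : (chartD I Φ x v).2 = 0 := by
  obtain ⟨γ, rfl, hγT, hγ, rfl⟩ := hv
  have h1 := (hΦ.hasMFDerivAt hx).comp (0 : ℝ) hγ.hasMFDerivAt
  have h2 : HasFDerivAt (Φ ∘ γ) ((chartD I Φ (γ 0)).comp
      (mfderiv 𝓘(ℝ, ℝ) I γ 0 : ℝ →L[ℝ] E)) (0 : ℝ) := hasMFDerivAt_iff_hasFDerivAt.1 h1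
  have h3 : HasFDerivAt (fun t => (Φ (γ t)).2) _ (0 : ℝ) :=
    (ContinuousLinearMap.snd ℝ (Euc p) (Euc q)).hasFDerivAt.comp (0 : ℝ) h2
  have h4 : (fun t => (Φ (γ t)).2) =ᶠ[𝓝 0] fun _ => (0 : Euc q) := by
    filter_upwards [hγT, hγ.continuousAt.eventually_mem (Φ.open_source.mem_nhds hx)] with t h h'
    exact hT _ h' h
  have h5 := h3.unique ((hasFDerivAt_const (0 : Euc q) (0 : ℝ)).congr_of_eventuallyEq h4)
  exact congrArg (fun L : ℝ →L[ℝ] Euc q => L 1) h5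

theorem IsStratumChart.mem_tangentVectors_iff {a : ι} {p q : ℕ}
    {Φ : OpenPartialHomeomorph M (Euc p × Euc q)} (hΦ : IsStratumChart I S a Φ) {x : M}
    (hx : x ∈ Φ.source) (hxa : x ∈ S a) (v : E) :
    v ∈ tangentVectors I (S a) x ↔ (chartD I Φ x v).2 = 0 := by
  refine ⟨chartD_snd_eq_zero_of_mem_tangentVectors hΦ.toIsSmoothChart
    (fun y hy hyT => (hΦ.mem_iff y hy).1 hyT) hx, fun h => ?_⟩
  have h1 : chartD I Φ x v = ((chartD I Φ x v).1, 0) := Prod.ext rfl h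
  rw [← hΦ.chartDSymm_chartD hx v, h1]
  exact mem_tangentVectors_of_forall hΦ.toIsSmoothChart
    (fun y hy y' hy' h => hΦ.mem_congr y hy y' hy' h a) hx hxa _

theorem IsStratumChart.chartDSymm_mem_stratTangent {a : ι} {p q : ℕ}
    {Φ : OpenPartialHomeomorph M (Euc p × Euc q)} (hΦ : IsStratumChart I S a Φ) {x : M}
    (hx : x ∈ Φ.source) (e : Euc p) : chartDSymm I Φ (Φ x) (e, 0) ∈ stratTangent I S x :=
  fun b hb => mem_tangentVectors_of_forall hΦ.toIsSmoothChart
    (fun y hy y' hy' h => hΦ.mem_congr y hy y' hy' h b) hx hb e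

variable (I) in
/-- `ζ : M → ℝᶜ`, defined on the open set `O`, is a submersion along its zero set, and the latter is
an open part of a stratum of `S`, or of the complement of `S` (then `c = 0`). -/
structure IsDefiningFunction (S : ι → Set M) (O : Set M) (c : ℕ) (ζ : M → Euc c) : Prop where
  isOpen : IsOpen O
  contMDiffOn : ContMDiffOn I 𝓘(ℝ, Euc c) ∞ ζ O
  surjective : ∀ y ∈ O, ζ y = 0 →
    Function.Surjective (mfderiv I 𝓘(ℝ, Euc c) ζ y : E →L[ℝ] Euc c)
  mem_iff : ∀ y ∈ O, ζ y = 0 → ∀ v : E,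
    v ∈ stratTangent I S y ↔ (mfderiv I 𝓘(ℝ, Euc c) ζ y : E →L[ℝ] Euc c) v = 0

theorem IsStratumChart.mfderiv_snd {a : ι} {p q : ℕ}
    {Φ : OpenPartialHomeomorph M (Euc p × Euc q)} (hΦ : IsStratumChart I S a Φ) {x : M}
    (hx : x ∈ Φ.source) (v : E) :
    (mfderiv I 𝓘(ℝ, Euc q) (fun y => (Φ y).2) x : E →L[ℝ] Euc q) v = (chartD I Φ x v).2 := by
  have h2 : HasMFDerivAt I 𝓘(ℝ, Euc q) (fun y => (Φ y).2) x
      ((ContinuousLinearMap.snd ℝ (Euc p) (Euc q)).comp (chartD I Φ x)) :=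
    (ContinuousLinearMap.snd ℝ (Euc p) (Euc q)).hasFDerivAt.hasMFDerivAt.comp x
      (hΦ.hasMFDerivAt hx)
  rw [h2.mfderiv]
  rfl

theorem IsStratumChart.isDefiningFunction (hS : IsStratification I S ρ) {a : ι} {p q : ℕ}
    {Φ : OpenPartialHomeomorph M (Euc p × Euc q)} (hΦ : IsStratumChart I S a Φ) :
    IsDefiningFunction I S Φ.source q (fun y => (Φ y).2) where
  isOpen := Φ.open_source
  contMDiffOn := (ContinuousLinearMap.snd ℝ (Euc p) (Euc q)).contDiff.contMDiff.comp_contMDiffOn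
    hΦ.contMDiffOn
  surjective y hy _ e := by
    refine ⟨chartDSymm I Φ (Φ y) (0, e), ?_⟩
    rw [hΦ.mfderiv_snd hy, hΦ.chartD_chartDSymm hy]
  mem_iff y hy h0 v := by
    have hya : y ∈ S a := (hΦ.mem_iff y hy).2 h0
    rw [hS.stratTangent_eq hya]
    refine (hΦ.mem_tangentVectors_iff hy hya v).trans ?_
    rw [hΦ.mfderiv_snd hy]
    exact Iff.rfl

theorem isDefiningFunction_compl (hS : IsClosed (⋃ a, S a)) :
    IsDefiningFunction I S (⋃ a, S a)ᶜ 0 (fun _ => 0) where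
  isOpen := hS.isOpen_compl
  contMDiffOn := contMDiffOn_const
  surjective _ _ _ e := ⟨0, Subsingleton.elim (α := Euc 0) _ _⟩
  mem_iff y hy _ v := by
    rw [stratTangent_eq_univ hy]
    exact ⟨fun _ => Subsingleton.elim (α := Euc 0) _ _, fun _ => mem_univ _⟩

/-- Countably many defining functions describe all strata, and the complement. -/
theorem IsStratification.exists_countable_definingFunctions [Countable ι] [T2Space M]
    [SecondCountableTopology M] (hS : IsStratification I S ρ) :
    ∃ T : Set (Set M × (Σ c : ℕ, (M → Euc c))), T.Countable ∧
      (∀ d ∈ T, IsDefiningFunction I S d.1 d.2.1 d.2.2) ∧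
      ∀ x, ∃ d ∈ T, x ∈ d.1 ∧ d.2.2 x = 0 := by
  have h1 : ∀ a, ∃ T : Set (Set M × (Σ c : ℕ, (M → Euc c))), T.Countable ∧
      (∀ d ∈ T, IsDefiningFunction I S d.1 d.2.1 d.2.2) ∧
      ∀ x ∈ S a, ∃ d ∈ T, x ∈ d.1 ∧ d.2.2 x = 0 := by
    intro a
    have h2 : ∀ x : S a, ∃ d : Set M × (Σ c : ℕ, (M → Euc c)),
        IsDefiningFunction I S d.1 d.2.1 d.2.2 ∧ {y | y ∈ d.1 ∧ d.2.2 y = 0} ∈ 𝓝[S a] (x : M) := by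
      rintro ⟨x, hx⟩
      obtain ⟨p, r, Φ, hxΦ, hΦ, -⟩ := hS.exists_chart a x hx
      refine ⟨⟨Φ.source, r + 1, fun y => (Φ y).2⟩, hΦ.isDefiningFunction hS, ?_⟩
      filter_upwards [self_mem_nhdsWithin,
        mem_nhdsWithin_of_mem_nhds (Φ.open_source.mem_nhds hxΦ)] with y hy hyΦ
      exact ⟨hyΦ, (hΦ.mem_iff y hyΦ).1 hy⟩
    choose d hd hd' using h2
    classical
    obtain ⟨t, hts, htc, ht⟩ := TopologicalSpace.countable_cover_nhdsWithin
      (s := S a) (f := fun x => if h : x ∈ S a then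
        {y | y ∈ (d ⟨x, h⟩).1 ∧ (d ⟨x, h⟩).2.2 y = 0} else ∅)
      (fun x hx => by simp only [hx, dite_true]; exact hd' ⟨x, hx⟩)
    refine ⟨range (fun x : t => d ⟨x, hts x.2⟩), ?_, ?_, ?_⟩
    · have := htc.to_subtype
      exact countable_range _
    · rintro _ ⟨x, rfl⟩
      exact hd _
    · intro x hx
      obtain ⟨y, hy, hxy⟩ := mem_iUnion₂.1 (ht hx)
      simp only [hts hy, dite_true] at hxy
      exact ⟨_, ⟨⟨y, hy⟩, rfl⟩, hxy⟩
  choose T hTc hTd hT using h1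
  refine ⟨insert ⟨(⋃ a, S a)ᶜ, 0, fun _ => 0⟩ (⋃ a, T a), (countable_iUnion hTc).insert _, ?_, ?_⟩
  · rintro d (rfl | hd)
    · exact isDefiningFunction_compl hS.isCompact.isClosed
    · obtain ⟨a, ha⟩ := mem_iUnion.1 hd
      exact hTd a d ha
  · intro x
    by_cases hx : x ∈ ⋃ a, S a
    · obtain ⟨a, ha⟩ := mem_iUnion.1 hx
      obtain ⟨d, hd, h⟩ := hT a x ha
      exact ⟨d, Or.inr (mem_iUnion.2 ⟨a, hd⟩), h⟩
    · exact ⟨_, Or.inl rfl, hx, rfl⟩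

end Manifold

/-! ### Transversality along an orbit is an open condition -/

theorem eventually_surjective {X V W : Type*} [TopologicalSpace X] [NormedAddCommGroup V]
    [NormedSpace ℝ V] [FiniteDimensional ℝ V] [NormedAddCommGroup W] [NormedSpace ℝ W]
    [FiniteDimensional ℝ W] {Λ : X → (V →L[ℝ] W)} {x : X} (hΛ : ContinuousAt Λ x)
    (hs : Function.Surjective (Λ x)) : ∀ᶠ y in 𝓝 x, Function.Surjective (Λ y) := by
  obtain ⟨R, hR⟩ := (Λ x).toLinearMap.exists_rightInverse_of_surjective
    (LinearMap.range_eq_top.2 hs)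
  let R' : W →L[ℝ] V := LinearMap.toContinuousLinearMap R
  have h1 : ContinuousAt (fun y => (Λ y).comp R') x := hΛ.clm_comp continuousAt_const
  have h2 : (Λ x).comp R' = 1 := by
    ext w
    exact LinearMap.congr_fun hR w
  have h3 : {L : W →L[ℝ] W | IsUnit L} ∈ 𝓝 ((Λ x).comp R') := by
    rw [h2]
    exact Units.isOpen.mem_nhds isUnit_one
  filter_upwards [h1.eventually_mem h3] with y hy w
  obtain ⟨L, hL⟩ := hy
  refine ⟨R' ((L⁻¹ : (W →L[ℝ] W)ˣ).val w), ?_⟩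
  have h4 := congrArg (fun A : W →L[ℝ] W => A w) (L.mul_inv)
  rw [hL] at h4
  exact h4

section Manifold

variable {E : Type*} [NormedAddCommGroup E] [NormedSpace ℝ E]
  {H : Type*} [TopologicalSpace H] {I : ModelWithCorners ℝ E H}
  {M : Type*} [TopologicalSpace M] [ChartedSpace H M]
  {ι ι' : Type*} {S : ι → Set M} {ρ : ι → ℕ} {S' : ι' → Set M} {ρ' : ι' → ℕ}

variable (I) in
/-- Transversality of the iterates at the orbit of `x`: the preimages under `g^i`, `i < d`, of the
tangent spaces of the strata of `S` at `g^i x`, and the tangent space of the stratum of `S'` at `x`,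
are in general position in `T_x M`. -/
def OrbitTransverse (S : ι → Set M) (S' : ι' → Set M) (d : ℕ) (g : M → M) (x : M) : Prop :=
  ∀ (w : ℕ → E) (w' : E), ∃ u : E,
    (∀ i < d, w i - mapD I g^[i] x u ∈ stratTangent I S (g^[i] x)) ∧
    w' - u ∈ stratTangent I S' x

variable [FiniteDimensional ℝ E] [IsManifold I ∞ M] [T2Space M]

/-- Whitney's condition (a), in the preferred chart at `x0`: there are continuous vector fields
tangent to all strata, which at `x0` span the tangent space of the stratum through `x0`. -/
theorem IsStratification.exists_tangent_fields (hS : IsStratification I S ρ) (x0 : M) :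
    ∃ (m : ℕ) (σ : M → (Euc m →L[ℝ] E)), ContinuousAt σ x0 ∧
      (∀ᶠ x in 𝓝 x0, ∀ (e : Euc m) (v : E), tangentCoord I x0 x v = σ x e →
        v ∈ stratTangent I S x) ∧
      ∀ v ∈ stratTangent I S x0, ∃ e, tangentCoord I x0 x0 v = σ x0 e := by
  by_cases hx : x0 ∈ ⋃ a, S a
  · obtain ⟨a, ha⟩ := mem_iUnion.1 hx
    obtain ⟨p, r, Φ, hxΦ, hΦ, -⟩ := hS.exists_chart a x0 ha
    set f : Euc p × Euc (r + 1) → E := extChartAt I x0 ∘ Φ.symm with hf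
    have hnear : ∀ᶠ x in 𝓝 x0, x ∈ Φ.source ∧ x ∈ (chartAt H x0).source :=
      (Φ.open_source.mem_nhds hxΦ) |> fun h1 => inter_mem h1 (chart_source_mem_nhds H x0)
    have hcd : ContDiffAt ℝ ∞ f (Φ x0) := by
      have h1 : ContMDiffAt I 𝓘(ℝ, E) ∞ (extChartAt I x0) (Φ.symm (Φ x0)) := by
        rw [Φ.left_inv hxΦ]
        exact contMDiffAt_extChartAt
      exact (h1.comp (Φ x0) (hΦ.contMDiffOn_symm.contMDiffAt
        (Φ.open_target.mem_nhds (Φ.map_source hxΦ)))).contDiffAt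
    have hrel : ∀ x ∈ Φ.source, x ∈ (chartAt H x0).source → ∀ e : Euc p,
        tangentCoord I x0 x (chartDSymm I Φ (Φ x) (e, 0)) = fderiv ℝ f (Φ x) (e, 0) := by
      intro x hx hx' e
      have h1 : HasMFDerivAt I 𝓘(ℝ, E) (extChartAt I x0) (Φ.symm (Φ x))
          (tangentCoord I x0 x : E →L[ℝ] E) := by
        rw [Φ.left_inv hx]
        exact (mdifferentiableAt_extChartAt hx').hasMFDerivAt
      have h2 := h1.comp (Φ x) (hΦ.hasMFDerivAt_symm (Φ.map_source hx))
      have h3 : HasFDerivAt f ((tangentCoord I x0 x).comp (chartDSymm I Φ (Φ x))) (Φ x) :=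
        hasMFDerivAt_iff_hasFDerivAt.1 h2
      rw [h3.fderiv]
      rfl
    refine ⟨p, fun x => (fderiv ℝ f (Φ x)).comp (ContinuousLinearMap.inl ℝ _ _), ?_, ?_, ?_⟩
    · have h1 : ContinuousAt (fderiv ℝ f) (Φ x0) :=
        (hcd.fderiv_right (m := 0) (by norm_cast)).continuousAt
      have h2 : ContinuousAt (fun x => fderiv ℝ f (Φ x)) x0 :=
        h1.comp (f := Φ) (Φ.continuousAt hxΦ)
      exact h2.clm_comp continuousAt_const
    · filter_upwards [hnear] with x hx e v hv
      have h1 : tangentCoord I x0 x v = tangentCoord I x0 x (chartDSymm I Φ (Φ x) (e, 0)) := by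
        rw [hrel x hx.1 hx.2]
        exact hv
      rw [(tangentCoord_bijective hx.2).1 h1]
      exact hΦ.chartDSymm_mem_stratTangent hx.1 e
    · intro v hv
      have h1 := (hΦ.mem_tangentVectors_iff hxΦ ha v).1 (hv a ha)
      refine ⟨(chartD I Φ x0 v).1, ?_⟩
      have h2 : ((chartD I Φ x0 v).1, (0 : Euc (r + 1))) = chartD I Φ x0 v := Prod.ext rfl h1.symm
      change _ = fderiv ℝ f (Φ x0) ((chartD I Φ x0 v).1, 0)
      rw [← hrel x0 hxΦ (mem_chart_source H x0), h2, hΦ.chartDSymm_chartD hxΦ]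
  · have e : Euc (finrank ℝ E) ≃L[ℝ] E := ContinuousLinearEquiv.ofFinrankEq (by simp)
    refine ⟨finrank ℝ E, fun _ => e, continuousAt_const, ?_,
      fun v _ => ⟨e.symm (tangentCoord I x0 x0 v), ?_⟩⟩
    · filter_upwards [hS.isCompact.isClosed.isOpen_compl.mem_nhds hx] with x hx e v _
      rw [stratTangent_eq_univ hx]
      exact mem_univ v
    · simp

/-- Transversality of the iterates along an orbit is an open condition on `g` and `x`. -/
theorem isOpen_orbitTransverse [LocallyCompactSpace M] (hS : IsStratification I S ρ)
    (hS' : IsStratification I S' ρ') (d : ℕ) :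
    IsOpen {p : (M ≃ₘ^∞⟮I, I⟯ M) × M | OrbitTransverse I S S' d p.1 p.2} := by
  rw [isOpen_iff_mem_nhds]
  rintro ⟨g0, x0⟩ h0
  choose D hD hDe using fun i : Fin d => exists_continuousAt_deriv_iterate (I := I) g0 x0 i
  choose m σ hσ hσt hσs using fun i : Fin d => hS.exists_tangent_fields ((⇑g0)^[i] x0)
  obtain ⟨m', σ', hσ', hσt', hσs'⟩ := hS'.exists_tangent_fields x0
  -- transversality means that the following linear map is surjective
  let Λ : (M ≃ₘ^∞⟮I, I⟯ M) × M → (E × (∀ i, Euc (m i)) × Euc m' →L[ℝ] (Fin d → E) × E) := fun p =>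
    ((ContinuousLinearMap.pi fun i =>
      (D i p).comp (ContinuousLinearMap.fst ℝ _ _) + (σ i ((⇑p.1)^[i] p.2)).comp
        ((ContinuousLinearMap.proj i).comp ((ContinuousLinearMap.fst ℝ _ _).comp
          (ContinuousLinearMap.snd ℝ _ _))))).prod
    (ContinuousLinearMap.fst ℝ _ _ + (σ' p.2).comp ((ContinuousLinearMap.snd ℝ _ _).comp
      (ContinuousLinearMap.snd ℝ _ _)))
  have hit : ∀ i : ℕ, Tendsto (fun p : (M ≃ₘ^∞⟮I, I⟯ M) × M => (⇑p.1)^[i] p.2) (𝓝 (g0, x0))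
      (𝓝 ((⇑g0)^[i] x0)) := fun i => (continuous_eval_iterate i).tendsto' _ _ rfl
  have hΛc : ContinuousAt Λ (g0, x0) := by
    rw [continuousAt_clm_apply]
    rintro ⟨u, e, e'⟩
    refine ContinuousAt.prodMk (continuousAt_pi.2 fun i => ?_) ?_
    · refine ContinuousAt.add ((hD i).clm_apply continuousAt_const) ?_
      have : ContinuousAt (fun p : (M ≃ₘ^∞⟮I, I⟯ M) × M => σ i ((⇑p.1)^[i] p.2)) (g0, x0) :=
        (hσ i).tendsto.comp (hit i)
      exact this.clm_apply continuousAt_const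
    · refine continuousAt_const.add ?_
      have : ContinuousAt (fun p : (M ≃ₘ^∞⟮I, I⟯ M) × M => σ' p.2) (g0, x0) :=
        hσ'.tendsto.comp (hit 0)
      exact this.clm_apply continuousAt_const
  have hbij : ∀ x0 : M, Function.Bijective (tangentCoord I x0 x0) := fun x0 =>
    tangentCoord_bijective (mem_chart_source H x0)
  have hΛs : Function.Surjective (Λ (g0, x0)) := by
    rintro ⟨W, W'⟩
    choose w hw using fun i : Fin d => (hbij ((⇑g0)^[i] x0)).2 (W i)
    obtain ⟨w', hw'⟩ := (hbij x0).2 W'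
    obtain ⟨u, hu, hu'⟩ := h0 (fun i => if h : i < d then w ⟨i, h⟩ else 0) w'
    have h1 : ∀ i : Fin d, ∃ e, tangentCoord I ((⇑g0)^[i] x0) ((⇑g0)^[i] x0)
        (w i - mapD I (⇑g0)^[i] x0 u) = σ i ((⇑g0)^[i] x0) e := fun i => by
      refine hσs i _ ?_
      have := hu i i.2
      simp only [i.2, dite_true] at this
      exact this
    choose e he using h1
    obtain ⟨e', he'⟩ := hσs' _ hu'
    refine ⟨(tangentCoord I x0 x0 u, e, e'), Prod.ext (funext fun i => ?_) ?_⟩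
    · change D i (g0, x0) (tangentCoord I x0 x0 u) + σ i ((⇑g0)^[i] x0) (e i) = W i
      have h2 := (hDe i).self_of_nhds u
      rw [← he i, map_sub, hw, ← h2]
      exact add_sub_cancel _ _
    · change tangentCoord I x0 x0 u + σ' x0 e' = W'
      rw [← he', map_sub, hw', add_sub_cancel]
  filter_upwards [eventually_surjective hΛc hΛs, eventually_all.2 hDe,
    eventually_all.2 fun i : Fin d => (hit i).eventually (hσt i), (hit 0).eventually hσt',
    (hit 0).eventually (chart_source_mem_nhds H x0)] with p hp hpD hpσ hpσ' hpc
  intro w w'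
  obtain ⟨⟨U, e, e'⟩, hU⟩ := hp (fun i => tangentCoord I ((⇑g0)^[i] x0) ((⇑p.1)^[i] p.2) (w i),
    tangentCoord I x0 p.2 w')
  obtain ⟨u, rfl⟩ := (tangentCoord_bijective (I := I) hpc).2 U
  refine ⟨u, fun i hi => ?_, ?_⟩
  · refine hpσ ⟨i, hi⟩ (e ⟨i, hi⟩) _ ?_
    have h1 : D ⟨i, hi⟩ p (tangentCoord I x0 p.2 u) + σ ⟨i, hi⟩ ((⇑p.1)^[i] p.2) (e ⟨i, hi⟩) =
        tangentCoord I ((⇑g0)^[i] x0) ((⇑p.1)^[i] p.2) (w i) :=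
      congrFun (congrArg Prod.fst hU) ⟨i, hi⟩
    have h2 := hpD ⟨i, hi⟩ u
    rw [map_sub, h2, ← h1]
    exact add_sub_cancel_left _ _
  · refine hpσ' e' _ ?_
    have h1 : tangentCoord I x0 p.2 u + σ' p.2 e' = tangentCoord I x0 p.2 w' :=
      congrArg Prod.snd hU
    change tangentCoord I x0 p.2 (w' - u) = σ' p.2 e'
    rw [map_sub, ← h1, add_sub_cancel_left]

end Manifold

/-! ### Transversality along orbits and transversality of the iterates -/

section Manifold

variable {E : Type*} [NormedAddCommGroup E] [NormedSpace ℝ E]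
  {H : Type*} [TopologicalSpace H] {I : ModelWithCorners ℝ E H}
  {M : Type*} [TopologicalSpace M] [ChartedSpace H M]
  {ι ι' : Type*} {S : ι → Set M} {ρ : ι → ℕ} {S' : ι' → Set M} {ρ' : ι' → ℕ}

theorem mapD_comp {f g : M → M} (hf : ContMDiff I I ∞ f) (hg : ContMDiff I I ∞ g) (x : M) (v : E) :
    mapD I (f ∘ g) x v = mapD I f (g x) (mapD I g x v) := by
  rw [mapD, mfderiv_comp x (hf.contMDiffAt.mdifferentiableAt (by norm_cast))
    (hg.contMDiffAt.mdifferentiableAt (by norm_cast))]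
  rfl

theorem mapD_congr {f g : M → M} {x : M} (h : f =ᶠ[𝓝 x] g) : mapD I f x = mapD I g x :=
  h.mfderiv_eq

theorem mapD_id (x : M) (v : E) : mapD I (id : M → M) x v = v := by
  have : mapD I (id : M → M) x = ContinuousLinearMap.id ℝ E := mfderiv_id
  rw [this]
  rfl

theorem mapD_symm_mapD (g : M ≃ₘ^∞⟮I, I⟯ M) (x : M) (v : E) :
    mapD I g.symm (g x) (mapD I g x v) = v := by
  rw [← mapD_comp g.symm.contMDiff g.contMDiff]
  have : (⇑g.symm ∘ ⇑g) = id := funext g.symm_apply_apply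
  rw [this, mapD_id]

theorem mapD_mapD_symm (g : M ≃ₘ^∞⟮I, I⟯ M) (x : M) (v : E) :
    mapD I g x (mapD I g.symm (g x) v) = v := by
  have h := mapD_symm_mapD g.symm (g x) v
  rw [g.symm_apply_apply] at h
  exact h

theorem mapD_bijective (g : M ≃ₘ^∞⟮I, I⟯ M) (x : M) : Function.Bijective (mapD I g x) :=
  Function.bijective_iff_has_inverse.2 ⟨mapD I g.symm (g x), mapD_symm_mapD g x, mapD_mapD_symm g x⟩

theorem mapD_iterate_bijective (g : M ≃ₘ^∞⟮I, I⟯ M) (i : ℕ) (x : M) :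
    Function.Bijective (mapD I (⇑g)^[i] x) := by
  induction i with
  | zero =>
    have : mapD I (⇑g)^[0] x = ContinuousLinearMap.id ℝ E := mfderiv_id
    rw [this]
    exact Function.bijective_id
  | succ i ih =>
    have : ⇑(mapD I (⇑g)^[i + 1] x) = mapD I g ((⇑g)^[i] x) ∘ mapD I (⇑g)^[i] x :=
      funext (mapD_iterate_succ g i x)
    rw [this]
    exact (mapD_bijective g _).comp ih

theorem mapD_iterate_add (g : M ≃ₘ^∞⟮I, I⟯ M) (i j : ℕ) (x : M) (v : E) :
    mapD I (⇑g)^[i + j] x v = mapD I (⇑g)^[i] ((⇑g)^[j] x) (mapD I (⇑g)^[j] x v) := by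
  rw [Function.iterate_add, mapD_comp (contMDiff_iterate g i) (contMDiff_iterate g j)]

theorem zero_mem_tangentVectors {T : Set M} {x : M} (hx : x ∈ T) :
    (0 : E) ∈ tangentVectors I T x := by
  refine ⟨fun _ => x, rfl, Eventually.of_forall fun _ => hx, mdifferentiableAt_const, ?_⟩
  rw [mfderiv_const]
  rfl

theorem zero_mem_stratTangent (x : M) : (0 : E) ∈ stratTangent I S x :=
  fun _ ha => zero_mem_tangentVectors ha

theorem mapD_mem_tangentVectors (g : M ≃ₘ^∞⟮I, I⟯ M) {T : Set M} (hg : MapsTo g T T)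
    {x : M} {v : E} (hv : v ∈ tangentVectors I T x) : mapD I g x v ∈ tangentVectors I T (g x) := by
  obtain ⟨γ, rfl, hγT, hγ, rfl⟩ := hv
  have h1 := (g.contMDiff.contMDiffAt (x := γ 0)).mdifferentiableAt (by norm_cast)
    |>.hasMFDerivAt.comp (0 : ℝ) hγ.hasMFDerivAt
  refine ⟨g ∘ γ, rfl, hγT.mono fun t ht => hg ht, h1.mdifferentiableAt, ?_⟩
  rw [h1.mfderiv]
  rfl

theorem image_symm_eq {g : M ≃ₘ^∞⟮I, I⟯ M} {T : Set M} (hg : g '' T = T) : g.symm '' T = T := by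
  conv_lhs => rw [← hg]
  rw [← image_comp]
  have : (⇑g.symm ∘ ⇑g) = id := funext g.symm_apply_apply
  rw [this, image_id]

theorem mem_iff_of_image_eq {g : M ≃ₘ^∞⟮I, I⟯ M} {T : Set M} (hg : g '' T = T) (x : M) :
    g x ∈ T ↔ x ∈ T := by
  conv_lhs => rw [← hg]
  exact g.injective.mem_set_image

theorem mapD_mem_stratTangent_iff {g : M ≃ₘ^∞⟮I, I⟯ M} (hg : ∀ a, g '' S a = S a) (x : M) (v : E) :
    mapD I g x v ∈ stratTangent I S (g x) ↔ v ∈ stratTangent I S x := by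
  refine forall_congr' fun a => ?_
  rw [mem_iff_of_image_eq (hg a)]
  refine imp_congr_right fun _ => ⟨fun h => ?_, fun h => mapD_mem_tangentVectors g
    (fun y hy => (mem_iff_of_image_eq (hg a) y).2 hy) h⟩
  have h2 := mapD_mem_tangentVectors g.symm
    (fun y hy => (mem_iff_of_image_eq (image_symm_eq (hg a)) y).2 hy) h
  rw [mapD_symm_mapD, g.symm_apply_apply] at h2
  exact h2

theorem mapD_iterate_mem_stratTangent_iff {g : M ≃ₘ^∞⟮I, I⟯ M} (hg : ∀ a, g '' S a = S a)
    (i : ℕ) (x : M) (v : E) :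
    mapD I (⇑g)^[i] x v ∈ stratTangent I S ((⇑g)^[i] x) ↔ v ∈ stratTangent I S x := by
  induction i with
  | zero => rw [Function.iterate_zero, mapD_id]; rfl
  | succ i ih =>
    rw [mapD_iterate_succ, Function.iterate_succ_apply', mapD_mem_stratTangent_iff hg, ih]

theorem iterate_symm_iterate (g : M ≃ₘ^∞⟮I, I⟯ M) (i : ℕ) (x : M) :
    (⇑g)^[i] ((⇑g.symm)^[i] x) = x :=
  Function.LeftInverse.iterate (fun x => g.apply_symm_apply x) i x

/-- Transversality along the orbit ending in `y`, stated at `y`: all conditions are transported from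
the first point of the orbit to the last one. -/
theorem exists_of_orbitTransverse {g : M ≃ₘ^∞⟮I, I⟯ M} (hg : ∀ b, g '' S' b = S' b) {d : ℕ}
    (h : ∀ x, OrbitTransverse I S S' d g x) (y : M) (w : Fin d → E) (w' : E) :
    ∃ u : E, (∀ (j : Fin d) (z : M), (⇑g)^[(j : ℕ)] z = y →
      ∃ v ∈ stratTangent I S z, mapD I (⇑g)^[(j : ℕ)] z v = w j - u) ∧
      w' - u ∈ stratTangent I S' y := by
  cases d with
  | zero =>
    obtain ⟨u, -, hu⟩ := h y (fun _ => 0) w'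
    exact ⟨u, fun j => j.elim0, hu⟩
  | succ m =>
    obtain ⟨x, rfl⟩ : ∃ x, (⇑g)^[m] x = y := ⟨_, iterate_symm_iterate g m y⟩
    choose W hW using fun i : ℕ => (mapD_iterate_bijective g (m - i) ((⇑g)^[i] x)).2
      (if h : m - i < m + 1 then w ⟨m - i, h⟩ else 0)
    obtain ⟨W', rfl⟩ := (mapD_iterate_bijective g m x).2 w'
    obtain ⟨u, hu, hu'⟩ := h x W W'
    refine ⟨mapD I (⇑g)^[m] x u, fun j z hz => ?_, ?_⟩
    · have hj : (j : ℕ) ≤ m := Nat.lt_succ_iff.1 j.2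
      have hzx : z = (⇑g)^[m - j] x := by
        refine (g.injective.iterate j) ?_
        change (⇑g)^[(j : ℕ)] z = (⇑g)^[(j : ℕ)] ((⇑g)^[m - j] x)
        rw [hz, ← Function.iterate_add_apply, Nat.add_sub_cancel' hj]
      subst hzx
      refine ⟨_, hu (m - j) (by omega), ?_⟩
      have h1 := hW (m - j)
      have h2 : m - (m - j) = (j : ℕ) := by omega
      simp only [h2, Fin.is_lt, dite_true, Fin.eta] at h1
      rw [map_sub, h1, ← mapD_iterate_add, Nat.add_sub_cancel' hj]
    · rw [← map_sub]
      exact (mapD_iterate_mem_stratTangent_iff hg m x _).2 hu'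

/-- Transversality of the iterates means transversality along each orbit. -/
theorem iteratesTransverse_iff (hS : IsStratification I S ρ) (hS' : IsStratification I S' ρ')
    {g : M ≃ₘ^∞⟮I, I⟯ M} (hg : ∀ b, g '' S' b = S' b) (d : ℕ) :
    IteratesTransverse I S S' d g ↔ ∀ x, OrbitTransverse I S S' d g x := by
  constructor
  · intro h x w w'
    rcases isEmpty_or_nonempty ι with hι | ⟨⟨a0⟩⟩
    · refine ⟨w', fun i _ a => hι.elim a, ?_⟩
      rw [sub_self]
      exact zero_mem_stratTangent x
    cases d with
    | zero =>
      refine ⟨w', fun i hi => absurd hi (Nat.not_lt_zero i), ?_⟩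
      rw [sub_self]
      exact zero_mem_stratTangent x
    | succ m =>
    classical
    let z : Fin (m + 1) → M := fun j => (⇑g)^[m - j] x
    have hz : ∀ j : Fin (m + 1), (⇑g)^[(j : ℕ)] (z j) = (⇑g)^[m] x := fun j => by
      have hj : (j : ℕ) ≤ m := Nat.lt_succ_iff.1 j.2
      rw [← Function.iterate_add_apply, Nat.add_sub_cancel' hj]
    let a : Fin (m + 1) → ι := fun j => if h : ∃ a, z j ∈ S a then h.choose else a0
    have ha : ∀ j, z j ∈ ⋃ a, S a → z j ∈ S (a j) := fun j hj => by
      have h1 : ∃ a, z j ∈ S a := mem_iUnion.1 hj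
      simp only [a, h1, dite_true]
      exact h1.choose_spec
    let J : Finset (Fin (m + 1)) := Finset.univ.filter fun j => z j ∈ ⋃ a, S a
    let W : Fin (m + 1) → E := fun j => mapD I (⇑g)^[(j : ℕ)] (z j) (w (m - j))
    -- it is enough to solve the equations at the end point of the orbit
    suffices hsuff : ∃ U : E, (∀ j ∈ J, ∃ v : E, v ∈ tangentVectors I (S (a j)) (z j) ∧
        mapD I (⇑g)^[(j : ℕ)] (z j) v = W j - U) ∧
        mapD I (⇑g)^[m] x w' - U ∈ stratTangent I S' ((⇑g)^[m] x) by
      obtain ⟨U, hU, hU'⟩ := hsuff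
      obtain ⟨u, rfl⟩ := (mapD_iterate_bijective g m x).2 U
      refine ⟨u, fun i hi => ?_, ?_⟩
      · by_cases hN : (⇑g)^[i] x ∈ ⋃ a, S a
        · let j : Fin (m + 1) := ⟨m - i, by omega⟩
          have hji : m - (j : ℕ) = i := by simp only [j]; omega
          have hzj : z j = (⇑g)^[i] x := by simp only [z, hji]
          have hj : j ∈ J := by
            simp only [J, Finset.mem_filter, Finset.mem_univ, true_and]
            rw [hzj]; exact hN
          obtain ⟨v, hv, hv'⟩ := hU j hj
          have h1 : w i - mapD I (⇑g)^[i] x u = v := by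
            refine (mapD_iterate_bijective g j (z j)).1 ?_
            rw [hv', map_sub]
            simp only [W, hji]
            rw [hzj, ← mapD_iterate_add]
            have : (j : ℕ) + i = m := by simp only [j]; omega
            rw [this]
          rw [h1, ← hzj, hS.stratTangent_eq (ha j (by rw [hzj]; exact hN))]
          exact hv
        · rw [stratTangent_eq_univ hN]
          exact mem_univ _
      · rw [← map_sub] at hU'
        exact (mapD_iterate_mem_stratTangent_iff hg m x _).1 hU'
    by_cases hy : (⇑g)^[m] x ∈ ⋃ b, S' b
    · obtain ⟨b, hb⟩ := mem_iUnion.1 hy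
      let K : Finset (Option (Fin (m + 1))) := insert none (J.map Function.Embedding.some)
      have hK : ∀ j ∈ J, some j ∈ K := fun j hj =>
        Finset.mem_insert_of_mem (Finset.mem_map_of_mem _ hj)
      have hKn : none ∈ K := Finset.mem_insert_self _ _
      obtain ⟨v, U, hv⟩ := (h a).2 b K (fun o => o.1.elim ((⇑g)^[m] x) z) ((⇑g)^[m] x) (by
        rintro ⟨_ | j, hj⟩
        · exact ⟨hb, rfl⟩
        · have hjJ : j ∈ J := by simpa [K] using hj
          have := (Finset.mem_filter.1 hjJ).2
          exact ⟨ha j this, hz j⟩)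
        (fun o => o.1.elim (mapD I (⇑g)^[m] x w') W)
      refine ⟨U, fun j hj => ⟨v ⟨some j, hK j hj⟩, (hv ⟨some j, hK j hj⟩).1,
        (hv ⟨some j, hK j hj⟩).2⟩, ?_⟩
      have h1 := hv ⟨none, hKn⟩
      rw [hS'.stratTangent_eq hb]
      let U' : E := U
      let v' : E := v ⟨none, hKn⟩
      have h2 : mapD I (id : M → M) ((⇑g)^[m] x) v' = mapD I (⇑g)^[m] x w' - U' := h1.2
      rw [mapD_id] at h2
      change mapD I (⇑g)^[m] x w' - U' ∈ _
      rw [← h2]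
      exact h1.1
    · obtain ⟨v, U, hv⟩ := (h a).1 J (fun j => z j) ((⇑g)^[m] x) (fun j =>
        ⟨ha j (Finset.mem_filter.1 j.2).2, hz j⟩) (fun j => W j)
      refine ⟨U, fun j hj => ⟨v ⟨j, hj⟩, (hv ⟨j, hj⟩).1, (hv ⟨j, hj⟩).2⟩, ?_⟩
      rw [stratTangent_eq_univ hy]
      exact mem_univ _
  · intro h a
    refine ⟨?_, fun b => ?_⟩
    · intro K x y hx (w : K → E)
      classical
      obtain ⟨u, hu, -⟩ := exists_of_orbitTransverse hg h y
        (fun j => if hj : j ∈ K then w ⟨j, hj⟩ else 0) 0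
      have key : ∀ j : K, ∃ v : E, v ∈ tangentVectors I (S (a j)) (x j) ∧
          mapD I (⇑g)^[((j : Fin d) : ℕ)] (x j) v = w j - u := by
        rintro ⟨j, hj⟩
        obtain ⟨v, hv, hv'⟩ := hu j (x ⟨j, hj⟩) (hx ⟨j, hj⟩).2
        simp only [hj, dite_true] at hv'
        exact ⟨v, hv (a j) (hx ⟨j, hj⟩).1, hv'⟩
      choose v hv using key
      exact ⟨v, u, hv⟩
    · intro K x y hx (w : K → E)
      classical
      obtain ⟨u, hu, hu'⟩ := exists_of_orbitTransverse hg h y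
        (fun j => if hj : some j ∈ K then w ⟨some j, hj⟩ else 0)
        (if hn : none ∈ K then w ⟨none, hn⟩ else 0)
      have key : ∀ o : K, ∃ v : E, v ∈ tangentVectors I (o.1.elim (S' b) fun j => S (a j)) (x o) ∧
          mapD I (o.1.elim id fun j => (⇑g)^[(j : ℕ)]) (x o) v = w o - u := by
        rintro ⟨_ | j, hj⟩
        · have h1 := hx ⟨none, hj⟩
          have h2 : x ⟨none, hj⟩ = y := h1.2
          simp only [hj, dite_true] at hu'
          refine ⟨w ⟨none, hj⟩ - u, ?_, mapD_id _ _⟩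
          have h3 := hu' b (by rw [← h2]; exact h1.1)
          rw [← h2] at h3
          exact h3
        · obtain ⟨v, hv, hv'⟩ := hu j (x ⟨some j, hj⟩) (hx ⟨some j, hj⟩).2
          simp only [hj, dite_true] at hv'
          exact ⟨v, hv (a j) (hx ⟨some j, hj⟩).1, hv'⟩
      choose v hv using key
      exact ⟨v, u, hv⟩

end Manifold

/-! ### Diffeomorphisms which are shears in a chart -/

section Euclidean

variable {F : Type*} [NormedAddCommGroup F] [NormedSpace ℝ F] [FiniteDimensional ℝ F]

/-- The sum of the identity and of a smooth contraction is a diffeomorphism. -/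
theorem exists_homeomorph_id_add {η : F → F} (hη : ContDiff ℝ ∞ η) {K : NNReal} (hK : K < 1)
    (hL : LipschitzWith K η) :
    ∃ ψ : F ≃ₜ F, (∀ x, ψ x = x + η x) ∧ ContDiff ℝ ∞ ψ.symm := by
  have h1 : ApproximatesLinearOn (fun x => x + η x)
      ((ContinuousLinearEquiv.refl ℝ F : F ≃L[ℝ] F) : F →L[ℝ] F) univ K := by
    intro x _ y _
    have : x + η x - (y + η y) - (ContinuousLinearEquiv.refl ℝ F : F →L[ℝ] F) (x - y) =
        η x - η y := by
      simp only [ContinuousLinearEquiv.coe_refl, ContinuousLinearMap.coe_id', id_eq]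
      abel
    rw [this, ← dist_eq_norm, ← dist_eq_norm]
    exact hL.dist_le_mul x y
  have h2 : Subsingleton F ∨
      K < ‖(((ContinuousLinearEquiv.refl ℝ F).symm : F ≃L[ℝ] F) : F →L[ℝ] F)‖₊⁻¹ := by
    rcases subsingleton_or_nontrivial F with h | h
    · exact Or.inl h
    · refine Or.inr ?_
      have : ‖(((ContinuousLinearEquiv.refl ℝ F).symm : F ≃L[ℝ] F) : F →L[ℝ] F)‖₊ = 1 :=
        ContinuousLinearMap.nnnorm_id
      rw [this]
      simpa using hK
  refine ⟨h1.toHomeomorph _ h2, fun x => rfl, ?_⟩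
  have hd : ∀ x, ∃ L : F ≃L[ℝ] F, HasFDerivAt (fun x => x + η x) (L : F →L[ℝ] F) x := by
    intro x
    have hu : IsUnit (1 - -(fderiv ℝ η x)) := by
      refine isUnit_one_sub_of_norm_lt_one ?_
      rw [norm_neg]
      exact (norm_fderiv_le_of_lipschitz ℝ hL).trans_lt (by exact_mod_cast hK)
    obtain ⟨u, hu⟩ := hu
    refine ⟨ContinuousLinearEquiv.unitsEquiv ℝ F u, ?_⟩
    have h3 : ((ContinuousLinearEquiv.unitsEquiv ℝ F u : F ≃L[ℝ] F) : F →L[ℝ] F) =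
        ContinuousLinearMap.id ℝ F + fderiv ℝ η x := by
      have h4 : ((ContinuousLinearEquiv.unitsEquiv ℝ F u : F ≃L[ℝ] F) : F →L[ℝ] F) = u := by
        ext; rfl
      rw [h4, hu, sub_neg_eq_add]
      rfl
    rw [h3]
    exact (hasFDerivAt_id x).add
      ((hη.differentiable (by norm_cast)).differentiableAt.hasFDerivAt)
  choose L hL' using hd
  exact (h1.toHomeomorph _ h2).contDiff_symm (f₀' := L) hL' (contDiff_id.add hη)

end Euclidean

section Manifold

variable {E : Type*} [NormedAddCommGroup E] [NormedSpace ℝ E]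
  {H : Type*} [TopologicalSpace H] {I : ModelWithCorners ℝ E H}
  {M : Type*} [TopologicalSpace M] [ChartedSpace H M]

section ExtendById

variable {F : Type*} [NormedAddCommGroup F]

open Classical in
/-- The map `ψ` of the coordinate space, transported to the domain of the chart `Φ` and extended by
the identity. -/
def extendById (Φ : OpenPartialHomeomorph M F) (ψ : F → F) (x : M) : M :=
  if x ∈ Φ.source then Φ.symm (ψ (Φ x)) else x

theorem extendById_of_mem {Φ : OpenPartialHomeomorph M F} {ψ : F → F} {x : M}
    (hx : x ∈ Φ.source) : extendById Φ ψ x = Φ.symm (ψ (Φ x)) := if_pos hx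

theorem extendById_of_notMem {Φ : OpenPartialHomeomorph M F} {ψ : F → F} {x : M}
    (hx : x ∉ Φ.source) : extendById Φ ψ x = x := if_neg hx

theorem mapsTo_target {Φ : OpenPartialHomeomorph M F} {ψ : F → F} {K : Set F}
    (hKt : K ⊆ Φ.target) (hψ : ∀ u ∉ K, ψ u = u) (hψK : ∀ u ∈ K, ψ u ∈ K) {u : F}
    (hu : u ∈ Φ.target) : ψ u ∈ Φ.target := by
  by_cases huK : u ∈ K
  · exact hKt (hψK u huK)
  · rwa [hψ u huK]

theorem extendById_extendById {Φ : OpenPartialHomeomorph M F} {ψ ψ' : F → F} {K : Set F}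
    (hKt : K ⊆ Φ.target) (hψ : ∀ u ∉ K, ψ u = u) (hψK : ∀ u ∈ K, ψ u ∈ K)
    (h : ∀ u, ψ' (ψ u) = u) (x : M) : extendById Φ ψ' (extendById Φ ψ x) = x := by
  by_cases hx : x ∈ Φ.source
  · have h1 := mapsTo_target hKt hψ hψK (Φ.map_source hx)
    rw [extendById_of_mem hx, extendById_of_mem (Φ.map_target h1), Φ.right_inv h1, h,
      Φ.left_inv hx]
  · rw [extendById_of_notMem hx, extendById_of_notMem hx]

variable [NormedSpace ℝ F]

theorem contMDiffOn_extendById [T2Space M] {V : Type*} [NormedAddCommGroup V] [NormedSpace ℝ V]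
    {Φ : OpenPartialHomeomorph M F} (hΦ : IsSmoothChart I Φ) {ψ : V → F → F} {U : Set V}
    (hU : IsOpen U) (hs : ContDiffOn ℝ ∞ (fun q : V × F => ψ q.1 q.2) (U ×ˢ univ))
    {K : Set F} (hK : IsCompact K) (hKt : K ⊆ Φ.target) (hψ : ∀ θ ∈ U, ∀ u ∉ K, ψ θ u = u)
    (hψK : ∀ θ ∈ U, ∀ u ∈ K, ψ θ u ∈ K) :
    ContMDiffOn (𝓘(ℝ, V).prod I) I ∞ (fun z : V × M => extendById Φ (ψ z.1) z.2)
      (U ×ˢ univ) := by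
  rintro ⟨θ, x⟩ ⟨hθ, -⟩
  refine ContMDiffAt.contMDiffWithinAt ?_
  by_cases hx : x ∈ Φ.source
  · have hΦx : ContMDiffAt (𝓘(ℝ, V).prod I) 𝓘(ℝ, F) ∞ (fun z : V × M => Φ z.2) (θ, x) :=
      (hΦ.contMDiffOn.contMDiffAt (Φ.open_source.mem_nhds hx)).comp (θ, x) (f := Prod.snd)
        contMDiffAt_snd
    have h2 : ContMDiffAt (𝓘(ℝ, V).prod I) 𝓘(ℝ, V × F) ∞
        (fun z : V × M => (z.1, Φ z.2)) (θ, x) := contMDiffAt_fst.prodMk_space hΦx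
    have h3 : ContMDiffAt 𝓘(ℝ, V × F) 𝓘(ℝ, F) ∞ (fun q : V × F => ψ q.1 q.2) (θ, Φ x) :=
      (hs.contDiffAt ((hU.prod isOpen_univ).mem_nhds ⟨hθ, mem_univ _⟩)).contMDiffAt
    have h4 : ContMDiffAt (𝓘(ℝ, V).prod I) 𝓘(ℝ, F) ∞
        (fun z : V × M => ψ z.1 (Φ z.2)) (θ, x) :=
      h3.comp (θ, x) (f := fun z : V × M => (z.1, Φ z.2)) h2
    have h5 : ψ θ (Φ x) ∈ Φ.target :=
      mapsTo_target hKt (hψ θ hθ) (hψK θ hθ) (Φ.map_source hx)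
    have h6 : ContMDiffAt (𝓘(ℝ, V).prod I) I ∞
        (fun z : V × M => Φ.symm (ψ z.1 (Φ z.2))) (θ, x) :=
      (hΦ.contMDiffOn_symm.contMDiffAt (Φ.open_target.mem_nhds h5)).comp (θ, x)
        (f := fun z : V × M => ψ z.1 (Φ z.2)) h4
    refine h6.congr_of_eventuallyEq ?_
    filter_upwards [(Φ.open_source.preimage continuous_snd).mem_nhds
      (show (θ, x) ∈ Prod.snd ⁻¹' Φ.source from hx)] with z hz
    exact extendById_of_mem hz
  · have hc : IsClosed (Φ.symm '' K) :=
      (hK.image_of_continuousOn (Φ.continuousOn_symm.mono hKt)).isClosed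
    have hxK : x ∉ Φ.symm '' K := by
      rintro ⟨u, hu, rfl⟩
      exact hx (Φ.map_target (hKt hu))
    have h6 : ContMDiffAt (𝓘(ℝ, V).prod I) I ∞ (fun z : V × M => z.2) (θ, x) := contMDiffAt_snd
    refine h6.congr_of_eventuallyEq ?_
    filter_upwards [(hc.isOpen_compl.preimage continuous_snd).mem_nhds
        (show (θ, x) ∈ Prod.snd ⁻¹' (Φ.symm '' K)ᶜ from hxK),
      (hU.preimage continuous_fst).mem_nhds
        (show (θ, x) ∈ Prod.fst ⁻¹' U from hθ)] with z hz hzU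
    by_cases hzs : z.2 ∈ Φ.source
    · have : Φ z.2 ∉ K := fun h => hz ⟨_, h, Φ.left_inv hzs⟩
      rw [extendById_of_mem hzs, hψ _ hzU _ this, Φ.left_inv hzs]
    · exact extendById_of_notMem hzs

/-- A diffeomorphism of the coordinate space with compact support in the image of a chart gives a
diffeomorphism of the manifold. -/
theorem exists_diffeomorph_extendById [T2Space M] {Φ : OpenPartialHomeomorph M F}
    (hΦ : IsSmoothChart I Φ) (ψ : F ≃ₜ F) (hs : ContDiff ℝ ∞ ψ) (hs' : ContDiff ℝ ∞ ψ.symm)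
    {K : Set F} (hK : IsCompact K) (hKt : K ⊆ Φ.target) (hψ : ∀ u ∉ K, ψ u = u)
    (hψK : ∀ u ∈ K, ψ u ∈ K) :
    ∃ D : M ≃ₘ^∞⟮I, I⟯ M, ∀ x, D x = extendById Φ ψ x := by
  have hψ' : ∀ u ∉ K, ψ.symm u = u := fun u hu => by
    rw [ψ.symm_apply_eq, hψ u hu]
  have hψK' : ∀ u ∈ K, ψ.symm u ∈ K := fun u hu => by
    by_contra h
    have := hψ _ h
    rw [ψ.apply_symm_apply] at this
    exact h (this ▸ hu)
  have key : ∀ φ : F → F, ContDiff ℝ ∞ φ → (∀ u ∉ K, φ u = u) → (∀ u ∈ K, φ u ∈ K) →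
      ContMDiff I I ∞ (extendById Φ φ) := by
    intro φ hφ h1 h2
    have h3 := contMDiffOn_extendById (V := ℝ) (ψ := fun _ => φ) hΦ isOpen_univ
      (hφ.comp contDiff_snd).contDiffOn hK hKt (fun _ _ => h1) (fun _ _ => h2)
    rw [univ_prod_univ, contMDiffOn_univ] at h3
    exact h3.comp (contMDiff_const (c := (0 : ℝ)) |>.prodMk contMDiff_id)
  exact ⟨⟨⟨extendById Φ ψ, extendById Φ ψ.symm,
    extendById_extendById hKt hψ hψK ψ.symm_apply_apply,
    extendById_extendById hKt hψ' hψK' ψ.apply_symm_apply⟩,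
    key ψ hs hψ hψK, key ψ.symm hs' hψ' hψK'⟩, fun x => rfl⟩

end ExtendById

variable {P Z : Type*} [NormedAddCommGroup P] [NormedSpace ℝ P] [FiniteDimensional ℝ P]
  [NormedAddCommGroup Z] [NormedSpace ℝ Z] [FiniteDimensional ℝ Z]

/-- A family `D` of diffeomorphisms, supported in a neighbourhood `U` of a point in the domain of
the chart `Φ`, which do not change the coordinate in `Z`, and which are shears on `C`. -/
structure IsShearFamily (I : ModelWithCorners ℝ E H) (Φ : OpenPartialHomeomorph M (P × Z))
    (U C : Set M) (ε : ℝ) (D : ShearParam P Z → (M ≃ₘ^∞⟮I, I⟯ M)) : Prop where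
  contMDiffOn : ContMDiffOn (𝓘(ℝ, ShearParam P Z).prod I) I ∞
    (fun z : ShearParam P Z × M => D z.1 z.2) (Metric.ball 0 ε ×ˢ univ)
  zero : D 0 = Diffeomorph.refl I M ∞
  eq_of_notMem : ∀ θ, ∀ x ∉ U, D θ x = x
  mem : ∀ θ, ∀ x ∈ U, D θ x ∈ U
  apply_snd : ∀ θ, ∀ x ∈ U, (Φ (D θ x)).2 = (Φ x).2
  apply : ∀ θ ∈ Metric.ball (0 : ShearParam P Z) ε, ∀ x ∈ C, Φ (D θ x) = shear θ (Φ x)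

/-- The family is `x ↦ x + b x • (θ.1 + θ.2 x, 0)` in the chart, with a smooth cut-off function `b`. For
small `θ` the added term is a contraction, so that these maps are diffeomorphisms. -/
theorem exists_isShearFamily [T2Space M] {Φ : OpenPartialHomeomorph M (P × Z)}
    (hΦ : IsSmoothChart I Φ) {x₀ : M} {U : Set M} (hU : IsOpen U) (hx₀ : x₀ ∈ U)
    (hUs : U ⊆ Φ.source) :
    ∃ (C : Set M) (ε : ℝ) (D : ShearParam P Z → (M ≃ₘ^∞⟮I, I⟯ M)),
      IsOpen C ∧ x₀ ∈ C ∧ C ⊆ U ∧ 0 < ε ∧ IsShearFamily I Φ U C ε D := by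
  -- a cut-off function
  have hΩ : IsOpen (Φ.target ∩ Φ.symm ⁻¹' U) := Φ.isOpen_inter_preimage_symm hU
  have hxΩ : Φ x₀ ∈ Φ.target ∩ Φ.symm ⁻¹' U :=
    ⟨Φ.map_source (hUs hx₀), by simpa [Φ.left_inv (hUs hx₀)] using hx₀⟩
  obtain ⟨R, hR, hRΩ⟩ := Metric.nhds_basis_closedBall.mem_iff.1 (hΩ.mem_nhds hxΩ)
  let b : ContDiffBump (Φ x₀) := ⟨R / 2, R, by positivity, by linarith⟩
  set K := Metric.closedBall (Φ x₀) R with hKdef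
  have hK : IsCompact K := isCompact_closedBall _ _
  have hbs : ContDiff ℝ ∞ b := b.contDiff
  have hbK : ∀ u ∉ K, b u = 0 := fun u hu => by
    refine b.zero_of_le_dist ?_
    exact (not_le.1 hu).le
  -- the perturbations, as linear functions of the parameter
  let η : ShearParam P Z → P × Z → P × Z := fun θ u => (b u • θ.1 + θ.2 (b u • u), 0)
  have hηs : ContDiff ℝ ∞ (fun q : ShearParam P Z × (P × Z) => η q.1 q.2) := by
    refine ContDiff.prodMk ?_ contDiff_const
    refine ContDiff.add ((hbs.comp contDiff_snd).smul contDiff_fst.fst) ?_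
    exact contDiff_fst.snd.clm_apply ((hbs.comp contDiff_snd).smul contDiff_snd)
  obtain ⟨c, hc⟩ : ∃ c : NNReal, LipschitzWith c (fun u : P × Z => (b u, b u • u)) := by
    refine ContDiff.lipschitzWith_of_hasCompactSupport (𝕂 := ℝ) (n := ∞) ?_
      (hbs.prodMk (hbs.smul contDiff_id)) (by simp)
    refine HasCompactSupport.of_support_subset_isCompact hK fun u hu => ?_
    by_contra h
    exact hu (by simp [hbK u h])
  have hηL : ∀ θ : ShearParam P Z, ‖θ‖ < 1 / (4 * (c + 1)) →
      LipschitzWith (1 / 2) (η θ) := by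
    intro θ hθ
    refine LipschitzWith.of_dist_le_mul fun u v => ?_
    have h1 := hc.dist_le_mul u v
    rw [Prod.dist_eq, max_le_iff] at h1
    obtain ⟨h1, h2⟩ := h1
    have h3 : dist (η θ u) (η θ v) =
        ‖(b u - b v) • θ.1 + θ.2 (b u • u - b v • v)‖ := by
      simp only [η, Prod.dist_eq, dist_self, map_sub, sub_smul]
      rw [max_eq_left dist_nonneg, dist_eq_norm]
      congr 1
      abel
    rw [Real.dist_eq] at h1
    rw [dist_eq_norm] at h2
    have h4 : ‖θ.1‖ ≤ ‖θ‖ := norm_fst_le θ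
    have h5 : ‖θ.2‖ ≤ ‖θ‖ := norm_snd_le θ
    have h6 : ‖(b u - b v) • θ.1 + θ.2 (b u • u - b v • v)‖ ≤
        (c * dist u v) * ‖θ‖ + ‖θ‖ * (c * dist u v) := by
      refine (norm_add_le _ _).trans (add_le_add ?_ ?_)
      · rw [norm_smul, Real.norm_eq_abs]
        gcongr
      · refine (θ.2.le_opNorm _).trans ?_
        gcongr
    have h7 : ‖θ‖ * (4 * (c + 1)) ≤ 1 := by
      rw [lt_div_iff₀ (by positivity)] at hθ
      exact hθ.le
    have h8 : ‖θ‖ * c ≤ 1 / 4 := by nlinarith [norm_nonneg θ]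
    rw [h3]
    refine h6.trans ?_
    push_cast
    nlinarith [dist_nonneg (x := u) (y := v), mul_le_mul_of_nonneg_right h8
      (dist_nonneg (x := u) (y := v))]
  set ε : ℝ := 1 / (4 * (c + 1)) with hεdef
  have hε : 0 < ε := by positivity
  have hD : ∀ θ : ShearParam P Z, ∃ D : M ≃ₘ^∞⟮I, I⟯ M,
      (‖θ‖ < ε → ∀ x, D x = extendById Φ (fun u => u + η θ u) x) ∧
      (∀ x ∉ U, D x = x) ∧ (∀ x ∈ U, D x ∈ U) ∧ (∀ x ∈ U, (Φ (D x)).2 = (Φ x).2) := by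
    intro θ
    by_cases hθ : ‖θ‖ < ε
    swap
    · exact ⟨Diffeomorph.refl I M ∞, fun h => absurd h hθ, by simp, by simp, by simp⟩
    have hs1 : ContDiff ℝ ∞ (η θ) := hηs.comp (contDiff_const.prodMk contDiff_id)
    obtain ⟨ψ, hψ, hψs⟩ := exists_homeomorph_id_add hs1 (by norm_num) (hηL θ hθ)
    have hψ' : ⇑ψ = fun u => u + η θ u := funext hψ
    have hψid : ∀ u ∉ K, ψ u = u := fun u hu => by simp [hψ, η, hbK u hu]
    have hψK : ∀ u ∈ K, ψ u ∈ K := fun u hu => by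
      by_contra h
      exact h (by rwa [ψ.injective (hψid _ h)])
    have hKt : K ⊆ Φ.target := fun u hu => (hRΩ hu).1
    obtain ⟨D, hD⟩ := exists_diffeomorph_extendById hΦ ψ
      (by rw [hψ']; exact contDiff_id.add hs1) hψs hK hKt hψid hψK
    have hDK : ∀ x ∈ Φ.source, Φ x ∈ K → D x ∈ U := fun x hx hxK => by
      rw [hD, extendById_of_mem hx]
      exact (hRΩ (hψK _ hxK)).2
    have hDK' : ∀ x ∈ Φ.source, Φ x ∉ K → D x = x := fun x hx hxK => by
      rw [hD, extendById_of_mem hx, hψid _ hxK, Φ.left_inv hx]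
    refine ⟨D, fun _ x => by rw [hD, hψ'], fun x hx => ?_, fun x hx => ?_, fun x hx => ?_⟩
    · by_cases hxs : x ∈ Φ.source
      · refine hDK' x hxs fun hxK => hx ?_
        have := (hRΩ hxK).2
        rwa [mem_preimage, Φ.left_inv hxs] at this
      · rw [hD, extendById_of_notMem hxs]
    · by_cases hxK : Φ x ∈ K
      · exact hDK x (hUs hx) hxK
      · rwa [hDK' x (hUs hx) hxK]
    · rw [hD, extendById_of_mem (hUs hx),
        Φ.right_inv (mapsTo_target hKt hψid hψK (Φ.map_source (hUs hx))), hψ]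
      simp [η]
  choose D hDf hD1 hD2 hD3 using hD
  have hηid : ∀ θ : ShearParam P Z, ∀ u ∉ K, u + η θ u = u := fun θ u hu => by
    simp [η, hbK u hu]
  have hηK : ∀ θ : ShearParam P Z, ‖θ‖ < ε → ∀ u ∈ K, u + η θ u ∈ K := by
    intro θ hθ u hu
    have hs1 : ContDiff ℝ ∞ (η θ) := hηs.comp (contDiff_const.prodMk contDiff_id)
    obtain ⟨ψ, hψ, -⟩ := exists_homeomorph_id_add hs1 (by norm_num) (hηL θ hθ)
    rw [← hψ]
    by_contra h
    have := hηid θ _ h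
    rw [← hψ] at this
    exact h (by rwa [ψ.injective this])
  refine ⟨Φ.source ∩ Φ ⁻¹' Metric.ball (Φ x₀) (R / 2), ε, D,
    Φ.isOpen_inter_preimage Metric.isOpen_ball,
    ⟨hUs hx₀, Metric.mem_ball_self (by positivity)⟩, fun x hx => ?_, hε, ?_, ?_, hD1, hD2, hD3,
    fun θ hθ x hx => ?_⟩
  · have h1 : Φ x ∈ K := Metric.closedBall_subset_closedBall (by linarith)
      (Metric.ball_subset_closedBall hx.2)
    have := (hRΩ h1).2
    rwa [mem_preimage, Φ.left_inv hx.1] at this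
  · have := contMDiffOn_extendById (V := ShearParam P Z) hΦ (ψ := fun θ u => u + η θ u)
      (Metric.isOpen_ball (x := 0) (ε := ε)) (contDiff_snd.add hηs).contDiffOn hK
      (fun u hu => (hRΩ hu).1) (fun θ _ => hηid θ)
      (fun θ hθ => hηK θ (mem_ball_zero_iff.1 hθ))
    exact this.congr fun z hz => hDf z.1 (mem_ball_zero_iff.1 hz.1) z.2
  · refine Diffeomorph.ext fun x => ?_
    rw [hDf 0 (by simpa using hε)]
    by_cases hx : x ∈ Φ.source
    · rw [extendById_of_mem hx]
      have : Φ x + η 0 (Φ x) = Φ x := by ext1 <;> simp [η]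
      rw [this, Φ.left_inv hx]
      rfl
    · rw [extendById_of_notMem hx]
      rfl
  · have hb1 : b (Φ x) = 1 := b.one_of_mem_closedBall (Metric.ball_subset_closedBall hx.2)
    have h1 : shear θ (Φ x) = Φ x + η θ (Φ x) := by simp [η, hb1, shear]
    rw [hDf θ (mem_ball_zero_iff.1 hθ), extendById_of_mem hx.1, Φ.right_inv, h1]
    exact mapsTo_target (fun u hu => (hRΩ hu).1) (hηid θ) (hηK θ (mem_ball_zero_iff.1 hθ))
      (Φ.map_source hx.1)

end Manifold

/-! ### Perturbations by shears -/

section Manifold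

variable {E : Type*} [NormedAddCommGroup E] [NormedSpace ℝ E]
  {H : Type*} [TopologicalSpace H] {I : ModelWithCorners ℝ E H}
  {M : Type*} [TopologicalSpace M] [ChartedSpace H M]

section Family

variable {P Z : Type*} [NormedAddCommGroup P] [NormedSpace ℝ P]
  [NormedAddCommGroup Z] [NormedSpace ℝ Z]
  {Φ : OpenPartialHomeomorph M (P × Z)} {U C : Set M} {ε : ℝ}
  {D : ShearParam P Z → (M ≃ₘ^∞⟮I, I⟯ M)} {ι' : Type*} {S' : ι' → Set M}

/-- The strata of `S'` are products of `P` with subsets of `Z`, and the family does not change the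
coordinate in `Z`. -/
theorem IsShearFamily.image_eq (hD : IsShearFamily I Φ U C ε D)
    (hS' : ∀ y ∈ U, ∀ y' ∈ U, (Φ y).2 = (Φ y').2 → ∀ b, y ∈ S' b ↔ y' ∈ S' b)
    (θ : ShearParam P Z) (b : ι') : D θ '' S' b = S' b := by
  have h : ∀ y, D θ y ∈ S' b ↔ y ∈ S' b := fun y => by
    by_cases hy : y ∈ U
    · exact hS' _ (hD.mem θ y hy) _ hy (hD.apply_snd θ y hy) b
    · rw [hD.eq_of_notMem θ y hy]
  ext y
  refine ⟨?_, fun hy => ⟨(D θ).symm y, ?_, (D θ).apply_symm_apply y⟩⟩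
  · rintro ⟨x, hx, rfl⟩
    exact (h x).2 hx
  · rw [← h, (D θ).apply_symm_apply]
    exact hy

/-- The isotopy to the identity is obtained by shrinking the parameter. -/
theorem IsShearFamily.trans_mem_diffPreserving (hD : IsShearFamily I Φ U C ε D)
    (hS' : ∀ y ∈ U, ∀ y' ∈ U, (Φ y).2 = (Φ y').2 → ∀ b, y ∈ S' b ↔ y' ∈ S' b)
    {g : M ≃ₘ^∞⟮I, I⟯ M} (hg : g ∈ diffPreserving I S') {θ : ShearParam P Z}
    (hθ : θ ∈ Metric.ball 0 ε) : (D θ).trans g ∈ diffPreserving I S' := by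
  obtain ⟨⟨G, hGs, hG0, hG1⟩, hgS⟩ := hg
  refine ⟨⟨fun s => (D (s • θ)).trans (G s), ?_, ?_, ?_⟩, fun b => ?_⟩
  · have h1 : ContMDiffOn (𝓘(ℝ, ℝ).prod I) (𝓘(ℝ, ShearParam P Z).prod I) ∞
        (fun z : ℝ × M => (z.1 • θ, z.2)) (Icc 0 1 ×ˢ univ) := by
      refine ContMDiffOn.prodMk ?_ contMDiffOn_snd
      have h2 : ContMDiff 𝓘(ℝ, ℝ) 𝓘(ℝ, ShearParam P Z) ∞ (fun s : ℝ => s • θ) :=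
        (contDiff_id.smul contDiff_const).contMDiff
      exact (h2.comp contMDiff_fst).contMDiffOn
    have h3 : MapsTo (fun z : ℝ × M => (z.1 • θ, z.2)) (Icc 0 1 ×ˢ univ)
        (Metric.ball (0 : ShearParam P Z) ε ×ˢ univ) := by
      rintro ⟨s, x⟩ ⟨⟨hs0, hs1⟩, -⟩
      refine ⟨?_, mem_univ _⟩
      rw [mem_ball_zero_iff] at hθ ⊢
      rw [norm_smul, Real.norm_eq_abs, abs_of_nonneg hs0]
      nlinarith [norm_nonneg θ]
    have h4 : ContMDiffOn (𝓘(ℝ, ℝ).prod I) (𝓘(ℝ, ℝ).prod I) ∞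
        (fun z : ℝ × M => (z.1, D (z.1 • θ) z.2)) (Icc 0 1 ×ˢ univ) :=
      contMDiffOn_fst.prodMk (hD.contMDiffOn.comp h1 h3)
    exact hGs.comp h4 fun z hz => ⟨hz.1, mem_univ _⟩
  · simp only [zero_smul, hD.zero, hG0]
    exact Diffeomorph.ext fun x => rfl
  · simp only [one_smul, hG1]
  · rw [Diffeomorph.coe_trans, image_comp, hD.image_eq hS', hgS]

/-- To approximate `g` it suffices to find arbitrarily small parameters `θ` for which the
perturbation of `g` is as required. -/
theorem IsShearFamily.mem_closure (hD : IsShearFamily I Φ U C ε D) (hε : 0 < ε)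
    (hS' : ∀ y ∈ U, ∀ y' ∈ U, (Φ y).2 = (Φ y').2 → ∀ b, y ∈ S' b ↔ y' ∈ S' b)
    {g : diffPreserving I S'} {A : Set (diffPreserving I S')} {Θ : Set (ShearParam P Z)}
    (hΘ : (0 : ShearParam P Z) ∈ closure Θ)
    (hA : ∀ᶠ θ in 𝓝 0, θ ∈ Θ → ∀ h : (D θ).trans g.1 ∈ diffPreserving I S',
      (⟨_, h⟩ : diffPreserving I S') ∈ A) : g ∈ closure A := by
  have hball := Metric.ball_mem_nhds (0 : ShearParam P Z) hε
  have hc : ContinuousAt (fun θ => (D θ).trans g.1) 0 :=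
    continuousAt_smoothTopology (U := Metric.ball 0 ε) hball
      (g.1.contMDiff.comp_contMDiffOn hD.contMDiffOn)
  have h0 : (D 0).trans g.1 = g.1 := by
    rw [hD.zero]
    exact Diffeomorph.ext fun x => rfl
  rw [closure_subtype, mem_closure_iff_nhds]
  intro V hV
  rw [← h0] at hV
  obtain ⟨θ, ⟨⟨hθV, hθA⟩, hθb⟩, hθ⟩ :=
    mem_closure_iff_nhds.1 hΘ _ (inter_mem (inter_mem (hc hV) hA) hball)
  have hmem := hD.trans_mem_diffPreserving hS' g.2 hθb
  exact ⟨_, hθV, ⟨_, hmem⟩, hθA hθ hmem, rfl⟩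

/-- The orbit of a point of `U` passes through `U`, where the map is perturbed, only
at time `0` among the first `m` steps. -/
theorem IsShearFamily.iterate_trans (hD : IsShearFamily I Φ U C ε D) {g : M ≃ₘ^∞⟮I, I⟯ M} {m : ℕ}
    (hg : ∀ i, 1 ≤ i → i < m → ∀ x ∈ U, g^[i] x ∉ U) (θ : ShearParam P Z) {x : M} (hx : x ∈ U)
    {i : ℕ} (hi : i < m) : ((D θ).trans g)^[i + 1] x = g^[i + 1] (D θ x) := by
  induction i with
  | zero => rfl
  | succ i ih =>
    rw [Function.iterate_succ_apply', ih (by omega), Function.iterate_succ_apply' _ (i + 1),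
      Diffeomorph.coe_trans, Function.comp_apply,
      hD.eq_of_notMem θ _ (hg (i + 1) (by omega) hi _ (hD.mem θ x hx))]

end Family

theorem exists_disjoint_iterates [IsManifold I ∞ M] [T2Space M] [LocallyCompactSpace M]
    {g : M ≃ₘ^∞⟮I, I⟯ M} {x : M} {m : ℕ} (h : ∀ i, 1 ≤ i → i < m → g^[i] x ≠ x) :
    ∃ U ∈ 𝓝 x, ∀ᶠ g' : M ≃ₘ^∞⟮I, I⟯ M in 𝓝 g, ∀ i, 1 ≤ i → i < m → ∀ y ∈ U, (⇑g')^[i] y ∉ U := by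
  have h1 : ∀ i ∈ Finset.Ico 1 m, ∃ U ∈ 𝓝 x,
      ∀ᶠ g' : M ≃ₘ^∞⟮I, I⟯ M in 𝓝 g, ∀ y ∈ U, (⇑g')^[i] y ∉ U := by
    intro i hi
    rw [Finset.mem_Ico] at hi
    obtain ⟨A, B, hA, hB, hxA, hxB, hAB⟩ := t2_separation (h i hi.1 hi.2)
    have hc := (continuous_eval_iterate (I := I) (M := M) i).continuousAt (x := (g, x))
    obtain ⟨G, hG, V, hV, hGV⟩ := mem_nhds_prod_iff.1 (hc (hA.mem_nhds hxA))
    refine ⟨V ∩ B, inter_mem hV (hB.mem_nhds hxB), ?_⟩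
    filter_upwards [hG] with g' hg' y hy hy'
    have h2 : (⇑g')^[i] y ∈ A := hGV (show (g', y) ∈ G ×ˢ V from ⟨hg', hy.1⟩)
    exact disjoint_left.1 hAB h2 hy'.2
  choose! U hU hUg using h1
  refine ⟨⋂ i ∈ Finset.Ico 1 m, U i, (biInter_finset_mem _).2 hU, ?_⟩
  filter_upwards [(Filter.eventually_all_finset _).2 hUg] with g' hg' i hi hi' y hy hy'
  have h3 := Finset.mem_Ico.2 ⟨hi, hi'⟩
  exact hg' i h3 y (mem_iInter₂.1 hy i h3) (mem_iInter₂.1 hy' i h3)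

end Manifold

/-! ### Charts adapted to a pair of transverse stratified sets -/

section Manifold

variable {E : Type*} [NormedAddCommGroup E] [NormedSpace ℝ E]
  {H : Type*} [TopologicalSpace H] {I : ModelWithCorners ℝ E H}
  {M : Type*} [TopologicalSpace M] [ChartedSpace H M]
  {ι ι' : Type*} {S : ι → Set M} {ρ : ι → ℕ} {S' : ι' → Set M} {ρ' : ι' → ℕ} {B : ℕ}

open Classical in
/-- The value of `ρ` on the stratum through `x`, and a larger value `B` if there is none. -/
def level (S' : ι' → Set M) (ρ' : ι' → ℕ) (B : ℕ) (x : M) : ℕ :=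
  if h : ∃ a, x ∈ S' a then ρ' h.choose else B

theorem IsStratification.level_of_mem (hS' : IsStratification I S' ρ') {a : ι'} {x : M}
    (hx : x ∈ S' a) : level S' ρ' B x = ρ' a := by
  have h : ∃ a, x ∈ S' a := ⟨a, hx⟩
  rw [level, dif_pos h, hS'.eq_of_mem h.choose_spec hx]

omit [TopologicalSpace M] in
theorem level_of_notMem {x : M} (hx : x ∉ ⋃ a, S' a) : level S' ρ' B x = B :=
  dif_neg fun ⟨a, ha⟩ => hx (mem_iUnion.2 ⟨a, ha⟩)

theorem IsStratification.level_le (hS' : IsStratification I S' ρ')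
    (hB : ∀ a, (S' a).Nonempty → ρ' a < B) (x : M) : level S' ρ' B x ≤ B := by
  by_cases hx : x ∈ ⋃ a, S' a
  · obtain ⟨a, ha⟩ := mem_iUnion.1 hx
    rw [hS'.level_of_mem ha]
    exact (hB a ⟨x, ha⟩).le
  · rw [level_of_notMem hx]

/-- The level is lower semicontinuous: this allows induction on the level. -/
theorem IsStratification.eventually_le_level [T2Space M] (hS' : IsStratification I S' ρ')
    (hB : ∀ a, (S' a).Nonempty → ρ' a < B) (x : M) :
    ∀ᶠ y in 𝓝 x, level S' ρ' B x ≤ level S' ρ' B y := by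
  by_cases hx : x ∈ ⋃ a, S' a
  · obtain ⟨a, ha⟩ := mem_iUnion.1 hx
    obtain ⟨p, r, Φ, hxΦ, -, hord⟩ := hS'.exists_chart a x ha
    filter_upwards [Φ.open_source.mem_nhds hxΦ] with y hy
    rw [hS'.level_of_mem ha]
    by_cases hyS : y ∈ ⋃ a, S' a
    · obtain ⟨b, hb⟩ := mem_iUnion.1 hyS
      rw [hS'.level_of_mem hb]
      rcases hord y hy b hb with rfl | h
      · exact le_rfl
      · exact h.le
    · rw [level_of_notMem hyS]
      exact (hB a ⟨x, ha⟩).le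
  · filter_upwards [hS'.isCompact.isClosed.isOpen_compl.mem_nhds hx] with y hy
    rw [level_of_notMem hx, level_of_notMem hy]

/-- Coordinates in `P × Z` around a point `x₀` of `S`, in which the strata of `S'` are products of
`P` with subsets of `Z`, the one through `x₀` being `P × {0}` (the complement of `S'` is regarded as
a stratum here, with `Z = 0`), and in which the translations in `P` are transverse to `S`. -/
structure IsPatch (I : ModelWithCorners ℝ E H) (S : ι → Set M) (S' : ι' → Set M) (ρ' : ι' → ℕ)
    (B : ℕ) (x₀ : M) {P Z : Type*} [NormedAddCommGroup P] [NormedSpace ℝ P]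
    [NormedAddCommGroup Z] [NormedSpace ℝ Z] (Φ : OpenPartialHomeomorph M (P × Z)) : Prop
    extends IsSmoothChart I Φ where
  mem_source : x₀ ∈ Φ.source
  mem_congr : ∀ y ∈ Φ.source, ∀ y' ∈ Φ.source, (Φ y).2 = (Φ y').2 → ∀ b, y ∈ S' b ↔ y' ∈ S' b
  snd_eq_zero : ∀ y ∈ Φ.source, level S' ρ' B y ≤ level S' ρ' B x₀ → (Φ y).2 = 0
  transverse : ∀ y ∈ Φ.source, ∀ w : E, ∃ e : P,
    w - chartDSymm I Φ (Φ y) (e, 0) ∈ stratTangent I S y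

theorem IsStratification.exists_notMem_stratTangent (hS : IsStratification I S ρ) {x : M}
    (hx : x ∈ ⋃ a, S a) : ∃ w : E, w ∉ stratTangent I S x := by
  obtain ⟨a, ha⟩ := mem_iUnion.1 hx
  obtain ⟨p, r, Θ, hxΘ, hΘ, -⟩ := hS.exists_chart a x ha
  obtain ⟨e, he⟩ := exists_ne (0 : Euc (r + 1))
  refine ⟨chartDSymm I Θ (Θ x) (0, e), fun h => he ?_⟩
  rw [hS.stratTangent_eq ha] at h
  have h1 := (hΘ.mem_tangentVectors_iff hxΘ ha _).1 h
  rwa [hΘ.chartD_chartDSymm hxΘ] at h1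

theorem IsPatch.nontrivial (hS : IsStratification I S ρ) {x₀ : M} {P Z : Type*}
    [NormedAddCommGroup P] [NormedSpace ℝ P] [NormedAddCommGroup Z] [NormedSpace ℝ Z]
    {Φ : OpenPartialHomeomorph M (P × Z)} (hΦ : IsPatch I S S' ρ' B x₀ Φ)
    (hx₀ : x₀ ∈ ⋃ a, S a) : Nontrivial P := by
  by_contra hP
  rw [not_nontrivial_iff_subsingleton] at hP
  obtain ⟨w, hw⟩ := hS.exists_notMem_stratTangent (I := I) hx₀
  obtain ⟨e, he⟩ := hΦ.transverse x₀ hΦ.mem_source w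
  have h0 : ((e, 0) : P × Z) = 0 := Prod.ext (Subsingleton.elim _ _) rfl
  rw [h0, map_zero, sub_zero] at he
  exact hw he

/-- The equations of the strata of `S` can be solved by translations in `P`. -/
theorem IsPatch.exists_mfderiv_eq {x₀ : M} {P Z : Type*}
    [NormedAddCommGroup P] [NormedSpace ℝ P] [NormedAddCommGroup Z] [NormedSpace ℝ Z]
    {Φ : OpenPartialHomeomorph M (P × Z)} (hΦ : IsPatch I S S' ρ' B x₀ Φ) {O : Set M} {c : ℕ}
    {ζ : M → Euc c} (hζ : IsDefiningFunction I S O c ζ) {y : M} (hy : y ∈ Φ.source) (hyO : y ∈ O)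
    (h0 : ζ y = 0) (a : Euc c) :
    ∃ e : P, (mfderiv I 𝓘(ℝ, Euc c) ζ y : E →L[ℝ] Euc c) (chartDSymm I Φ (Φ y) (e, 0)) = a := by
  let L : E →L[ℝ] Euc c := mfderiv I 𝓘(ℝ, Euc c) ζ y
  obtain ⟨w, hw⟩ : ∃ w : E, L w = a := hζ.surjective y hyO h0 a
  obtain ⟨e, he⟩ := hΦ.transverse y hy w
  refine ⟨e, ?_⟩
  have h1 : L (w - chartDSymm I Φ (Φ y) (e, 0)) = 0 := (hζ.mem_iff y hyO h0 _).1 he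
  rw [map_sub, sub_eq_zero] at h1
  exact h1.symm.trans hw

theorem IsSmoothChart.contDiffAt_comp_symm {F F' : Type*} [NormedAddCommGroup F]
    [NormedSpace ℝ F] [NormedAddCommGroup F'] [NormedSpace ℝ F']
    {Φ : OpenPartialHomeomorph M F} (hΦ : IsSmoothChart I Φ) {x : M} (hx : x ∈ Φ.source)
    {f : M → F'} (hf : ContMDiffAt I 𝓘(ℝ, F') ∞ f x) :
    ContDiffAt ℝ ∞ (fun u => f (Φ.symm u)) (Φ x) := by
  have h1 : ContMDiffAt I 𝓘(ℝ, F') ∞ f (Φ.symm (Φ x)) := by rwa [Φ.left_inv hx]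
  exact (h1.comp (Φ x) (hΦ.contMDiffOn_symm.contMDiffAt
    (Φ.open_target.mem_nhds (Φ.map_source hx)))).contDiffAt

theorem IsSmoothChart.fderiv_comp_symm {F F' : Type*} [NormedAddCommGroup F]
    [NormedSpace ℝ F] [NormedAddCommGroup F'] [NormedSpace ℝ F']
    {Φ : OpenPartialHomeomorph M F} (hΦ : IsSmoothChart I Φ) {x : M} (hx : x ∈ Φ.source)
    {f : M → F'} (hf : ContMDiffAt I 𝓘(ℝ, F') ∞ f x) (e : F) :
    fderiv ℝ (fun u => f (Φ.symm u)) (Φ x) e =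
      (mfderiv I 𝓘(ℝ, F') f x : E →L[ℝ] F') (chartDSymm I Φ (Φ x) e) := by
  let L : E →L[ℝ] F' := mfderiv I 𝓘(ℝ, F') f x
  have h1 : HasMFDerivAt I 𝓘(ℝ, F') f (Φ.symm (Φ x)) L := by
    rw [Φ.left_inv hx]
    exact (hf.mdifferentiableAt (by simp)).hasMFDerivAt
  have h2 : HasFDerivAt (fun u => f (Φ.symm u)) (L.comp (chartDSymm I Φ (Φ x))) (Φ x) :=
    hasMFDerivAt_iff_hasFDerivAt.1 (h1.comp (Φ x) (hΦ.hasMFDerivAt_symm (Φ.map_source hx)))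
  exact congrArg (fun A : F →L[ℝ] F' => A e) h2.fderiv

/-- If, at one point, translations along the first factor of a chart are transverse to `S`, then so
they are in a neighbourhood. -/
theorem IsStratification.eventually_transverse [FiniteDimensional ℝ E]
    (hS : IsStratification I S ρ) {x₀ : M}
    {p q : ℕ} {Φ : OpenPartialHomeomorph M (Euc p × Euc q)} (hΦ : IsSmoothChart I Φ)
    (hx₀ : x₀ ∈ Φ.source) {a : ι} (ha : x₀ ∈ S a)
    (h : ∀ w : E, ∃ e : Euc p, w - chartDSymm I Φ (Φ x₀) (e, 0) ∈ stratTangent I S x₀) :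
    ∀ᶠ y in 𝓝 x₀, ∀ w : E, ∃ e : Euc p,
      w - chartDSymm I Φ (Φ y) (e, 0) ∈ stratTangent I S y := by
  obtain ⟨p₁, r₁, Θ, hxΘ, hΘ, -⟩ := hS.exists_chart a x₀ ha
  let ζ : Euc p × Euc q → Euc (r₁ + 1) := fun u => (Θ (Φ.symm u)).2
  have hfd : ∀ y ∈ Φ.source ∩ Θ.source, HasFDerivAt ζ
      ((ContinuousLinearMap.snd ℝ (Euc p₁) (Euc (r₁ + 1))).comp
        ((chartD I Θ y).comp (chartDSymm I Φ (Φ y)))) (Φ y) := by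
    intro y hy
    have h1 := hΦ.hasMFDerivAt_symm (Φ.map_source hy.1)
    have h2 : HasMFDerivAt I 𝓘(ℝ, Euc p₁ × Euc (r₁ + 1)) Θ (Φ.symm (Φ y)) (chartD I Θ y) := by
      rw [Φ.left_inv hy.1]
      exact hΘ.hasMFDerivAt hy.2
    have h3 := h2.comp (Φ y) h1
    exact (ContinuousLinearMap.snd ℝ (Euc p₁) (Euc (r₁ + 1))).hasFDerivAt.comp (Φ y)
      (hasMFDerivAt_iff_hasFDerivAt.1 h3)
  have hsm : ContDiffAt ℝ ∞ ζ (Φ x₀) := by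
    have h1 : ContMDiffAt 𝓘(ℝ, Euc p × Euc q) I ∞ Φ.symm (Φ x₀) :=
      hΦ.contMDiffOn_symm.contMDiffAt (Φ.open_target.mem_nhds (Φ.map_source hx₀))
    have h2 : ContMDiffAt I 𝓘(ℝ, Euc p₁ × Euc (r₁ + 1)) ∞ Θ (Φ.symm (Φ x₀)) := by
      rw [Φ.left_inv hx₀]
      exact hΘ.contMDiffOn.contMDiffAt (Θ.open_source.mem_nhds hxΘ)
    exact (h2.comp (Φ x₀) h1).contDiffAt.snd
  let Λ : M → (Euc p →L[ℝ] Euc (r₁ + 1)) := fun y =>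
    (fderiv ℝ ζ (Φ y)).comp (ContinuousLinearMap.inl ℝ (Euc p) (Euc q))
  have hΛ : ∀ y ∈ Φ.source ∩ Θ.source, ∀ e,
      Λ y e = (chartD I Θ y (chartDSymm I Φ (Φ y) (e, 0))).2 := by
    intro y hy e
    simp only [Λ, (hfd y hy).fderiv]
    rfl
  have hΛc : ContinuousAt Λ x₀ := by
    have h1 : ContinuousAt (fderiv ℝ ζ) (Φ x₀) :=
      (hsm.fderiv_right (m := 0) (by norm_num)).continuousAt
    have h2 : ContinuousAt (fun y => fderiv ℝ ζ (Φ y)) x₀ :=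
      ContinuousAt.comp (g := fderiv ℝ ζ) h1 (Φ.continuousAt hx₀)
    exact h2.clm_comp continuousAt_const
  have hsurj : Function.Surjective (Λ x₀) := by
    intro z
    obtain ⟨e, he⟩ := h (chartDSymm I Θ (Θ x₀) (0, z))
    refine ⟨e, ?_⟩
    rw [hS.stratTangent_eq ha] at he
    have h1 := (hΘ.mem_tangentVectors_iff hxΘ ha _).1 he
    rw [map_sub, hΘ.chartD_chartDSymm hxΘ, Prod.snd_sub, sub_eq_zero] at h1
    rw [hΛ x₀ ⟨hx₀, hxΘ⟩, ← h1]
  filter_upwards [eventually_surjective hΛc hsurj, Φ.open_source.mem_nhds hx₀,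
    Θ.open_source.mem_nhds hxΘ] with y hy hyΦ hyΘ w
  obtain ⟨e, he⟩ := hy (chartD I Θ y w).2
  rw [hΛ y ⟨hyΦ, hyΘ⟩] at he
  refine ⟨e, ?_⟩
  rw [← hΘ.chartDSymm_chartD hyΘ (w - chartDSymm I Φ (Φ y) (e, 0))]
  have h1 : chartD I Θ y (w - chartDSymm I Φ (Φ y) (e, 0)) =
      ((chartD I Θ y (w - chartDSymm I Φ (Φ y) (e, 0))).1, 0) := by
    refine Prod.ext rfl ?_
    rw [map_sub, Prod.snd_sub, he, sub_self]
  rw [h1]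
  exact hΘ.chartDSymm_mem_stratTangent hyΘ _

theorem isPatch_restrOpen {x₀ : M} {P Z : Type*}
    [NormedAddCommGroup P] [NormedSpace ℝ P] [NormedAddCommGroup Z] [NormedSpace ℝ Z]
    {Φ : OpenPartialHomeomorph M (P × Z)} {s : Set M} (hs : IsOpen s) (hxs : x₀ ∈ s)
    (hΦ : IsSmoothChart I Φ) (hx₀ : x₀ ∈ Φ.source)
    (h1 : ∀ y ∈ Φ.source, y ∈ s → ∀ y' ∈ Φ.source, y' ∈ s →
      (Φ y).2 = (Φ y').2 → ∀ b, y ∈ S' b ↔ y' ∈ S' b)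
    (h2 : ∀ y ∈ Φ.source, y ∈ s → level S' ρ' B y ≤ level S' ρ' B x₀ → (Φ y).2 = 0)
    (h3 : ∀ y ∈ Φ.source, y ∈ s → ∀ w : E, ∃ e : P,
      w - chartDSymm I Φ (Φ y) (e, 0) ∈ stratTangent I S y) :
    IsPatch I S S' ρ' B x₀ (Φ.restrOpen s hs) where
  toIsSmoothChart := hΦ.restr hs
  mem_source := ⟨hx₀, hxs⟩
  mem_congr y hy y' hy' h := h1 y hy.1 hy.2 y' hy'.1 hy'.2 h
  snd_eq_zero y hy h := h2 y hy.1 hy.2 h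
  transverse y hy w := h3 y hy.1 hy.2 w

theorem IsSmoothChart.trans_continuousLinearEquiv {F F' : Type*} [NormedAddCommGroup F]
    [NormedSpace ℝ F] [NormedAddCommGroup F'] [NormedSpace ℝ F']
    {Φ : OpenPartialHomeomorph M F} (hΦ : IsSmoothChart I Φ) (L : F ≃L[ℝ] F') :
    IsSmoothChart I (Φ.transHomeomorph L.toHomeomorph) where
  contMDiffOn := L.contDiff.contMDiff.comp_contMDiffOn hΦ.contMDiffOn
  contMDiffOn_symm := hΦ.contMDiffOn_symm.comp L.symm.contDiff.contMDiff.contMDiffOn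
    fun _ hu => hu

/-- Around a point of `S'` one takes coordinates adapted to `S'`; their translations along the stratum
of `S'` are transverse to `S` at that point, hence also nearby. -/
theorem IsStratification.exists_isPatch [FiniteDimensional ℝ E] [T2Space M]
    (hS : IsStratification I S ρ) (hS' : IsStratification I S' ρ')
    (hB : ∀ a, (S' a).Nonempty → ρ' a < B) (hSS' : ∀ a b, TransverseSubmanifolds I (S a) (S' b))
    {x₀ : M} (hx₀ : x₀ ∈ ⋃ a, S a) :
    ∃ (p q : ℕ) (Φ : OpenPartialHomeomorph M (Euc p × Euc q)), IsPatch I S S' ρ' B x₀ Φ := by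
  obtain ⟨a, ha⟩ := mem_iUnion.1 hx₀
  by_cases hx' : x₀ ∈ ⋃ b, S' b
  · obtain ⟨b, hb⟩ := mem_iUnion.1 hx'
    obtain ⟨p, r, Φ, hxΦ, hΦ, hord⟩ := hS'.exists_chart b x₀ hb
    have h1 : ∀ᶠ y in 𝓝 x₀, ∀ w : E, ∃ e : Euc p,
        w - chartDSymm I Φ (Φ y) (e, 0) ∈ stratTangent I S y := by
      refine hS.eventually_transverse hΦ.toIsSmoothChart hxΦ ha fun w => ?_
      obtain ⟨v, hv, v', hv', hw⟩ := hSS' a b x₀ ⟨ha, hb⟩ w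
      let u : E := v
      let u' : E := v'
      refine ⟨(chartD I Φ x₀ u').1, ?_⟩
      have h2 : chartD I Φ x₀ u' = ((chartD I Φ x₀ u').1, 0) :=
        Prod.ext rfl ((hΦ.mem_tangentVectors_iff hxΦ hb u').1 hv')
      have h3 : w - u' = u := sub_eq_of_eq_add hw
      rw [← h2, hΦ.chartDSymm_chartD hxΦ, hS.stratTangent_eq ha, h3]
      exact hv
    obtain ⟨s, hs, hso, hxs⟩ := eventually_nhds_iff.1 h1
    refine ⟨p, r + 1, Φ.restrOpen s hso, isPatch_restrOpen hso hxs hΦ.toIsSmoothChart hxΦ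
      (fun y hy _ y' hy' _ h => hΦ.mem_congr y hy y' hy' h) (fun y hy _ hlev => ?_)
      (fun y _ hys => hs y hys)⟩
    rw [hS'.level_of_mem hb] at hlev
    by_cases hyS : y ∈ ⋃ b, S' b
    · obtain ⟨c, hc⟩ := mem_iUnion.1 hyS
      rw [hS'.level_of_mem hc] at hlev
      rcases hord y hy c hc with rfl | h
      · exact (hΦ.mem_iff y hy).1 hc
      · omega
    · rw [level_of_notMem hyS] at hlev
      exact absurd (hB b ⟨x₀, hb⟩) (by omega)
  · -- away from `S'` all directions of the manifold are at disposal
    obtain ⟨p, r, Θ, hxΘ, hΘ, -⟩ := hS.exists_chart a x₀ ha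
    have hdim : finrank ℝ (Euc p × Euc (r + 1)) = finrank ℝ (Euc (p + (r + 1)) × Euc 0) := by
      simp
    let L := ContinuousLinearEquiv.ofFinrankEq hdim
    have hΦ := hΘ.trans_continuousLinearEquiv L
    refine ⟨p + (r + 1), 0, _, isPatch_restrOpen hS'.isCompact.isClosed.isOpen_compl hx' hΦ hxΘ ?_ ?_ ?_⟩
    · intro y _ hy y' _ hy' _ b
      exact iff_of_false (fun h => hy (mem_iUnion.2 ⟨b, h⟩)) fun h => hy' (mem_iUnion.2 ⟨b, h⟩)
    · intro y _ _ _
      exact Subsingleton.elim (α := Euc 0) _ _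
    · intro y hy _ w
      refine ⟨(chartD I (Θ.transHomeomorph L.toHomeomorph) y w).1, ?_⟩
      have h2 : ((chartD I (Θ.transHomeomorph L.toHomeomorph) y w).1, 0) =
          chartD I (Θ.transHomeomorph L.toHomeomorph) y w :=
        Prod.ext rfl (Subsingleton.elim (α := Euc 0) _ _)
      rw [h2, hΦ.chartDSymm_chartD hy, sub_self]
      exact zero_mem_stratTangent y

end Manifold

/-! ### Points of a stratified set generically do not return -/

section Manifold

variable {E : Type*} [NormedAddCommGroup E] [NormedSpace ℝ E]
  {H : Type*} [TopologicalSpace H] {I : ModelWithCorners ℝ E H}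
  {M : Type*} [TopologicalSpace M] [ChartedSpace H M]
  {ι ι' : Type*} {S : ι → Set M} {ρ : ι → ℕ} {S' : ι' → Set M} {ρ' : ι' → ℕ} {B : ℕ}

/-- Along the stratum of `S'` through the centre of a patch, the translations `t` for which the
map `y ↦ y + t` agrees somewhere on `S` with a given map `h` are negligible. -/
theorem IsPatch.dense_compl_displacements [T2Space M] [Countable ι] [SecondCountableTopology M]
    (hS : IsStratification I S ρ) {x₀ : M}
    (hx₀ : x₀ ∈ ⋃ a, S a) {p : ℕ} {Z : Type*} [NormedAddCommGroup Z] [NormedSpace ℝ Z]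
    {Φ : OpenPartialHomeomorph M (Euc p × Z)} (hΦ : IsPatch I S S' ρ' B x₀ Φ) {h : M → M}
    (hh : ContMDiff I I ∞ h) :
    Dense {t : Euc p | ∀ x ∈ Φ.source, x ∈ ⋃ a, S a → (Φ x).2 = 0 → h x ∈ Φ.source →
      (Φ (h x)).1 - (Φ x).1 ≠ t} := by
  have hP : Nontrivial (Euc p) := hΦ.nontrivial hS hx₀
  obtain ⟨T, hTc, hTd, hT⟩ := hS.exists_countable_definingFunctions
  have := hTc.to_subtype
  let j : Euc p → M := fun y => Φ.symm (y, 0)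
  let G : Euc p → Euc p := fun y => (Φ (h (j y))).1 - y
  let A : T → Set (Euc p) := fun d => {y | (y, 0) ∈ Φ.target ∧ j y ∈ ⋃ a, S a ∧
    h (j y) ∈ Φ.source ∧ j y ∈ d.1.1 ∧ d.1.2.2 (j y) = 0}
  have hbound : ∀ d : T, dimH (G '' A d) ≤ ((finrank ℝ (Euc p) - 1 : ℕ) : ENNReal) := by
    rintro ⟨⟨O, c, ζ⟩, hd⟩
    have hζ : IsDefiningFunction I S O c ζ := hTd _ hd
    let A' : Set (Euc p) := {y | (y, 0) ∈ Φ.target ∧ j y ∈ ⋃ a, S a ∧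
      h (j y) ∈ Φ.source ∧ j y ∈ O ∧ ζ (j y) = 0}
    change dimH (G '' A') ≤ _
    rcases Nat.eq_zero_or_pos c with rfl | hc
    · -- `c = 0` only happens off `S`
      have hA : A' = ∅ := by
        refine eq_empty_of_forall_notMem fun y hy => ?_
        obtain ⟨w, hw⟩ := hS.exists_notMem_stratTangent (I := I) hy.2.1
        exact hw ((hζ.mem_iff _ hy.2.2.2.1 hy.2.2.2.2 w).2
          (Subsingleton.elim (α := Euc 0) _ _))
      simp [hA]
    have hin : ∀ y : Euc p, HasStrictFDerivAt (fun y : Euc p => ((y, 0) : Euc p × Z))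
        (ContinuousLinearMap.inl ℝ (Euc p) Z) y := fun y =>
      (ContinuousLinearMap.inl ℝ (Euc p) Z).hasStrictFDerivAt
    refine (dimH_image_le_of_submersion (Y := Euc c) (T := A') (G := G) ?_ ?_).trans ?_
    · intro y hy
      have hx : j y ∈ Φ.source := Φ.map_target hy.1
      have hΦx : Φ (j y) = (y, 0) := Φ.right_inv hy.1
      have hζx : ContMDiffAt I 𝓘(ℝ, Euc c) ∞ ζ (j y) :=
        hζ.contMDiffOn.contMDiffAt (hζ.isOpen.mem_nhds hy.2.2.2.1)
      have h1 := hΦ.contDiffAt_comp_symm hx hζx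
      have h2 := hΦ.fderiv_comp_symm hx hζx
      have h3 := hΦ.exists_mfderiv_eq hζ hx hy.2.2.2.1 hy.2.2.2.2
      rw [hΦx] at h1 h2 h3
      refine ⟨fun y => ζ (j y), _,
        HasStrictFDerivAt.comp (g := fun u => ζ (Φ.symm u)) y (h1.hasStrictFDerivAt (by simp))
          (hin y), fun a => ?_, ?_⟩
      · obtain ⟨e, he⟩ := h3 a
        exact ⟨e, (h2 (e, 0)).trans he⟩
      · filter_upwards [self_mem_nhdsWithin] with y' hy'
        exact hy'.2.2.2.2
    · intro y hy
      have hx : j y ∈ Φ.source := Φ.map_target hy.1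
      have hΦx : Φ (j y) = (y, 0) := Φ.right_inv hy.1
      have h1 : ContMDiffAt I 𝓘(ℝ, Euc p × Z) ∞ (fun x => Φ (h x)) (j y) :=
        (hΦ.contMDiffOn.contMDiffAt (Φ.open_source.mem_nhds hy.2.2.1)).comp (j y) hh.contMDiffAt
      have h2 := hΦ.contDiffAt_comp_symm hx h1
      rw [hΦx] at h2
      exact ⟨_, (((h2.hasStrictFDerivAt (by simp)).comp y (hin y)).fst).sub
        (hasStrictFDerivAt_id y)⟩
    · have : finrank ℝ (Euc c) = c := by simp
      rw [this]
      exact_mod_cast Nat.sub_le_sub_left hc _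
  refine (dense_compl_iUnion_of_dimH_le hbound).mono ?_
  intro t ht x hx hxS hx2 hhx he
  refine ht ?_
  obtain ⟨d, hd, hxd, h0⟩ := hT x
  have hx' : Φ x = ((Φ x).1, 0) := Prod.ext rfl hx2
  have hj : j (Φ x).1 = x := by
    change Φ.symm ((Φ x).1, 0) = x
    rw [← hx', Φ.left_inv hx]
  refine mem_iUnion.2 ⟨⟨d, hd⟩, (Φ x).1, ⟨?_, ?_, ?_, ?_, ?_⟩, ?_⟩
  · rw [← hx']
    exact Φ.map_source hx
  · rwa [hj]
  · rwa [hj]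
  · rwa [hj]
  · rwa [hj]
  · change (Φ (h (j (Φ x).1))).1 - (Φ x).1 = t
    rw [hj, he]

variable [IsManifold I ∞ M] [LocallyCompactSpace M]

theorem continuous_eval_iterate_subtype (i : ℕ) :
    Continuous (fun p : diffPreserving I S' × M => (⇑p.1.1)^[i] p.2) :=
  (continuous_eval_iterate i).comp
    (f := fun p : diffPreserving I S' × M => ((p.1.1, p.2) : (M ≃ₘ^∞⟮I, I⟯ M) × M))
    ((continuous_subtype_val.comp continuous_fst).prodMk continuous_snd)

/-- The points of `S` do not return before `m` steps. -/
def NoReturn (S : ι → Set M) (m : ℕ) (g : M → M) : Prop :=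
  ∀ x ∈ ⋃ a, S a, ∀ i, 1 ≤ i → i < m → g^[i] x ≠ x

variable [T2Space M]


theorem IsStratification.isOpen_iterate_ne (hS : IsStratification I S ρ)
    (hS' : IsStratification I S' ρ') (hB : ∀ a, (S' a).Nonempty → ρ' a < B) (i b : ℕ) :
    IsOpen {p : diffPreserving I S' × M | p.2 ∈ ⋃ a, S a → level S' ρ' B p.2 < b →
      (⇑p.1.1)^[i] p.2 ≠ p.2} := by
  have h1 : IsOpen {x : M | b ≤ level S' ρ' B x} := by
    rw [isOpen_iff_mem_nhds]
    intro x hx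
    filter_upwards [hS'.eventually_le_level hB x] with y hy
    exact le_trans hx hy
  have h2 : IsOpen {p : diffPreserving I S' × M | (⇑p.1.1)^[i] p.2 ≠ p.2} :=
    isOpen_ne_fun (continuous_eval_iterate_subtype i) continuous_snd
  have h3 := ((hS.isCompact.isClosed.isOpen_compl.preimage continuous_snd).union
    (h1.preimage continuous_snd)).union h2
  convert h3 using 1
  ext p
  simp only [mem_ofPred_eq, mem_union, mem_preimage, mem_compl_iff]
  rw [← not_lt]
  tauto

theorem IsStratification.isOpen_noReturn [CompactSpace M] (hS : IsStratification I S ρ)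
    (hS' : IsStratification I S' ρ') (m : ℕ) :
    IsOpen {g : diffPreserving I S' | NoReturn S m g.1} := by
  obtain ⟨B, hB⟩ := hS'.bounded
  have h : ∀ i ∈ Finset.Ico 1 m, IsOpen {g : diffPreserving I S' | ∀ x ∈ (univ : Set M),
      x ∈ ⋃ a, S a → level S' ρ' B x < B + 1 → (⇑g.1)^[i] x ≠ x} := fun i _ =>
    isOpen_forall_mem_of_isCompact (hS.isOpen_iterate_ne hS' hB i (B + 1)) isCompact_univ
  convert isOpen_biInter_finset h using 1
  ext g
  simp only [mem_ofPred_eq, mem_iInter, Finset.mem_Ico]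
  exact ⟨fun hg i hi x _ hx _ => hg x hx i hi.1 hi.2, fun hg x hx i hi hi' =>
    hg i ⟨hi, hi'⟩ x (mem_univ x) hx (Nat.lt_succ_of_le (hS'.level_le hB x))⟩

variable [FiniteDimensional ℝ E] [Countable ι] [SecondCountableTopology M]

/-- If the points of `S` close to `x₀` do not return for `m` steps, then they do not return
after `m + 1` steps either, up to a small perturbation. -/
theorem IsStratification.eventually_mem_closure_iterate_ne (hS : IsStratification I S ρ)
    (hS' : IsStratification I S' ρ') (hB : ∀ a, (S' a).Nonempty → ρ' a < B)
    (hSS' : ∀ a b, TransverseSubmanifolds I (S a) (S' b)) {m : ℕ} {x₀ : M}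
    (hx₀ : x₀ ∈ ⋃ a, S a) {g₀ : diffPreserving I S'}
    (hg₀ : ∀ i, 1 ≤ i → i < m + 1 → (⇑g₀.1)^[i] x₀ ≠ x₀) :
    ∃ C ∈ 𝓝 x₀, ∀ᶠ g₁ in 𝓝 g₀, g₁ ∈ closure {g : diffPreserving I S' | ∀ x ∈ C,
      x ∈ ⋃ a, S a → level S' ρ' B x ≤ level S' ρ' B x₀ → (⇑g.1)^[m + 1] x ≠ x} := by
  obtain ⟨p, q, Φ, hΦ⟩ := hS.exists_isPatch hS' hB hSS' hx₀
  obtain ⟨U₁, hU₁, hg₁⟩ := exists_disjoint_iterates hg₀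
  obtain ⟨C, ε, D, hC, hxC, hCU, hε, hD⟩ := exists_isShearFamily hΦ.toIsSmoothChart
    (isOpen_interior.inter Φ.open_source)
    ⟨mem_interior_iff_mem_nhds.2 hU₁, hΦ.mem_source⟩ inter_subset_right
  set U := interior U₁ ∩ Φ.source with hU
  refine ⟨C, hC.mem_nhds hxC, ?_⟩
  filter_upwards [continuous_subtype_val.continuousAt.eventually hg₁] with g₁ hg₁
  have hdisj : ∀ i, 1 ≤ i → i < m + 1 → ∀ x ∈ U, (⇑g₁.1)^[i] x ∉ U :=
    fun i hi hi' x hx hx' => hg₁ i hi hi' x (interior_subset hx.1) (interior_subset hx'.1)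
  obtain ⟨A, hA, hdense⟩ : ∃ A : Set (Euc p), (∀ t ∈ A, ∀ x ∈ Φ.source, x ∈ ⋃ a, S a →
      (Φ x).2 = 0 → (⇑g₁.1.symm)^[m + 1] x ∈ Φ.source →
      (Φ ((⇑g₁.1.symm)^[m + 1] x)).1 - (Φ x).1 ≠ t) ∧ Dense A := by
    refine ⟨_, ?_, hΦ.dense_compl_displacements hS hx₀ (contMDiff_iterate g₁.1.symm (m + 1))⟩
    exact fun t ht => ht
  refine hD.mem_closure (Θ := (fun t => (t, 0)) '' A) hε
    (fun y hy y' hy' => hΦ.mem_congr y hy.2 y' hy'.2) ?_ ?_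
  · have hcont : Continuous (fun t : Euc p => ((t, 0) : ShearParam (Euc p) (Euc q))) := by
      fun_prop
    exact image_closure_subset_closure_image hcont ⟨0, hdense 0, rfl⟩
  · filter_upwards [Metric.ball_mem_nhds _ hε] with θ hθ hθΘ h x hxC hxS hlev hper
    obtain ⟨t, ht, rfl⟩ := hθΘ
    have hxU := hCU hxC
    have hper' : ((D (t, 0)).trans g₁.1)^[m + 1] x = x := hper
    rw [hD.iterate_trans hdisj _ hxU (Nat.lt_succ_self m)] at hper'
    have h1 : (⇑g₁.1.symm)^[m + 1] x = D (t, 0) x := by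
      conv_lhs => rw [← hper']
      exact iterate_symm_iterate g₁.1.symm (m + 1) _
    have h2 := hD.apply _ hθ x hxC
    have h3 : (⇑g₁.1.symm)^[m + 1] x ∈ Φ.source := by
      rw [h1]
      exact (hD.mem _ x hxU).2
    refine hA t ht x hxU.2 hxS (hΦ.snd_eq_zero x hxU.2 hlev) h3 ?_
    rw [h1, h2]
    simp [shear]

/-- For a dense set of diffeomorphisms preserving `S'`, the points of `S` do not return. This is
achieved for longer and longer times, and for each time first on the strata of `S'` of small level;
a perturbation which moves the points of a stratum within it removes the returns to that stratum. -/
theorem IsStratification.dense_noReturn [CompactSpace M] (hS : IsStratification I S ρ)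
    (hS' : IsStratification I S' ρ')
    (hSS' : ∀ a b, TransverseSubmanifolds I (S a) (S' b)) (m : ℕ) :
    Dense {g : diffPreserving I S' | NoReturn S m g.1} := by
  obtain ⟨B, hB⟩ := hS'.bounded
  induction m with
  | zero =>
    intro g
    exact subset_closure fun x _ i _ hi => absurd hi (Nat.not_lt_zero i)
  | succ m ih =>
    rcases Nat.eq_zero_or_pos m with rfl | hm
    · intro g
      exact subset_closure fun x _ i hi hi' => absurd hi' (by omega)
    obtain ⟨m, rfl⟩ : ∃ k, m = k + 1 := ⟨m - 1, by omega⟩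
    have hQ := hS.isOpen_noReturn (I := I) hS' (m + 1)
    have key : ∀ b, Dense {g : diffPreserving I S' | NoReturn S (m + 1) g.1 ∧
        ∀ x, x ∈ ⋃ a, S a → level S' ρ' B x < b → (⇑g.1)^[m + 1] x ≠ x} := by
      intro b
      induction b with
      | zero => simpa using ih
      | succ b ihb =>
        refine dense_iff_closure_eq.2 (univ_subset_iff.1 ?_)
        rw [← ihb.closure_eq]
        refine closure_minimal ?_ isClosed_closure
        rintro g₀ ⟨hg₀, hg₀b⟩
        have h1 : g₀ ∈ closure {g : diffPreserving I S' | ∀ x, x ∈ ⋃ a, S a →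
            level S' ρ' B x < b + 1 → (⇑g.1)^[m + 1] x ≠ x} := by
          have hopen := hS.isOpen_iterate_ne (I := I) hS' hB (m + 1) (b + 1)
          refine mem_closure_of_local hopen fun x₀ => ?_
          by_cases hgood : x₀ ∈ ⋃ a, S a → level S' ρ' B x₀ < b + 1 →
              (⇑g₀.1)^[m + 1] x₀ ≠ x₀
          · obtain ⟨G, hG, C, hC, hGC⟩ := mem_nhds_prod_iff.1
              (hopen.mem_nhds (show (g₀, x₀) ∈ {p : diffPreserving I S' × M | _} from hgood))
            refine ⟨C, hC, ?_⟩
            filter_upwards [hG] with g hg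
            exact subset_closure fun x hx => hGC (show (g, x) ∈ G ×ˢ C from ⟨hg, hx⟩)
          · push Not at hgood
            obtain ⟨hx₀, hlev, hper⟩ := hgood
            have hlev' : level S' ρ' B x₀ = b := by
              by_contra h
              exact hg₀b x₀ hx₀ (by omega) hper
            obtain ⟨C, hC, h⟩ := hS.eventually_mem_closure_iterate_ne hS' hB hSS' hx₀
              (hg₀ x₀ hx₀)
            refine ⟨C, hC, h.mono fun g hg => closure_mono ?_ hg⟩
            intro g' hg' x hx hxS hlt
            exact hg' x hx hxS (by omega)
        have h2 := hQ.inter_closure ⟨hg₀, h1⟩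
        exact h2
    refine (key (B + 1)).mono ?_
    rintro g ⟨hg, hg'⟩ x hx i hi hi'
    rcases Nat.lt_succ_iff_lt_or_eq.1 hi' with h | rfl
    · exact hg x hx i hi h
    · exact hg' x hx (Nat.lt_succ_of_le (hS'.level_le hB x))

end Manifold

/-! ### Derivatives along perturbed orbits -/

section Manifold

variable {E : Type*} [NormedAddCommGroup E] [NormedSpace ℝ E]
  {H : Type*} [TopologicalSpace H] {I : ModelWithCorners ℝ E H}
  {M : Type*} [TopologicalSpace M] [ChartedSpace H M]
  {ι ι' : Type*} {S : ι → Set M} {ρ : ι → ℕ} {S' : ι' → Set M} {ρ' : ι' → ℕ} {B : ℕ}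

variable (I) in
/-- The derivative of a function with values in `ℝᶜ`. -/
def funD {c : ℕ} (ζ : M → Euc c) (x : M) : E →L[ℝ] Euc c := mfderiv I 𝓘(ℝ, Euc c) ζ x

theorem IsDefiningFunction.contMDiffAt {O : Set M} {c : ℕ} {ζ : M → Euc c}
    (hζ : IsDefiningFunction I S O c ζ) {x : M} (hx : x ∈ O) : ContMDiffAt I 𝓘(ℝ, Euc c) ∞ ζ x :=
  hζ.contMDiffOn.contMDiffAt (hζ.isOpen.mem_nhds hx)

theorem IsDefiningFunction.sub_mem_iff {O : Set M} {c : ℕ} {ζ : M → Euc c}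
    (hζ : IsDefiningFunction I S O c ζ) {x : M} (hx : x ∈ O) (h0 : ζ x = 0) (v w : E) :
    v - w ∈ stratTangent I S x ↔ funD I ζ x v = funD I ζ x w := by
  rw [← sub_eq_zero, ← map_sub]
  exact hζ.mem_iff x hx h0 _

theorem funD_comp {c : ℕ} {ζ : M → Euc c} {g : M → M} (hg : ContMDiff I I ∞ g) {x : M}
    (hζ : ContMDiffAt I 𝓘(ℝ, Euc c) ∞ ζ (g x)) (v : E) :
    funD I (fun y => ζ (g y)) x v = funD I ζ (g x) (mapD I g x v) := by
  have h1 := (hζ.mdifferentiableAt (by simp)).hasMFDerivAt.comp x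
    ((hg.contMDiffAt (x := x)).mdifferentiableAt (by simp)).hasMFDerivAt
  exact congrArg (fun L : E →L[ℝ] Euc c => L v) h1.mfderiv

/-- At a point off `S`, the first of the `m + 1` conditions is void, and the others are those for the
next point of the orbit. -/
theorem orbitTransverse_succ_of_notMem {g : M ≃ₘ^∞⟮I, I⟯ M} (hg : ∀ b, g '' S' b = S' b) {m : ℕ}
    {x : M} (hx : x ∉ ⋃ a, S a) (h : OrbitTransverse I S S' m g (g x)) :
    OrbitTransverse I S S' (m + 1) g x := by
  intro w w'
  obtain ⟨u', hu', hw'⟩ := h (fun i => w (i + 1)) (mapD I g x w')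
  obtain ⟨u, rfl⟩ := (mapD_bijective g x).2 u'
  refine ⟨u, fun i hi => ?_, ?_⟩
  · cases i with
    | zero =>
      have h0 : stratTangent I S ((⇑g)^[0] x) = univ := stratTangent_eq_univ hx
      rw [h0]
      exact mem_univ _
    | succ i =>
      rw [mapD_iterate_add g i 1]
      exact hu' i (by omega)
  · rw [← mapD_mem_stratTangent_iff hg x, map_sub]
    exact hw'

/-- A stratum of `S` at `g^i y`, `1 ≤ i ≤ m`, and a stratum of `S'` at `y`: if the iterates are
transverse at `g y` for `m` steps, then the preimages of these strata near `y` have independent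
equations. -/
theorem exists_funD_eq_of_orbitTransverse {g : M ≃ₘ^∞⟮I, I⟯ M} (hg : ∀ b, g '' S' b = S' b)
    {m : ℕ} {y : M} (h : OrbitTransverse I S S' m g (g y)) {O : Fin m → Set M} {c : Fin m → ℕ}
    {ζ : ∀ i, M → Euc (c i)} (hζ : ∀ i, IsDefiningFunction I S (O i) (c i) (ζ i))
    (hy : ∀ i, (⇑g)^[(i : ℕ) + 1] y ∈ O i) (h0 : ∀ i, ζ i ((⇑g)^[(i : ℕ) + 1] y) = 0)
    {O' : Set M} {c' : ℕ} {ζ' : M → Euc c'} (hζ' : IsDefiningFunction I S' O' c' ζ')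
    (hy' : y ∈ O') (h0' : ζ' y = 0) (b : ∀ i, Euc (c i)) (b' : Euc c') :
    ∃ u : E, (∀ i : Fin m,
      funD I (ζ i) ((⇑g)^[(i : ℕ) + 1] y) (mapD I (⇑g)^[(i : ℕ) + 1] y u) = b i) ∧
      funD I ζ' y u = b' := by
  have h1 : ∀ i, ∃ w : E, funD I (ζ i) ((⇑g)^[(i : ℕ) + 1] y) w = b i := fun i =>
    (hζ i).surjective _ (hy i) (h0 i) (b i)
  choose w hw using h1
  obtain ⟨w', hw'⟩ : ∃ w : E, funD I ζ' y w = b' := hζ'.surjective y hy' h0' b'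
  obtain ⟨u', hu', huw'⟩ := h (fun i => if hi : i < m then w ⟨i, hi⟩ else 0) (mapD I g y w')
  obtain ⟨u, rfl⟩ := (mapD_bijective g y).2 u'
  refine ⟨u, fun i => ?_, ?_⟩
  · have h2 := hu' i i.2
    simp only [i.2, dite_true] at h2
    have h3 : w i - mapD I (⇑g)^[(i : ℕ) + 1] y u ∈ stratTangent I S ((⇑g)^[(i : ℕ) + 1] y) := by
      rw [mapD_iterate_add g i 1]
      exact h2
    rw [← ((hζ i).sub_mem_iff (hy i) (h0 i) _ _).1 h3, hw]
  · rw [← map_sub, mapD_mem_stratTangent_iff hg] at huw'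
    rw [← (hζ'.sub_mem_iff hy' h0' _ _).1 huw', hw']

section Family

variable {p q : ℕ} {Φ : OpenPartialHomeomorph M (Euc p × Euc q)} {U C : Set M} {ε : ℝ}
  {D : ShearParam (Euc p) (Euc q) → (M ≃ₘ^∞⟮I, I⟯ M)}

theorem IsShearFamily.mapD_chartDSymm (hΦ : IsSmoothChart I Φ) (hD : IsShearFamily I Φ U C ε D)
    (hC : IsOpen C) (hCU : C ⊆ U) (hUΦ : U ⊆ Φ.source)
    {θ : ShearParam (Euc p) (Euc q)} (hθ : θ ∈ Metric.ball 0 ε) {x : M} (hx : x ∈ C)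
    (v : Euc p × Euc q) :
    mapD I (D θ) x (chartDSymm I Φ (Φ x) v) = chartDSymm I Φ (Φ (D θ x)) (shearLin θ.2 v) := by
  have hxΦ := hUΦ (hCU hx)
  have h1 : HasFDerivAt (shear θ) (shearLin θ.2) (Φ x) := by
    have h2 : HasFDerivAt (fun z : Euc p × Euc q => θ.1 + θ.2 z) θ.2 (Φ x) :=
      θ.2.hasFDerivAt.const_add θ.1
    exact (hasFDerivAt_id (Φ x)).add (h2.prodMk (hasFDerivAt_const (0 : Euc q) (Φ x)))
  have h3 := h1.hasMFDerivAt.comp x (hΦ.hasMFDerivAt hxΦ)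
  have h4 : shear θ (Φ x) = Φ (D θ x) := (hD.apply θ hθ x hx).symm
  have h5 : Φ (D θ x) ∈ Φ.target := Φ.map_source (hUΦ (hD.mem θ x (hCU hx)))
  have h6 : HasMFDerivAt 𝓘(ℝ, Euc p × Euc q) I Φ.symm (shear θ (Φ x))
      (chartDSymm I Φ (Φ (D θ x)) : Euc p × Euc q →L[ℝ] E) := by
    rw [h4]
    exact hΦ.hasMFDerivAt_symm h5
  have h7 := h6.comp x h3
  have h8 : (D θ : M → M) =ᶠ[𝓝 x] Φ.symm ∘ (shear θ ∘ Φ) := by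
    filter_upwards [hC.mem_nhds hx] with x' hx'
    simp only [Function.comp_apply]
    rw [← hD.apply θ hθ x' hx', Φ.left_inv (hUΦ (hD.mem θ x' (hCU hx')))]
  have h9 : mapD I (D θ) x =
      (chartDSymm I Φ (Φ (D θ x))).comp ((shearLin θ.2).comp (chartD I Φ x)) :=
    (mapD_congr h8).trans h7.mfderiv
  rw [h9]
  simp only [ContinuousLinearMap.comp_apply]
  rw [hΦ.chartD_chartDSymm hxΦ]

theorem IsShearFamily.mapD_iterate_trans (hD : IsShearFamily I Φ U C ε D) (hU : IsOpen U)
    {g : M ≃ₘ^∞⟮I, I⟯ M} {m : ℕ} (hg : ∀ i, 1 ≤ i → i < m → ∀ x ∈ U, g^[i] x ∉ U)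
    (θ : ShearParam (Euc p) (Euc q)) {x : M} (hx : x ∈ U) {i : ℕ} (hi : i < m) (u : E) :
    mapD I ((D θ).trans g)^[i + 1] x u = mapD I g^[i + 1] (D θ x) (mapD I (D θ) x u) := by
  rw [← mapD_comp (contMDiff_iterate g (i + 1)) (D θ).contMDiff]
  have h : ((D θ).trans g : M → M)^[i + 1] =ᶠ[𝓝 x] (⇑g)^[i + 1] ∘ D θ := by
    filter_upwards [hU.mem_nhds hx] with y hy
    exact hD.iterate_trans hg θ hy hi
  rw [mapD_congr h]

end Family

end Manifold

/-! ### Transversality of one more iterate -/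

section Manifold

variable {E : Type*} [NormedAddCommGroup E] [NormedSpace ℝ E]
  {H : Type*} [TopologicalSpace H] {I : ModelWithCorners ℝ E H}
  {M : Type*} [TopologicalSpace M] [ChartedSpace H M]
  {ι ι' : Type*} {S : ι → Set M} {ρ : ι → ℕ} {S' : ι' → Set M} {ρ' : ι' → ℕ} {B : ℕ}

section Equations

variable {p q : ℕ} (Φ : OpenPartialHomeomorph M (Euc p × Euc q)) (g : M → M) {m : ℕ}
  {c : Fin m → ℕ} (ζ : ∀ i, M → Euc (c i)) {c' : ℕ} (ζ' : M → Euc c')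

/-- The equations, in a chart, of the points which lie on a stratum of `S'` and whose iterates lie
on strata of `S`. -/
def orbitEqn (u : Euc p × Euc q) : (∀ i, Euc (c i)) × Euc c' :=
  (fun i => ζ i (g^[(i : ℕ) + 1] (Φ.symm u)), ζ' (Φ.symm u))

/-- The domain of these equations. -/
def orbitDomain (O : Fin m → Set M) (O' : Set M) : Set (Euc p × Euc q) :=
  Φ.target ∩ Φ.symm ⁻¹' (O' ∩ ⋂ i : Fin m, g^[(i : ℕ) + 1] ⁻¹' O i)

variable {Φ ζ ζ'} {O : Fin m → Set M} {O' : Set M}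

theorem isOpen_orbitDomain {g : M ≃ₘ^∞⟮I, I⟯ M} (hO : ∀ i, IsOpen (O i)) (hO' : IsOpen O') :
    IsOpen (orbitDomain Φ g O O') :=
  Φ.isOpen_inter_preimage_symm (hO'.inter (isOpen_iInter_of_finite fun i =>
    (hO i).preimage (contMDiff_iterate g _).continuous))

theorem contDiffAt_orbitEqn (hΦ : IsSmoothChart I Φ) {g : M ≃ₘ^∞⟮I, I⟯ M}
    (hζ : ∀ i, IsDefiningFunction I S (O i) (c i) (ζ i))
    (hζ' : IsDefiningFunction I S' O' c' ζ') {y : M} (hyΦ : y ∈ Φ.source)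
    (hy : ∀ i : Fin m, (⇑g)^[(i : ℕ) + 1] y ∈ O i) (hy' : y ∈ O') :
    ContDiffAt ℝ ∞ (orbitEqn Φ g ζ ζ') (Φ y) := by
  refine ContDiffAt.prodMk (contDiffAt_pi.2 fun i => ?_)
    (hΦ.contDiffAt_comp_symm hyΦ (hζ'.contMDiffAt hy'))
  exact hΦ.contDiffAt_comp_symm hyΦ (f := fun y => ζ i ((⇑g)^[(i : ℕ) + 1] y))
    (((hζ i).contMDiffAt (hy i)).comp y (contMDiff_iterate g _).contMDiffAt)

theorem fderiv_orbitEqn (hΦ : IsSmoothChart I Φ) {g : M ≃ₘ^∞⟮I, I⟯ M}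
    (hζ : ∀ i, IsDefiningFunction I S (O i) (c i) (ζ i))
    (hζ' : IsDefiningFunction I S' O' c' ζ') {y : M} (hyΦ : y ∈ Φ.source)
    (hy : ∀ i : Fin m, (⇑g)^[(i : ℕ) + 1] y ∈ O i) (hy' : y ∈ O') (v : Euc p × Euc q) :
    fderiv ℝ (orbitEqn Φ g ζ ζ') (Φ y) v =
      (fun i : Fin m => funD I (ζ i) ((⇑g)^[(i : ℕ) + 1] y)
        (mapD I (⇑g)^[(i : ℕ) + 1] y (chartDSymm I Φ (Φ y) v)),
      funD I ζ' y (chartDSymm I Φ (Φ y) v)) := by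
  have hsm : ∀ i : Fin m, ContMDiffAt I 𝓘(ℝ, Euc (c i)) ∞
      (fun y => ζ i ((⇑g)^[(i : ℕ) + 1] y)) y := fun i =>
    ((hζ i).contMDiffAt (hy i)).comp y (contMDiff_iterate g _).contMDiffAt
  have h1 := fun i : Fin m => ((hΦ.contDiffAt_comp_symm hyΦ (hsm i)).differentiableAt
    (by simp)).hasFDerivAt
  have h2 := ((hΦ.contDiffAt_comp_symm hyΦ (hζ'.contMDiffAt hy')).differentiableAt
    (by simp)).hasFDerivAt
  have h3 : HasFDerivAt (orbitEqn Φ g ζ ζ') _ (Φ y) := (hasFDerivAt_pi.2 h1).prodMk h2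
  rw [h3.fderiv]
  refine Prod.ext (funext fun i => ?_) (hΦ.fderiv_comp_symm hyΦ (hζ'.contMDiffAt hy') v)
  exact (hΦ.fderiv_comp_symm hyΦ (hsm i) v).trans
    (funD_comp (contMDiff_iterate g _) ((hζ i).contMDiffAt (hy i)) _)

/-- At the points of a patch, almost all shears make a stratum of `S` transverse to the solutions of
the above equations. -/
theorem dimH_badShears_orbitEqn_le {x₀ : M} (hΦ : IsPatch I S S' ρ' B x₀ Φ)
    {g : M ≃ₘ^∞⟮I, I⟯ M} (hg : ∀ b, g '' S' b = S' b) (hm : ∀ x, OrbitTransverse I S S' m g x)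
    {O₀ : Set M} {c₀ : ℕ} {ζ₀ : M → Euc c₀} (hζ₀ : IsDefiningFunction I S O₀ c₀ ζ₀)
    (hζ : ∀ i, IsDefiningFunction I S (O i) (c i) (ζ i))
    (hζ' : IsDefiningFunction I S' O' c' ζ') :
    dimH (badShears (fun u => ζ₀ (Φ.symm u)) (orbitEqn Φ g ζ ζ') (Φ.target ∩ Φ.symm ⁻¹' O₀)
        (orbitDomain Φ g O O')) ≤
      ((finrank ℝ (ShearParam (Euc p) (Euc q)) - 1 : ℕ) : ENNReal) := by
  have hrep : ∀ u ∈ Φ.target, ∃ y ∈ Φ.source, u = Φ y ∧ Φ.symm u = y := fun u hu =>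
    ⟨Φ.symm u, Φ.map_target hu, (Φ.right_inv hu).symm, rfl⟩
  refine dimH_badShears_le (Φ.isOpen_inter_preimage_symm hζ₀.isOpen)
    (isOpen_orbitDomain (fun i => (hζ i).isOpen) hζ'.isOpen) ?_ ?_ ?_ ?_
  · rintro u ⟨hu, hu'⟩
    obtain ⟨y, hy, rfl, hsy⟩ := hrep u hu
    rw [mem_preimage, hsy] at hu'
    exact ((hΦ.contDiffAt_comp_symm hy (hζ₀.contMDiffAt hu')).of_le
      ENat.LEInfty.out).contDiffWithinAt
  · rintro u ⟨hu, hu', hu''⟩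
    obtain ⟨y, hy, rfl, hsy⟩ := hrep u hu
    rw [hsy] at hu' hu''
    exact ((contDiffAt_orbitEqn hΦ.toIsSmoothChart hζ hζ' hy (fun i => mem_iInter.1 hu'' i)
      hu').of_le ENat.LEInfty.out).contDiffWithinAt
  · rintro u ⟨hu, hu'⟩ h0 a
    obtain ⟨y, hy, rfl, hsy⟩ := hrep u hu
    rw [mem_preimage, hsy] at hu'
    rw [hsy] at h0
    obtain ⟨e, he⟩ := hΦ.exists_mfderiv_eq hζ₀ hy hu' h0 a
    exact ⟨e, (hΦ.fderiv_comp_symm hy (hζ₀.contMDiffAt hu') (e, 0)).trans he⟩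
  · rintro u ⟨hu, hu', hu''⟩ h0 ⟨b, b'⟩
    obtain ⟨y, hy, rfl, hsy⟩ := hrep u hu
    rw [hsy] at hu' hu''
    simp only [orbitEqn, hsy, Prod.mk_eq_zero, funext_iff, Pi.zero_apply] at h0
    have hu3 : ∀ i : Fin m, (⇑g)^[(i : ℕ) + 1] y ∈ O i := fun i => mem_iInter.1 hu'' i
    obtain ⟨w, hw, hw'⟩ := exists_funD_eq_of_orbitTransverse hg (hm (g y)) hζ hu3 h0.1 hζ' hu'
      h0.2 b b'
    refine ⟨chartD I Φ y w, ?_⟩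
    rw [fderiv_orbitEqn hΦ.toIsSmoothChart hζ hζ' hy hu3 hu', hΦ.chartDSymm_chartD hy]
    exact Prod.ext (funext hw) hw'

end Equations

variable [T2Space M]

section Open

variable [FiniteDimensional ℝ E] [IsManifold I ∞ M] [LocallyCompactSpace M]

theorem IsStratification.isOpen_orbitTransverse_subtype (hS : IsStratification I S ρ)
    (hS' : IsStratification I S' ρ') (d : ℕ) :
    IsOpen {p : diffPreserving I S' × M | OrbitTransverse I S S' d p.1.1 p.2} :=
  (isOpen_orbitTransverse hS hS' d).preimage
    (f := fun p : diffPreserving I S' × M => ((p.1.1, p.2) : (M ≃ₘ^∞⟮I, I⟯ M) × M))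
    ((continuous_subtype_val.comp continuous_fst).prodMk continuous_snd)

theorem IsStratification.isOpen_forall_orbitTransverse [CompactSpace M]
    (hS : IsStratification I S ρ) (hS' : IsStratification I S' ρ') (d : ℕ) :
    IsOpen {g : diffPreserving I S' | ∀ x, OrbitTransverse I S S' d g.1 x} := by
  simpa using isOpen_forall_mem_of_isCompact (hS.isOpen_orbitTransverse_subtype hS' d)
    isCompact_univ

end Open

variable [SecondCountableTopology M] [Countable ι] [Countable ι']

/-- At the points of a patch which do not return for `m` steps, transversality for `m` steps becomes
transversality for `m + 1` steps after almost every shear. -/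
theorem IsPatch.exists_dense_orbitTransverse (hS : IsStratification I S ρ)
    (hS' : IsStratification I S' ρ') {x₀ : M} (hx₀ : x₀ ∈ ⋃ a, S a) {p q : ℕ}
    {Φ : OpenPartialHomeomorph M (Euc p × Euc q)} (hΦ : IsPatch I S S' ρ' B x₀ Φ)
    {U C : Set M} {ε : ℝ} {D : ShearParam (Euc p) (Euc q) → (M ≃ₘ^∞⟮I, I⟯ M)}
    (hD : IsShearFamily I Φ U C ε D) (hU : IsOpen U) (hC : IsOpen C) (hCU : C ⊆ U)
    (hUΦ : U ⊆ Φ.source) {g : M ≃ₘ^∞⟮I, I⟯ M} (hg : ∀ b, g '' S' b = S' b) {m : ℕ}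
    (hret : ∀ i, 1 ≤ i → i < m → ∀ x ∈ U, (⇑g)^[i] x ∉ U)
    (hm : ∀ x, OrbitTransverse I S S' m g x) :
    ∃ Θ : Set (ShearParam (Euc p) (Euc q)), Dense Θ ∧
      ∀ θ ∈ Θ, θ ∈ Metric.ball 0 ε → ‖θ.2‖ < 1 → ∀ x ∈ C,
        OrbitTransverse I S S' (m + 1) ((D θ).trans g) x := by
  obtain ⟨T, hTc, hTd, hT⟩ := hS.exists_countable_definingFunctions
  obtain ⟨T', hTc', hTd', hT'⟩ := hS'.exists_countable_definingFunctions
  have := hTc.to_subtype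
  have := hTc'.to_subtype
  have := hΦ.nontrivial hS hx₀
  have hdense := dense_compl_iUnion_of_dimH_le (κ := (Fin m → T) × T × T')
    fun k => dimH_badShears_orbitEqn_le hΦ hg hm (hTd _ k.2.1.2) (fun i => hTd _ (k.1 i).2)
      (hTd' _ k.2.2.2)
  refine ⟨_, hdense, fun θ hθ hθε hθ1 x hx w w' => ?_⟩
  have hxU := hCU hx
  have hxΦ := hUΦ hxU
  have hyΦ := hUΦ (hD.mem θ x hxU)
  have hshear := hD.apply θ hθε x hx
  -- the strata met by the orbit of `x` under the perturbed map
  obtain ⟨d₀, hd₀, hx0, h0x⟩ := hT x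
  choose d hd hdx h0d using fun i : Fin m => hT ((⇑g)^[(i : ℕ) + 1] (D θ x))
  obtain ⟨d', hd', hx', h0x'⟩ := hT' (D θ x)
  by_contra hcon
  refine hθ (mem_iUnion.2 ⟨(fun i => ⟨d i, hd i⟩, ⟨d₀, hd₀⟩, ⟨d', hd'⟩), hθ1, Φ x, ?_, ?_, ?_, ?_,
    fun hv => hcon ?_⟩)
  · exact ⟨Φ.map_source hxΦ, by rw [mem_preimage, Φ.left_inv hxΦ]; exact hx0⟩
  · simpa only [Φ.left_inv hxΦ] using h0x
  · rw [← hshear]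
    refine ⟨Φ.map_source hyΦ, ?_⟩
    rw [mem_preimage, Φ.left_inv hyΦ]
    exact ⟨hx', mem_iInter.2 hdx⟩
  · rw [← hshear]
    simp only [orbitEqn, Φ.left_inv hyΦ, Prod.mk_eq_zero]
    exact ⟨funext h0d, h0x'⟩
  · rw [← hshear] at hv
    obtain ⟨v, hv0, hv1⟩ := hv (funD I d₀.2.2 x (w 0))
      (fun i => funD I (d i).2.2 ((⇑g)^[(i : ℕ) + 1] (D θ x)) (w (i + 1)),
        funD I d'.2.2 (D θ x) (mapD I (D θ) x w'))
    have hv0' := (hΦ.fderiv_comp_symm hxΦ ((hTd _ hd₀).contMDiffAt hx0) v).symm.trans hv0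
    have hv1' := (fderiv_orbitEqn hΦ.toIsSmoothChart (fun i => hTd _ (hd i)) (hTd' _ hd')
      hyΦ hdx hx' (shearLin θ.2 v)).symm.trans hv1
    rw [← hD.mapD_chartDSymm hΦ.toIsSmoothChart hC hCU hUΦ hθε hx, Prod.mk.injEq] at hv1'
    obtain ⟨hv1', hv2'⟩ := hv1'
    set u := chartDSymm I Φ (Φ x) v
    refine ⟨u, fun i hi => ?_, ?_⟩
    · cases i with
      | zero =>
        have h1 : mapD I ((D θ).trans g)^[0] x u = u := mapD_id x u
        rw [h1]
        exact ((hTd _ hd₀).sub_mem_iff hx0 h0x _ _).2 hv0'.symm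
      | succ i =>
        have hi' : i < m := by omega
        rw [hD.mapD_iterate_trans hU hret θ hxU hi', hD.iterate_trans hret θ hxU hi']
        exact ((hTd _ (hd ⟨i, hi'⟩)).sub_mem_iff (hdx ⟨i, hi'⟩) (h0d ⟨i, hi'⟩) _ _).2
          (congrFun hv1' ⟨i, hi'⟩).symm
    · have hDS : ∀ b, D θ '' S' b = S' b := hD.image_eq
        (fun y hy y' hy' => hΦ.mem_congr y (hUΦ hy) y' (hUΦ hy')) θ
      rw [← mapD_mem_stratTangent_iff hDS, map_sub]
      exact ((hTd' _ hd').sub_mem_iff hx' h0x' _ _).2 hv2'.symm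

/-- Induction on `d`. Near points of `S`, one more iterate is made transverse by shears, after the
points of `S` have been made not to return for `d` steps. -/
theorem IsStratification.dense_forall_orbitTransverse [FiniteDimensional ℝ E] [IsManifold I ∞ M]
    [LocallyCompactSpace M] [CompactSpace M]
    (hS : IsStratification I S ρ) (hS' : IsStratification I S' ρ')
    (hSS' : ∀ a b, TransverseSubmanifolds I (S a) (S' b)) (d : ℕ) :
    Dense {g : diffPreserving I S' | ∀ x, OrbitTransverse I S S' d g.1 x} := by
  induction d with
  | zero =>
    intro g
    refine subset_closure fun x w w' => ⟨w', fun i hi => absurd hi (Nat.not_lt_zero i), ?_⟩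
    rw [sub_self]
    exact zero_mem_stratTangent x
  | succ m ih =>
    obtain ⟨B, hB⟩ := hS'.bounded
    have hopen := hS.isOpen_forall_orbitTransverse (I := I) hS' m
    have h1 := ih.inter_of_isOpen_left (hS.dense_noReturn hS' hSS' m) hopen
    refine dense_iff_closure_eq.2 (univ_subset_iff.1 ?_)
    rw [← h1.closure_eq]
    refine closure_minimal ?_ isClosed_closure
    rintro g₀ ⟨hg₀, hret₀⟩
    refine mem_closure_of_local (hS.isOpen_orbitTransverse_subtype hS' (m + 1)) fun x₀ => ?_
    by_cases hx₀ : x₀ ∈ ⋃ a, S a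
    · obtain ⟨p, q, Φ, hΦ⟩ := hS.exists_isPatch hS' hB hSS' hx₀
      obtain ⟨U₁, hU₁, hg₁⟩ := exists_disjoint_iterates (hret₀ x₀ hx₀)
      have hUo := isOpen_interior (s := U₁) |>.inter Φ.open_source
      obtain ⟨C, ε, D, hC, hxC, hCU, hε, hD⟩ := exists_isShearFamily hΦ.toIsSmoothChart hUo
        ⟨mem_interior_iff_mem_nhds.2 hU₁, hΦ.mem_source⟩ inter_subset_right
      set U := interior U₁ ∩ Φ.source with hU
      refine ⟨C, hC.mem_nhds hxC, ?_⟩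
      filter_upwards [continuous_subtype_val.continuousAt.eventually hg₁,
        hopen.mem_nhds hg₀] with g₁ hg₁ hg₁m
      have hdisj : ∀ i, 1 ≤ i → i < m → ∀ x ∈ U, (⇑g₁.1)^[i] x ∉ U :=
        fun i hi hi' x hx hx' => hg₁ i hi hi' x (interior_subset hx.1) (interior_subset hx'.1)
      obtain ⟨Θ, hΘ, hgood⟩ := hΦ.exists_dense_orbitTransverse hS hS' hx₀ hD hUo hC hCU
        inter_subset_right g₁.2.2 hdisj hg₁m
      refine hD.mem_closure hε (fun y hy y' hy' => hΦ.mem_congr y hy.2 y' hy'.2) (hΘ 0) ?_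
      filter_upwards [Metric.ball_mem_nhds _ hε, Metric.ball_mem_nhds _ one_pos]
        with θ hθ hθ1 hθΘ _ x hx
      exact hgood θ hθΘ hθ ((norm_snd_le θ).trans_lt (mem_ball_zero_iff.1 hθ1)) x hx
    · refine ⟨(⋃ a, S a)ᶜ, hS.isCompact.isClosed.isOpen_compl.mem_nhds hx₀, ?_⟩
      filter_upwards [hopen.mem_nhds hg₀] with g₁ hg₁
      exact subset_closure fun x hx => orbitTransverse_succ_of_notMem g₁.2.2 hx (hg₁ _)

end Manifold

/-! ### Genericity of the transversality of iterates -/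

section Manifold

variable {E : Type*} [NormedAddCommGroup E] [NormedSpace ℝ E]
  {H : Type*} [TopologicalSpace H] {I : ModelWithCorners ℝ E H}
  {M : Type*} [TopologicalSpace M] [ChartedSpace H M]

theorem IsCompactSubmanifold.isStratification {N : Set M} (hN : IsCompactSubmanifold I N) :
    IsStratification I (fun _ : Unit => N) (fun _ => 0) where
  isCompact := by simpa only [iUnion_const] using hN.1
  bounded := ⟨1, fun _ _ => one_pos⟩
  exists_chart a x hx := by
    obtain ⟨p, r, -, Φ, ⟨hxΦ, -, h1, h2⟩, h⟩ := hN.2 x hx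
    refine ⟨p, r, Φ, hxΦ, ⟨⟨h1, h2⟩, h, fun y hy y' hy' he _ => ?_⟩, fun _ _ _ _ => Or.inl rfl⟩
    rw [h y hy, h y' hy', he]

/-- The strata are ordered by their dimensions. -/
theorem IsConicalSubmanifold.isStratification {S : ℕ → Set M} (hS : IsConicalSubmanifold I S) :
    IsStratification I S id where
  isCompact := hS.1
  bounded := ⟨finrank ℝ E, fun p ⟨x, hx⟩ => by
    obtain ⟨r, hr, -⟩ := hS.2 p x hx
    simp only [id]
    omega⟩
  exists_chart p x hx := by
    obtain ⟨r, -, L, Φ, -, ⟨hxΦ, -, h1, h2⟩, h⟩ := hS.2 p x hx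
    refine ⟨p, r, Φ, hxΦ, ⟨⟨h1, h2⟩, fun y hy => (h y hy).2.1, fun y hy y' hy' he b => ?_⟩,
      fun y hy b hb => ?_⟩
    · rcases lt_trichotomy b p with hb | rfl | hb
      · exact iff_of_false ((h y hy).1 b hb) ((h y' hy').1 b hb)
      · rw [(h y hy).2.1, (h y' hy').2.1, he]
      · obtain ⟨i, rfl⟩ := Nat.exists_eq_add_of_le hb
        rw [(h y hy).2.2 i, (h y' hy').2.2 i, he]
    · rcases lt_trichotomy b p with hlt | heq | hlt
      · exact absurd hb ((h y hy).1 b hlt)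
      · exact Or.inl heq
      · exact Or.inr hlt

/-- The transversality of the iterates is generic, for stratified sets. -/
theorem IsStratification.generic_iteratesTransverse [FiniteDimensional ℝ E] [T2Space M]
    [CompactSpace M] [IsManifold I ∞ M] {ι ι' : Type*} [Countable ι] [Countable ι']
    {S : ι → Set M} {ρ : ι → ℕ} {S' : ι' → Set M} {ρ' : ι' → ℕ} (hS : IsStratification I S ρ)
    (hS' : IsStratification I S' ρ') (hSS' : ∀ a b, TransverseSubmanifolds I (S a) (S' b)) :
    (∀ᶠ g in residual (diffPreserving I S'), ∀ d : ℕ, IteratesTransverse I S S' d g.1) ∧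
      ∀ d : ℕ, IsOpen {g : diffPreserving I S' | IteratesTransverse I S S' d g.1} ∧
        Dense {g : diffPreserving I S' | IteratesTransverse I S S' d g.1} := by
  have : SecondCountableTopology H := I.secondCountableTopology
  have : SecondCountableTopology M := ChartedSpace.secondCountable_of_sigmaCompact H M
  have key : ∀ d : ℕ, IsOpen {g : diffPreserving I S' | IteratesTransverse I S S' d g.1} ∧
      Dense {g : diffPreserving I S' | IteratesTransverse I S S' d g.1} := by
    intro d
    have h : {g : diffPreserving I S' | IteratesTransverse I S S' d g.1} =
        {g | ∀ x, OrbitTransverse I S S' d g.1 x} :=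
      ext fun g => iteratesTransverse_iff hS hS' g.2.2 d
    rw [h]
    exact ⟨hS.isOpen_forall_orbitTransverse hS' d, hS.dense_forall_orbitTransverse hS' hSS' d⟩
  exact ⟨eventually_countable_forall.2 fun d => residual_of_dense_open (key d).1 (key d).2, key⟩

end Manifold

end IterateTransversality

end

open IterateTransversality in
/-- The first part is about compact submanifolds `N`, `N'` (each with itself as its only stratum), the
second one about compact submanifolds `S`, `S'` with conical singularities. -/
theorem lemma4p3
    {E : Type*} [NormedAddCommGroup E] [NormedSpace ℝ E] [FiniteDimensional ℝ E]
    {H : Type*} [TopologicalSpace H] (I : ModelWithCorners ℝ E H)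
    {M : Type*} [TopologicalSpace M] [T2Space M] [CompactSpace M] [ChartedSpace H M]
    [IsManifold I ∞ M] :
    (∀ N N' : Set M, IsCompactSubmanifold I N → IsCompactSubmanifold I N' →
      TransverseSubmanifolds I N N' →
      (∀ᶠ g in residual (diffPreserving I (fun _ : Unit => N')),
        ∀ d : ℕ, IteratesTransverse I (fun _ : Unit => N) (fun _ : Unit => N') d g.1) ∧
      ∀ d : ℕ,
        IsOpen {g : diffPreserving I (fun _ : Unit => N') |
          IteratesTransverse I (fun _ : Unit => N) (fun _ : Unit => N') d g.1} ∧
        Dense {g : diffPreserving I (fun _ : Unit => N') |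
          IteratesTransverse I (fun _ : Unit => N) (fun _ : Unit => N') d g.1}) ∧
    (∀ S S' : ℕ → Set M, IsConicalSubmanifold I S → IsConicalSubmanifold I S' →
      (∀ p q, TransverseSubmanifolds I (S p) (S' q)) →
      (∀ᶠ g in residual (diffPreserving I S'), ∀ d : ℕ, IteratesTransverse I S S' d g.1) ∧
      ∀ d : ℕ,
        IsOpen {g : diffPreserving I S' | IteratesTransverse I S S' d g.1} ∧
        Dense {g : diffPreserving I S' | IteratesTransverse I S S' d g.1}) := by
  refine ⟨fun N N' hN hN' hNN' => ?_, fun S S' hS hS' hSS' => ?_⟩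
  · exact hN.isStratification.generic_iteratesTransverse hN'.isStratification fun _ _ => hNN'
  · exact hS.isStratification.generic_iteratesTransverse hS'.isStratification hSS'
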